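/- **Setting.** Let $(X,d)$ be a complete separable metric space and $\varphi:[0,\infty)\to[0,\infty]$ a continuous decreasing function, finite on $(0,\infty)$; write $\varphi(x,y)=\varphi(d(x,y))$. For a Borel measure $\mu$ put $I_\varphi(\mu)=\iint\varphi(x,y)\,d\mu(x)\,d\mu(y)$, and for a Borel set $K$ put $C_\varphi(K)=\sup\{I_\varphi(\mu)^{-1}:\mu\text{ a Borel probability measure on }K\}$. For $k\ge1$ let $\mathcal Q_k$ be a countable family of pairwise disjoint Borel subsets of $X$ such that $\sup_{Q\in\mathcal Q_k}\operatorname{diam}Q\to0$ and every $Q\in\mathcal Q_k$ with $k>1$ is contained in a unique $D\in\mathcal Q_{k-1}$; let $X_0=\bigcap_{k}\bigcup_{Q\in\mathcal Q_k}Q$. Let $(\Omega,\mathcal A,P)$ be a probability space and $B=B_\omega\subseteq X$ a random closed set such that $\{B\cap K\ne\emptyset\}\in\mathcal A$ for $K$ compact and for $K\in\mathcal Q_k$, and $P(B\cap Q\neq\emptyset)>0$ for $Q\in\mathcal Q_k$. Put $$\mathcal C_k(\nu)=\sum_{Q\in\mathcal Q_k}P(Q\cap B\ne\emptyset)^{-1}\,1_{\{Q\cap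 B\neq\emptyset\}}\;\nu|_Q .$$ **Regular part.** Every locally finite Borel measure $\nu$ on $X$ is uniquely a sum $\nu=\nu_R+\nu_\perp$ of two mutually singular locally finite Borel measures such that $\nu_\perp$ is singular to every locally finite Borel measure of finite $\varphi$-energy and $\nu_R=\nu|_{\bigcup_n A_n}=\sum_n\nu|_{A_n}$ for disjoint Borel sets $A_n$ with $I_\varphi(\nu|_{A_n})<\infty$. **Conditional measure.** Let $\nu$ be a finite Borel measure. A random finite Borel measure $\mathcal C(\nu)$ is *the conditional measure of $\nu$ on $B$* (with respect to $\mathcal Q_k$, with regularity kernel $\varphi$) if the following hold, where a statement about $\mathcal C(\eta)$ for another measure $\eta$ includes that the conditional measure of $\eta$ exists: * (i) every subsequence of $(\mathcal C_k(\nu))_k$ has a further subsequence that almost surely converges weakly to $\mathcal C(\nu)$; * (ii) for every Borel $f\in L^1(\nu)$, $\int f\,d\mathcal C_k(\nu)$ converges in probability to a random variable $S(f)$, and $E\int f\,d\mathcal C(\nu)=E\,S(f)=\int f\,d\nu_R$; * (iii) for all Borel $f_1,f_2,\dots\in L^1(\nu)$, almost surely $\int f_n\,d\mathcal C(\nu)=S(f_n)$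 for all $n$; * (iv) for all Borel $A_1,A_2,\dots$ with $\nu(A_n)<\infty$, almost surely $S(\chi_{A_n})=\mathcal C(\nu)(A_n)$ for all $n$; * (v) $E\,\mathcal C(\nu)(A)=E\,S(\chi_A)=\nu_R(A)\le\nu(A)$ for Borel $A$ with $\nu(A)<\infty$; * (vi) $\mathcal C_k(\nu_R)(A)\to\mathcal C(\nu)(A)$ in $L^1$ for Borel $A$ with $\nu(A)<\infty$; * (vii) $\mathcal C(\nu_\perp)=0$ a.s.; * (viii) $\mathcal C(\nu)=\mathcal C(\nu_R)$ a.s.; * (ix) if $\nu=\sum_{i\ge1}\nu^i$ with locally finite Borel measures $\nu^i$, then $\mathcal C(\nu)=\sum_i\mathcal C(\nu^i)$ a.s.; * (x) $\mathcal C(f\,d\nu)=f\,d\mathcal C(\nu)$ a.s. for every Borel $f\ge0$ with $\int f\,d\nu<\infty$; * (xi) $\operatorname{supp}\mathcal C(\nu)\subseteq\operatorname{supp}\nu\cap B$ a.s. If $X$ is locally compact and $\nu$ is locally finite, the conditional measure is a random locally finite Borel measure $\mathcal C(\nu)$ with (ii)–(ix), (xi) and, instead of (i) and (x): (i*) $\int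 f\,d\mathcal C_k(\nu)\to\int f\,d\mathcal C(\nu)$ in probability for every continuous compactly supported $f$; (x*) $\mathcal C(f\,d\nu)=f\,d\mathcal C(\nu)$ a.s. for every Borel $f\ge0$ that is $\nu$-integrable on a neighbourhood of each point. **Kernels.** For $x\in X$ let $Q_k(x)$ be the element of $\mathcal Q_k$ containing $x$, or $\emptyset$ if there is none. Let $$F_{k,n}(x,y)=\frac{P(Q_k(x)\cap B\ne\emptyset\text{ and }Q_n(y)\cap B\neq\emptyset)}{P(Q_k(x)\cap B\ne\emptyset)\,P(Q_n(y)\cap B\ne\emptyset)}$$ if $Q_k(x)\ne\emptyset\neq Q_n(y)$, and $F_{k,n}(x,y)=0$ otherwise. Let $\overline F=\lim_N\sup_{k,n\ge N}F_{k,n}$ and $\underline F=\lim_N\inf_{k,n\ge N}F_{k,n}$. **Theorem.** Assume that * $\varphi(0)=\infty$; * there is $0<M<\infty$ with $0<\operatorname{diam}(Q)/M\le\operatorname{diam}(S)\le M\operatorname{diam}(Q)<\infty$ for all $k$ and all $Q,S\in\mathcal Q_k$; * there is $a>0$ with $a\,C_\varphi(Q)\le P(Q\cap B\neq\emptyset)$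 for all $k$ and all $Q\in\mathcal Q_k$; * there is $0<\delta<1$ such that: * for some $c_2,c_3<\infty$, $\varphi(r)\le c_2\,\varphi(r(1+2\delta))+c_3$ for all $r>0$; * for some $0<c<\infty$, whenever $Q\in\mathcal Q_k$, $S\in\mathcal Q_n$ and $\max\{\operatorname{diam}Q,\operatorname{diam}S\}<\delta\operatorname{dist}(Q,S)$, one has $P(Q\cap B\neq\emptyset\text{ and }S\cap B\ne\emptyset)\le c\,P(Q\cap B\ne\emptyset)\,P(S\cap B\neq\emptyset)\,\varphi(\operatorname{dist}(Q,S))$; * for some $M_\delta<\infty$, $\#\{S\in\mathcal Q_k:\max\{\operatorname{diam}Q,\operatorname{diam}S\}\ge\delta\operatorname{dist}(Q,S)\}\le M_\delta$ for all $k$ and all $Q\in\mathcal Q_k$; * $F:=\underline F=\overline F$ everywhere on $X\times X$; * $B\cap D=\emptyset$ almost surely for every compact $D\subseteq X_0$ with $C_\varphi(D)=0$. Let $\nu,\tau$ be finite Borel measures on $X$, or let $X$ be locally compact and $\nu,\tau$ locally finite Borel measures on $X$; assume $\nu(X\setminus X_0)=\tau(X\setminus X_0)=0$. Then the conditional measures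 $\mathcal C(\nu)$ and $\mathcal C(\tau)$ on $B$ exist, and $$E\left(\iint f(x,y)\,d\mathcal C(\nu)(x)\,d\mathcal C(\tau)(y)\right)=\iint F(x,y)f(x,y)\,d\nu_R(x)\,d\tau_R(y)$$ for every Borel function $f:X\times X\to\mathbb R$ with $\iint F(x,y)|f(x,y)|\,d\nu_R(x)\,d\tau_R(y)<\infty$, in particular for every Borel $f$ with $\iint\varphi(x,y)|f(x,y)|\,d\nu(x)\,d\tau(y)<\infty$. -/

import Mathlib

open MeasureTheory Filter Topology Set
open scoped NNReal ENNReal BoundedContinuousFunction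

noncomputable section

namespace CondMeas

/-! ### Kernels, energy, capacity -/

section Potential

variable {X : Type*} [MetricSpace X] [MeasurableSpace X]

/-- A regularity kernel: a nonnegative, continuous, monotone decreasing function
`[0, ∞) → [0, ∞]` with finite values on `(0, ∞)`. The associated kernel on `X × X` is
`φ (nndist x y)`. -/
structure IsRegularityKernel (φ : ℝ≥0 → ℝ≥0∞) : Prop where
  continuous : Continuous φ
  antitone : Antitone φ
  lt_top : ∀ r : ℝ≥0, 0 < r → φ r < ∞

/-- The `φ`-energy `∫∫ φ(x,y) dμ(x) dμ(y)`. -/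
def energy (φ : ℝ≥0 → ℝ≥0∞) (μ : Measure X) : ℝ≥0∞ :=
  ∫⁻ y, ∫⁻ x, φ (nndist x y) ∂μ ∂μ

/-- The `φ`-capacity of `K`: the supremum of `I_φ(μ)⁻¹` over the Borel probability measures `μ`
on `K`. -/
def capacity (φ : ℝ≥0 → ℝ≥0∞) (K : Set X) : ℝ≥0∞ :=
  ⨆ (μ : Measure X) (_ : IsProbabilityMeasure μ) (_ : μ Kᶜ = 0), (energy φ μ)⁻¹

/-- `dist(Q, S) = inf {d(x,y) : x ∈ Q, y ∈ S}`, for nonempty `Q` and `S`. -/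
def setDist (Q S : Set X) : ℝ≥0 := ⨅ p : Q × S, nndist (p.1 : X) (p.2 : X)

/-! ### The decomposition into regular and singular part -/

/-- `(νR, νS)` is the decomposition of `ν` into its `φ`-regular and `φ`-singular part. -/
structure IsRegularDecomposition (φ : ℝ≥0 → ℝ≥0∞) (ν νR νS : Measure X) : Prop where
  locallyFinite_regular : IsLocallyFiniteMeasure νR
  locallyFinite_singular : IsLocallyFiniteMeasure νS
  eq_add : ν = νR + νS
  mutuallySingular : νR ⟂ₘ νS
  singular : ∀ μ : Measure X, IsLocallyFiniteMeasure μ → energy φ μ < ∞ → νS ⟂ₘ μ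
  exists_pieces : ∃ A : ℕ → Set X, (∀ n, MeasurableSet (A n)) ∧ Pairwise (Function.onFun Disjoint A) ∧
    νR = ν.restrict (⋃ n, A n) ∧ νR = Measure.sum (fun n => ν.restrict (A n)) ∧
    ∀ n, energy φ (ν.restrict (A n)) < ∞

theorem energy_mono (φ : ℝ≥0 → ℝ≥0∞) {μ ν : Measure X} (h : μ ≤ ν) :
    energy φ μ ≤ energy φ ν :=
  lintegral_mono' h fun _ => lintegral_mono' h le_rfl

theorem energy_smul_lt_top (φ : ℝ≥0 → ℝ≥0∞) {μ : Measure X} (h : energy φ μ < ∞) (n : ℕ) :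
    energy φ ((n : ℝ≥0∞) • μ) < ∞ := by
  unfold energy at h ⊢
  simp only [lintegral_smul_measure, smul_eq_mul]
  rw [lintegral_const_mul' _ _ (ENNReal.natCast_ne_top n)]
  exact ENNReal.mul_lt_top (ENNReal.natCast_lt_top n)
    (ENNReal.mul_lt_top (ENNReal.natCast_lt_top n) h)

/-- Among the countable unions of sets on which `ν` has finite energy there is a largest one, up to
null sets. -/
theorem exists_max_pieces (φ : ℝ≥0 → ℝ≥0∞) (ν : Measure X) [SigmaFinite ν] :
    ∃ D : ℕ → Set X, (∀ n, MeasurableSet (D n)) ∧ (∀ n, energy φ (ν.restrict (D n)) < ∞) ∧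
      ∀ E : Set X, MeasurableSet E → energy φ (ν.restrict E) < ∞ → ν (E \ ⋃ n, D n) = 0 := by
  classical
  let T : Set (ℕ → Set X) :=
    {D | (∀ n, MeasurableSet (D n)) ∧ ∀ n, energy φ (ν.restrict (D n)) < ∞}
  let m := ν.toFinite
  have hne : T.Nonempty := ⟨fun _ => ∅, fun _ => MeasurableSet.empty, fun _ => by simp [energy]⟩
  obtain ⟨u, -, hu, hmem⟩ :=
    exists_seq_tendsto_sSup (hne.image fun D : ℕ → Set X => m (⋃ n, D n)) (OrderTop.bddAbove _)
  choose D hDT hDu using hmem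
  let V : ℕ → Set X := fun k => D k.unpair.1 k.unpair.2
  have hVT : V ∈ T := ⟨fun k => (hDT _).1 _, fun k => (hDT _).2 _⟩
  have hle : ∀ i, ⋃ n, D i n ⊆ ⋃ n, V n := fun i =>
    iUnion_subset fun n => by
      have : D i n = V (Nat.pair i n) := by simp [V]
      rw [this]; exact subset_iUnion V _
  have hsup : sSup ((fun D : ℕ → Set X => m (⋃ n, D n)) '' T) ≤ m (⋃ n, V n) :=
    le_of_tendsto' hu fun i => by rw [← hDu i]; exact measure_mono (hle i)
  refine ⟨V, hVT.1, hVT.2, fun E hE hfin => ?_⟩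
  have hW : (fun n => Nat.casesOn n E V : ℕ → Set X) ∈ T :=
    ⟨fun n => by cases n with
      | zero => exact hE
      | succ k => exact hVT.1 k,
     fun n => by cases n with
      | zero => exact hfin
      | succ k => exact hVT.2 k⟩
  have h1 : m ((⋃ n, V n) ∪ (E \ ⋃ n, V n)) ≤ m (⋃ n, V n) := by
    refine le_trans (measure_mono ?_) ((le_sSup (mem_image_of_mem _ hW)).trans hsup)
    refine union_subset (iUnion_subset fun n => ?_) (sdiff_subset.trans ?_)
    · exact subset_iUnion (fun n => Nat.casesOn n E V : ℕ → Set X) (n + 1)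
    · exact subset_iUnion (fun n => Nat.casesOn n E V : ℕ → Set X) 0
  have hVm : MeasurableSet (⋃ n, V n) := MeasurableSet.iUnion hVT.1
  rw [measure_union disjoint_sdiff_right (hE.diff hVm)] at h1
  have h2 : m (E \ ⋃ n, V n) = 0 := by
    by_contra h0
    exact absurd h1 (not_le.2 (ENNReal.lt_add_right (measure_ne_top _ _) h0))
  exact toFinite_apply_eq_zero_iff.1 h2

/-- Every locally finite Borel measure has a regular and a singular part. -/
theorem exists_isRegularDecomposition [SecondCountableTopology X] [BorelSpace X]
    (φ : ℝ≥0 → ℝ≥0∞) (ν : Measure X) [IsLocallyFiniteMeasure ν] :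
    ∃ p : Measure X × Measure X, IsRegularDecomposition φ ν p.1 p.2 := by
  obtain ⟨D, hDm, hDe, hmax⟩ := exists_max_pieces φ ν
  have hUm : MeasurableSet (⋃ n, D n) := MeasurableSet.iUnion hDm
  refine ⟨(ν.restrict (⋃ n, D n), ν.restrict (⋃ n, D n)ᶜ), ?_⟩
  refine ⟨inferInstance, inferInstance, (Measure.restrict_add_restrict_compl hUm).symm,
    ⟨(⋃ n, D n)ᶜ, hUm.compl, ?_, ?_⟩, ?_, disjointed D, MeasurableSet.disjointed hDm,
    disjoint_disjointed D, ?_, ?_, ?_⟩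
  · rw [Measure.restrict_apply hUm.compl, compl_inter_self, measure_empty]
  · rw [compl_compl, Measure.restrict_apply hUm, inter_compl_self, measure_empty]
  · intro μ hμ he
    set σ := ν.restrict (⋃ n, D n)ᶜ with hσ
    obtain ⟨s, hs, hs1, hs2⟩ := Measure.mutuallySingular_singularPart σ μ
    set g := σ.rnDeriv μ with hg
    have hgm : Measurable g := Measure.measurable_rnDeriv σ μ
    have hdec : σ = σ.singularPart μ + μ.withDensity g := Measure.haveLebesgueDecomposition_add σ μ
    have hnull : ∀ n : ℕ, σ ({x | g x ≤ n} ∩ s) = 0 := by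
      intro n
      have hEm : MeasurableSet ({x | g x ≤ n} ∩ s) :=
        (measurableSet_le hgm measurable_const).inter hs
      have hEm' : MeasurableSet (({x | g x ≤ n} ∩ s) ∩ (⋃ n, D n)ᶜ) := hEm.inter hUm.compl
      have hle : ν.restrict (({x | g x ≤ n} ∩ s) ∩ (⋃ n, D n)ᶜ) ≤ (n : ℝ≥0∞) • μ := by
        rw [← Measure.restrict_restrict hEm, ← hσ]
        refine Measure.le_iff.2 fun t ht => ?_
        rw [Measure.restrict_apply ht, hdec, Measure.add_apply,
          measure_mono_null (inter_subset_right.trans inter_subset_right) hs1, zero_add,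
          withDensity_apply _ (ht.inter hEm)]
        calc ∫⁻ x in t ∩ ({x | g x ≤ n} ∩ s), g x ∂μ
            ≤ ∫⁻ _ in t ∩ ({x | g x ≤ n} ∩ s), (n : ℝ≥0∞) ∂μ :=
              setLIntegral_mono measurable_const fun x hx => hx.2.1
          _ = n * μ (t ∩ ({x | g x ≤ n} ∩ s)) := by simp
          _ ≤ ((n : ℝ≥0∞) • μ) t := by
              rw [Measure.smul_apply, smul_eq_mul]
              gcongr
              exact inter_subset_left
      have h0 := hmax _ hEm' ((energy_mono φ hle).trans_lt (energy_smul_lt_top φ he n))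
      rw [hσ, Measure.restrict_apply hEm]
      refine measure_mono_null ?_ h0
      exact fun x hx => ⟨hx, hx.2⟩
    have hsσ : σ s = 0 := by
      have hfin : ∀ᵐ x ∂μ, g x < ∞ := Measure.rnDeriv_lt_top σ μ
      have hsub : s ⊆ (⋃ n : ℕ, ({x | g x ≤ n} ∩ s)) ∪ ({x | ¬ g x < ∞} ∩ s) := by
        intro x hx
        by_cases h : g x < ∞
        · obtain ⟨n, hn⟩ := ENNReal.exists_nat_gt h.ne
          exact Or.inl (mem_iUnion.2 ⟨n, hn.le, hx⟩)
        · exact Or.inr ⟨h, hx⟩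
      refine measure_mono_null hsub (measure_union_null (measure_iUnion_null hnull) ?_)
      rw [hdec, Measure.add_apply, measure_mono_null inter_subset_right hs1, zero_add]
      exact withDensity_absolutelyContinuous μ g
        (measure_mono_null inter_subset_left (ae_iff.1 hfin))
    exact ⟨s, hs, hsσ, hs2⟩
  · rw [iUnion_disjointed]
  · rw [← Measure.restrict_iUnion (disjoint_disjointed D) (MeasurableSet.disjointed hDm),
      iUnion_disjointed]
  · exact fun n => (energy_mono φ (Measure.restrict_mono (disjointed_subset D n) le_rfl)).trans_lt
      (hDe n)

open Classical in
/-- The `φ`-regular part of `ν` (for locally finite `ν`, see `isRegularDecomposition_parts`). -/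
def regularPart (φ : ℝ≥0 → ℝ≥0∞) (ν : Measure X) : Measure X :=
  if h : ∃ p : Measure X × Measure X, IsRegularDecomposition φ ν p.1 p.2 then h.choose.1 else 0

open Classical in
/-- The `φ`-singular part of `ν` (for locally finite `ν`, see `isRegularDecomposition_parts`). -/
def singularPart (φ : ℝ≥0 → ℝ≥0∞) (ν : Measure X) : Measure X :=
  if h : ∃ p : Measure X × Measure X, IsRegularDecomposition φ ν p.1 p.2 then h.choose.2 else 0

theorem isRegularDecomposition_parts [SecondCountableTopology X] [BorelSpace X]
    (φ : ℝ≥0 → ℝ≥0∞) (ν : Measure X) [IsLocallyFiniteMeasure ν] :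
    IsRegularDecomposition φ ν (regularPart φ ν) (singularPart φ ν) := by
  have h := exists_isRegularDecomposition φ ν
  simp only [regularPart, singularPart, dif_pos h]
  exact h.choose_spec

end Potential

/-! ### The partitions and the random closed set -/

section Setting

variable {X : Type*} [MetricSpace X] [MeasurableSpace X]
variable {Ω : Type*} [MeasurableSpace Ω]

/-- A sequence of countable families of disjoint Borel sets, indexed from `0` (so `𝒬 k` stands for
the usual `𝒬_{k+1}`, `k + 1 ≥ 1`): the diameters tend uniformly to zero, and each member of a family lies in exactly
one member of the preceding family. -/
structure IsPartitionSequence (𝒬 : ℕ → Set (Set X)) : Prop where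
  countable : ∀ k, (𝒬 k).Countable
  measurableSet : ∀ k, ∀ Q ∈ 𝒬 k, MeasurableSet Q
  disjoint : ∀ k, ∀ Q ∈ 𝒬 k, ∀ S ∈ 𝒬 k, Q ≠ S → Q ∩ S = ∅
  tendsto_diam : Tendsto (fun k => ⨆ Q ∈ 𝒬 k, Metric.ediam Q) atTop (𝓝 0)
  nested : ∀ k, ∀ Q ∈ 𝒬 (k + 1), ∃! D, D ∈ 𝒬 k ∧ Q ⊆ D

/-- `X₀ = ⋂ₖ ⋃_{Q ∈ 𝒬ₖ} Q`. -/
def coreSet (𝒬 : ℕ → Set (Set X)) : Set X := ⋂ k, ⋃₀ 𝒬 k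

/-- The event `{A ∩ B ≠ ∅}`. -/
def hit (B : Ω → Set X) (A : Set X) : Set Ω := {ω | (A ∩ B ω).Nonempty}

/-- `B` is a random closed set such that the events that `B` hits a compact set, or a member of
one of the families `𝒬 k`, are measurable, the latter with positive probability. -/
structure IsRandomClosedSet (P : Measure Ω) (𝒬 : ℕ → Set (Set X)) (B : Ω → Set X) : Prop where
  isClosed : ∀ ω, IsClosed (B ω)
  measurableSet_hit_compact : ∀ K : Set X, IsCompact K → MeasurableSet (hit B K)
  measurableSet_hit : ∀ k, ∀ Q ∈ 𝒬 k, MeasurableSet (hit B Q)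
  hit_pos : ∀ k, ∀ Q ∈ 𝒬 k, 0 < P (hit B Q)

/-- `𝒞ₖ(ν) = ∑_{Q ∈ 𝒬ₖ} P(Q ∩ B ≠ ∅)⁻¹ · 1_{Q ∩ B ≠ ∅} · ν|_Q`, a random measure. -/
def approxCond (P : Measure Ω) (𝒬 : ℕ → Set (Set X)) (B : Ω → Set X) (k : ℕ) (ν : Measure X)
    (ω : Ω) : Measure X :=
  Measure.sum fun Q : 𝒬 k =>
    ((P (hit B (Q : Set X)))⁻¹ * (hit B (Q : Set X)).indicator (fun _ => (1 : ℝ≥0∞)) ω) •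
      ν.restrict (Q : Set X)

open Classical in
/-- The member of `𝒬 k` that contains `x`, or `∅` if there is none. -/
def cell (𝒬 : ℕ → Set (Set X)) (k : ℕ) (x : X) : Set X :=
  if h : ∃ Q ∈ 𝒬 k, x ∈ Q then h.choose else ∅

open Classical in
/-- The kernel `F_{k,n}`. -/
def kernelF (P : Measure Ω) (𝒬 : ℕ → Set (Set X)) (B : Ω → Set X) (k n : ℕ) (x y : X) : ℝ≥0∞ :=
  if cell 𝒬 k x ≠ ∅ ∧ cell 𝒬 n y ≠ ∅ then
    P (hit B (cell 𝒬 k x) ∩ hit B (cell 𝒬 n y)) /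
      (P (hit B (cell 𝒬 k x)) * P (hit B (cell 𝒬 n y)))
  else 0

/-- `F̄(x,y) = lim_N sup_{k,n ≥ N} F_{k,n}(x,y)`. -/
def upperF (P : Measure Ω) (𝒬 : ℕ → Set (Set X)) (B : Ω → Set X) (x y : X) : ℝ≥0∞ :=
  limsup (fun N : ℕ => ⨆ (k : ℕ) (_ : N ≤ k) (n : ℕ) (_ : N ≤ n), kernelF P 𝒬 B k n x y) atTop

/-- `F̲(x,y) = lim_N inf_{k,n ≥ N} F_{k,n}(x,y)`. -/
def lowerF (P : Measure Ω) (𝒬 : ℕ → Set (Set X)) (B : Ω → Set X) (x y : X) : ℝ≥0∞ :=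
  liminf (fun N : ℕ => ⨅ (k : ℕ) (_ : N ≤ k) (n : ℕ) (_ : N ≤ n), kernelF P 𝒬 B k n x y) atTop

/-! ### The special assumptions -/

/-- `φ(r) ≤ c₂ φ(r (1 + 2δ)) + c₃` for all `r > 0`. -/
def KernelRestriction (φ : ℝ≥0 → ℝ≥0∞) (δ : ℝ≥0) : Prop :=
  ∃ c₂ c₃ : ℝ≥0, ∀ r : ℝ≥0, 0 < r → φ r ≤ c₂ * φ (r * (1 + 2 * δ)) + c₃

/-- Every `Q ∈ 𝒬ₖ` has at most `M_δ` many `S ∈ 𝒬ₖ` with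
`max {diam Q, diam S} ≥ δ dist(Q,S)`. -/
def BoundedSubdivision (𝒬 : ℕ → Set (Set X)) (δ : ℝ≥0) : Prop :=
  ∃ Mδ : ℕ, ∀ k, ∀ Q ∈ 𝒬 k,
    {S ∈ 𝒬 k | ((δ * setDist Q S : ℝ≥0) : ℝ≥0∞) ≤
      max (Metric.ediam Q) (Metric.ediam S)}.encard ≤ Mδ

/-- `0 < diam(Q) / M ≤ diam(S) ≤ diam(Q) M < ∞` for all `Q, S` in the same family. -/
def SameSize (𝒬 : ℕ → Set (Set X)) : Prop :=
  ∃ M : ℝ≥0, 0 < M ∧ ∀ k, ∀ Q ∈ 𝒬 k, ∀ S ∈ 𝒬 k,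
    0 < Metric.ediam Q / M ∧ Metric.ediam Q / M ≤ Metric.ediam S ∧
      Metric.ediam S ≤ Metric.ediam Q * M ∧ Metric.ediam Q * M < ∞

/-- `a C_φ(Q) ≤ P(Q ∩ B ≠ ∅)` for all `Q`. -/
def LowerHitting (P : Measure Ω) (φ : ℝ≥0 → ℝ≥0∞) (𝒬 : ℕ → Set (Set X)) (B : Ω → Set X) : Prop :=
  ∃ a : ℝ≥0, 0 < a ∧ ∀ k, ∀ Q ∈ 𝒬 k, a * capacity φ Q ≤ P (hit B Q)

/-- `P(Q ∩ B ≠ ∅, S ∩ B ≠ ∅) ≤ c P(Q ∩ B ≠ ∅) P(S ∩ B ≠ ∅) φ(dist(Q,S))` whenever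
`max {diam Q, diam S} < δ dist(Q,S)`. -/
def CapacityIndependence (P : Measure Ω) (φ : ℝ≥0 → ℝ≥0∞) (𝒬 : ℕ → Set (Set X))
    (B : Ω → Set X) (δ : ℝ≥0) : Prop :=
  ∃ c : ℝ≥0, 0 < c ∧ ∀ k n, ∀ Q ∈ 𝒬 k, ∀ S ∈ 𝒬 n,
    max (Metric.ediam Q) (Metric.ediam S) < ((δ * setDist Q S : ℝ≥0) : ℝ≥0∞) →
      P (hit B Q ∩ hit B S) ≤ c * P (hit B Q) * P (hit B S) * φ (setDist Q S)

/-! ### Convergence of random measures -/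

/-- Weak convergence of finite measures. -/
def WeaklyConverges (μs : ℕ → Measure X) (μ : Measure X) : Prop :=
  (∀ j, IsFiniteMeasure (μs j)) ∧ IsFiniteMeasure μ ∧
    ∀ g : X →ᵇ ℝ, Tendsto (fun j => ∫ x, g x ∂μs j) atTop (𝓝 (∫ x, g x ∂μ))

/-- `M k` weakly converges to `N` subsequentially in probability: every subsequence has a further
subsequence along which almost surely the measures converge weakly. -/
def WeaklySubseqInProb (P : Measure Ω) (M : ℕ → Ω → Measure X) (N : Ω → Measure X) : Prop :=
  ∀ α : ℕ → ℕ, StrictMono α → ∃ β : ℕ → ℕ, StrictMono β ∧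
    ∀ᵐ ω ∂P, WeaklyConverges (fun j => M (α (β j)) ω) (N ω)

/-- `M k` vaguely converges to `N` in probability: the integrals of every compactly supported
continuous function converge in probability. -/
def VaguelyInProb (P : Measure Ω) (M : ℕ → Ω → Measure X) (N : Ω → Measure X) : Prop :=
  (∀ᵐ ω ∂P, ∀ k, IsLocallyFiniteMeasure (M k ω)) ∧
    ∀ g : X → ℝ, Continuous g → HasCompactSupport g →
      TendstoInMeasure P (fun k ω => ∫ x, g x ∂M k ω) atTop (fun ω => ∫ x, g x ∂N ω)

/-! ### The conditional measure

The defining properties of the conditional measure `𝒞(ν)` of `ν` speak about the conditional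
measures of other measures too (of the singular and the regular part of `ν`, of the summands of
`ν`, and of `f dν`). Therefore they are stated for a relation `R`, where `R η N` is read as
"`N` is the conditional measure `𝒞(η)` of `η`". -/

/-- The properties that are common to the finite and to the locally finite case. -/
structure CommonProperties (P : Measure Ω) (φ : ℝ≥0 → ℝ≥0∞) (𝒬 : ℕ → Set (Set X))
    (B : Ω → Set X) (R : Measure X → (Ω → Measure X) → Prop)
    (ν : Measure X) (N : Ω → Measure X) : Prop where
  /-- For `f ∈ L¹(ν)` the integrals `∫ f d𝒞ₖ(ν)` converge in probability to a random variable
  `S f`, which has the right expectation and which almost surely is `∫ f d𝒞(ν)`; in particular,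
  almost surely `S χ_A = 𝒞(ν)(A)`, with expectation `ν_R(A)`. -/
  exists_limit : ∃ S : (X → ℝ) → Ω → ℝ,
    (∀ f : X → ℝ, Measurable f → Integrable f ν →
      TendstoInMeasure P (fun k ω => ∫ x, f x ∂approxCond P 𝒬 B k ν ω) atTop (S f) ∧
      Integrable (S f) P ∧ Integrable (fun ω => ∫ x, f x ∂N ω) P ∧
      Integrable f (regularPart φ ν) ∧
      ∫ ω, ∫ x, f x ∂N ω ∂P = ∫ ω, S f ω ∂P ∧
      ∫ ω, S f ω ∂P = ∫ x, f x ∂regularPart φ ν) ∧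
    (∀ f : ℕ → X → ℝ, (∀ n, Measurable (f n) ∧ Integrable (f n) ν) →
      ∀ᵐ ω ∂P, ∀ n, Integrable (f n) (N ω) ∧ ∫ x, f n x ∂N ω = S (f n) ω) ∧
    (∀ A : ℕ → Set X, (∀ n, MeasurableSet (A n) ∧ ν (A n) < ∞) →
      ∀ᵐ ω ∂P, ∀ n, N ω (A n) < ∞ ∧ S ((A n).indicator fun _ => 1) ω = (N ω).real (A n)) ∧
    (∀ A : Set X, MeasurableSet A → ν A < ∞ →
      ∫⁻ ω, N ω A ∂P = regularPart φ ν A ∧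
      ∫ ω, S (A.indicator fun _ => 1) ω ∂P = (regularPart φ ν).real A ∧
      regularPart φ ν A ≤ ν A)
  /-- `𝒞ₖ(ν_R)(A) → 𝒞(ν)(A)` in `L¹`. -/
  tendsto_L1 : ∀ A : Set X, MeasurableSet A → ν A < ∞ →
    Tendsto (fun k => eLpNorm
      (fun ω => (approxCond P 𝒬 B k (regularPart φ ν) ω).real A - (N ω).real A) 1 P)
      atTop (𝓝 0)
  /-- `𝒞(ν_⊥) = 0` almost surely. -/
  singular_eq_zero : ∃ N' : Ω → Measure X, R (singularPart φ ν) N' ∧ ∀ᵐ ω ∂P, N' ω = 0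
  /-- `𝒞(ν) = 𝒞(ν_R)` almost surely. -/
  eq_regular : ∃ N' : Ω → Measure X, R (regularPart φ ν) N' ∧ ∀ᵐ ω ∂P, N ω = N' ω
  /-- `𝒞(∑ νⁱ) = ∑ 𝒞(νⁱ)` almost surely. -/
  eq_sum : ∀ νs : ℕ → Measure X, (∀ i, IsLocallyFiniteMeasure (νs i)) → ν = Measure.sum νs →
    ∃ Ns : ℕ → Ω → Measure X, (∀ i, R (νs i) (Ns i)) ∧
      ∀ᵐ ω ∂P, N ω = Measure.sum fun i => Ns i ω
  /-- `supp 𝒞(ν) ⊆ supp ν ∩ B` almost surely. -/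
  support_subset : ∀ᵐ ω ∂P, (N ω).support ⊆ ν.support ∩ B ω

/-- `R` is a relation all of whose pairs `(ν, 𝒞(ν))` have the defining properties of conditional
measures, for finite measures `ν`. -/
def IsFiniteConditionalSystem (P : Measure Ω) (φ : ℝ≥0 → ℝ≥0∞) (𝒬 : ℕ → Set (Set X))
    (B : Ω → Set X) (R : Measure X → (Ω → Measure X) → Prop) : Prop :=
  ∀ (ν : Measure X) (N : Ω → Measure X), R ν N →
    IsFiniteMeasure ν ∧ Measurable N ∧ (∀ ω, IsFiniteMeasure (N ω)) ∧
    WeaklySubseqInProb P (fun k ω => approxCond P 𝒬 B k ν ω) N ∧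
    CommonProperties P φ 𝒬 B R ν N ∧
    ∀ f : X → ℝ≥0, Measurable f → ∫⁻ x, f x ∂ν < ∞ →
      ∃ N' : Ω → Measure X, R (ν.withDensity fun x => f x) N' ∧
        ∀ᵐ ω ∂P, N' ω = (N ω).withDensity fun x => f x

/-- The random finite measure `N` is the conditional measure `𝒞(ν)` of the finite measure `ν` on
`B` with respect to `𝒬`, with regularity kernel `φ`. -/
def IsConditionalMeasure (P : Measure Ω) (φ : ℝ≥0 → ℝ≥0∞) (𝒬 : ℕ → Set (Set X))
    (B : Ω → Set X) (ν : Measure X) (N : Ω → Measure X) : Prop :=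
  ∃ R : Measure X → (Ω → Measure X) → Prop, IsFiniteConditionalSystem P φ 𝒬 B R ∧ R ν N

/-- `R` is a relation all of whose pairs `(ν, 𝒞(ν))` have the defining properties of conditional
measures, for locally finite measures `ν` (on a locally compact space). -/
def IsLocallyFiniteConditionalSystem (P : Measure Ω) (φ : ℝ≥0 → ℝ≥0∞) (𝒬 : ℕ → Set (Set X))
    (B : Ω → Set X) (R : Measure X → (Ω → Measure X) → Prop) : Prop :=
  ∀ (ν : Measure X) (N : Ω → Measure X), R ν N →
    IsLocallyFiniteMeasure ν ∧ Measurable N ∧ (∀ ω, IsLocallyFiniteMeasure (N ω)) ∧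
    VaguelyInProb P (fun k ω => approxCond P 𝒬 B k ν ω) N ∧
    CommonProperties P φ 𝒬 B R ν N ∧
    ∀ f : X → ℝ≥0, Measurable f → (∀ y, ∃ U ∈ 𝓝 y, ∫⁻ x in U, f x ∂ν < ∞) →
      ∃ N' : Ω → Measure X, R (ν.withDensity fun x => f x) N' ∧
        ∀ᵐ ω ∂P, N' ω = (N ω).withDensity fun x => f x

/-- The random locally finite measure `N` is the conditional measure `𝒞(ν)` of the locally finite
measure `ν` on `B` with respect to `𝒬`, with regularity kernel `φ` (on a locally compact space). -/
def IsConditionalMeasureLoc (P : Measure Ω) (φ : ℝ≥0 → ℝ≥0∞) (𝒬 : ℕ → Set (Set X))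
    (B : Ω → Set X) (ν : Measure X) (N : Ω → Measure X) : Prop :=
  ∃ R : Measure X → (Ω → Measure X) → Prop, IsLocallyFiniteConditionalSystem P φ 𝒬 B R ∧ R ν N

/-- `E (∫∫ f(x,y) dM(x) dN(y)) = ∫∫ F(x,y) f(x,y) dνR(x) dτR(y)` for every Borel function `f` with
`∫∫ F(x,y) |f(x,y)| dνR(x) dτR(y) < ∞`, all integrals being well defined. -/
def DoubleIntegralFormula (P : Measure Ω) (F : X → X → ℝ≥0∞) (νR τR : Measure X)
    (M N : Ω → Measure X) : Prop :=
  ∀ f : X × X → ℝ, Measurable f → ∫⁻ y, ∫⁻ x, F x y * ‖f (x, y)‖ₑ ∂νR ∂τR < ∞ →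
    Integrable (fun z : X × X => (F z.1 z.2).toReal * f z) (νR.prod τR) ∧
    (∀ᵐ ω ∂P, Integrable f ((M ω).prod (N ω))) ∧
    Integrable (fun ω => ∫ y, ∫ x, f (x, y) ∂M ω ∂N ω) P ∧
    ∫ ω, ∫ y, ∫ x, f (x, y) ∂M ω ∂N ω ∂P = ∫ y, ∫ x, (F x y).toReal * f (x, y) ∂νR ∂τR

end Setting

end CondMeas

end

set_option linter.unusedSectionVars false

/-! The measure `𝒞ₖ(ν)` is `ν` weighted by a random density (`dens`) that has mean 1 on `X₀` and
whose mixed second moments are the kernels: `E dₖ(x) dₙ(y) = F_{k,n}(x,y)`. Hence mixed second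
moments of the masses `mₖ` of `𝒞ₖ` are integrals of `F_{k,n}`.

Let `ν` have finite energy. On pairs of far cells, capacity independence and the growth condition on
`φ` bound `F_{k,k}` by `c (c₂ φ + c₃)`, so dominated convergence applies. On pairs of near cells, an
arithmetic-geometric mean splitting leaves terms `ν(Q)² / P(Q ∩ B ≠ ∅)`, at most `I_φ(ν|_Q) / a` by
the lower hitting bound. Each cell is counted boundedly often, and the sum of the energies
`I_φ(ν|_Q)` tends to 0, because `φ(0) = ∞` makes the diagonal a null set. So `E mₖ² → ∫∫ F`
(`Admissible.tendsto_lintegral_kernelF`). The lower envelopes of `F_{k,n}` give `E mₖ mₙ ≥ ∫∫ F -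
ε`, hence `E (mₖ - mₙ)² ≤ 4ε`, and the masses converge in `L²`. Restrictions of `ν` have finite
energy too, so `𝒞ₖ(ν)(A)` converges for each Borel `A`, and `exists_randomMeasure` makes the limits
into a random measure. Countable sums of such pieces settle `ν_R`, with convergence in `L¹`.

For `ν_⊥` the point is a compact set `D` of zero capacity that carries all but a small part of it
(`exists_compact_capacity_zero`). It comes from a minimax argument by Hahn–Banach separation
(`exists_measure_of_minimax`), together with the bound `two_mul_mutual_energy_le` of mutual energies
by energies. Almost surely `B` misses `D`, so `𝒞ₖ(ν_⊥)(D)` eventually vanishes, while the remaining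
mass is small in mean. Hence `𝒞ₖ(ν_⊥) → 0` in probability, although its mean does not tend to 0
unless `ν_⊥ = 0`.

For the formula, `L²` convergence yields `E M(A) N(A')` as the integral of `F` over `A × A'` for
pieces of finite energy. Rectangles determine the mean of `M ⊗ N`, and sums extend this to `ν_R` and
`τ_R`. Finally, property (vi) forces any two versions of the conditional measure to agree almost
surely (`CommonProperties.ae_eq`). -/

namespace CondMeas

/-! ### A distance on `[0, ∞]` -/

/-- The distance `|a - b|` on `[0, ∞]`. -/
noncomputable def ennDist (a b : ℝ≥0∞) : ℝ≥0∞ := (a - b) + (b - a)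

theorem ennDist_comm (a b : ℝ≥0∞) : ennDist a b = ennDist b a := add_comm _ _

theorem ennDist_zero_right (a : ℝ≥0∞) : ennDist a 0 = a := by simp [ennDist]

theorem ennDist_le_add (a b : ℝ≥0∞) : ennDist a b ≤ a + b :=
  add_le_add tsub_le_self tsub_le_self

theorem le_add_ennDist (a b : ℝ≥0∞) : a ≤ b + ennDist a b := by
  have h : a ≤ b + (a - b) := le_add_tsub
  exact h.trans (by rw [ennDist]; gcongr; exact le_self_add)

theorem ennDist_add_le (a b c d : ℝ≥0∞) : ennDist (a + b) (c + d) ≤ ennDist a c + ennDist b d := by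
  have h (a b c d : ℝ≥0∞) : a + b - (c + d) ≤ (a - c) + (b - d) := add_tsub_add_le_tsub_add_tsub
  calc ennDist (a + b) (c + d) ≤ ((a - c) + (b - d)) + ((c - a) + (d - b)) :=
        add_le_add (h _ _ _ _) (h _ _ _ _)
    _ = _ := add_add_add_comm _ _ _ _

theorem ennDist_tsum_le {ι : Type*} (a b : ι → ℝ≥0∞) :
    ennDist (∑' i, a i) (∑' i, b i) ≤ ∑' i, ennDist (a i) (b i) := by
  have h (a b : ι → ℝ≥0∞) : (∑' i, a i) - ∑' i, b i ≤ ∑' i, (a i - b i) := by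
    rw [tsub_le_iff_right, ← ENNReal.tsum_add]
    exact ENNReal.tsum_le_tsum fun i => le_tsub_add
  simp only [ennDist, ENNReal.tsum_add]
  exact add_le_add (h _ _) (h _ _)

theorem ennDist_mul_left (c a b : ℝ≥0∞) (hc : c ≠ ∞) :
    ennDist (c * a) (c * b) = c * ennDist a b := by
  simp only [ennDist, mul_add, ENNReal.mul_sub (fun _ _ => hc)]

theorem measurable_ennDist {α : Type*} [MeasurableSpace α] {f g : α → ℝ≥0∞}
    (hf : Measurable f) (hg : Measurable g) : Measurable fun x => ennDist (f x) (g x) :=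
  (hf.sub hg).add (hg.sub hf)

/-- The bridge to norms of real functions in `L¹` and `L²`. Both values must be finite because
`toReal` sends `∞` to `0`. -/
theorem enorm_toReal_sub {a b : ℝ≥0∞} (ha : a ≠ ∞) (hb : b ≠ ∞) :
    ‖a.toReal - b.toReal‖ₑ = ennDist a b := by
  have key : ∀ {a b : ℝ≥0∞}, a ≠ ∞ → b ≠ ∞ → a ≤ b → ‖a.toReal - b.toReal‖ₑ = ennDist a b := by
    intro a b ha hb h
    have h' := ENNReal.toReal_mono hb h
    rw [ennDist, tsub_eq_zero_of_le h, zero_add, ← enorm_neg, neg_sub,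
      ← ENNReal.toReal_sub_of_le h hb, Real.enorm_of_nonneg ENNReal.toReal_nonneg,
      ENNReal.ofReal_toReal (ENNReal.sub_ne_top hb)]
  rcases le_total a b with h | h
  · exact key ha hb h
  · rw [← enorm_neg, neg_sub, ennDist_comm]; exact key hb ha h

theorem tendsto_of_ennDist {ι : Type*} {l : Filter ι} {u : ι → ℝ≥0∞} {b : ℝ≥0∞} (hb : b ≠ ∞)
    (h : Tendsto (fun i => ennDist (u i) b) l (𝓝 0)) : Tendsto u l (𝓝 b) := by
  rw [ENNReal.tendsto_nhds hb]
  intro ε hε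
  filter_upwards [(tendsto_order.1 h).2 ε hε] with i hi
  constructor
  · rw [tsub_le_iff_right]
    have := le_add_ennDist b (u i)
    rw [ennDist_comm] at this
    exact this.trans (by gcongr)
  · exact (le_add_ennDist (u i) b).trans (by gcongr)

theorem eq_of_ennDist_eq_zero {a b : ℝ≥0∞} (h : ennDist a b = 0) : a = b := by
  rw [ennDist, add_eq_zero] at h
  exact le_antisymm (tsub_eq_zero_iff_le.1 h.1) (tsub_eq_zero_iff_le.1 h.2)

/-- Dominated convergence for series in `[0, ∞]` that tend to zero. -/
theorem tendsto_tsum_zero_of_dominated {u : ℕ → ℕ → ℝ≥0∞} {b : ℕ → ℝ≥0∞}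
    (hb : ∑' i, b i ≠ ∞) (hub : ∀ k i, u k i ≤ b i)
    (hu : ∀ i, Tendsto (fun k => u k i) atTop (𝓝 0)) :
    Tendsto (fun k => ∑' i, u k i) atTop (𝓝 0) := by
  have := tendsto_lintegral_of_dominated_convergence (μ := Measure.count) (F := u)
    (f := fun _ : ℕ => 0) b (fun n => measurable_of_countable _)
    (fun k => Eventually.of_forall (hub k)) (by rwa [lintegral_count]) (Eventually.of_forall hu)
  simpa [lintegral_count] using this

/-! ### Densities and second moments of the approximations -/

section Density

variable {X : Type*} [MetricSpace X] [MeasurableSpace X] {Ω : Type*} [MeasurableSpace Ω]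

/-- The density of `𝒞ₖ(ν)` with respect to `ν`. -/
noncomputable def dens (P : Measure Ω) (𝒬 : ℕ → Set (Set X)) (B : Ω → Set X) (k : ℕ) (ω : Ω)
    (x : X) : ℝ≥0∞ :=
  ∑' Q : 𝒬 k, (Q : Set X).indicator
    (fun _ => (P (hit B (Q : Set X)))⁻¹ * (hit B (Q : Set X)).indicator (fun _ => 1) ω) x

variable {P : Measure Ω} {𝒬 : ℕ → Set (Set X)} {B : Ω → Set X}

theorem IsPartitionSequence.eq_of_mem (h𝒬 : IsPartitionSequence 𝒬) {k : ℕ} {Q S : Set X} {x : X}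
    (hQ : Q ∈ 𝒬 k) (hS : S ∈ 𝒬 k) (hxQ : x ∈ Q) (hxS : x ∈ S) : Q = S := by
  by_contra h
  have := h𝒬.disjoint k Q hQ S hS h
  exact (this ▸ (⟨hxQ, hxS⟩ : x ∈ Q ∩ S) : x ∈ (∅ : Set X))

theorem cell_eq (h𝒬 : IsPartitionSequence 𝒬) {k : ℕ} {Q : Set X} {x : X}
    (hQ : Q ∈ 𝒬 k) (hx : x ∈ Q) : cell 𝒬 k x = Q := by
  have h : ∃ Q ∈ 𝒬 k, x ∈ Q := ⟨Q, hQ, hx⟩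
  rw [cell, dif_pos h]
  exact h𝒬.eq_of_mem h.choose_spec.1 hQ h.choose_spec.2 hx

theorem cell_eq_empty {k : ℕ} {x : X} (hx : x ∉ ⋃₀ 𝒬 k) : cell 𝒬 k x = ∅ :=
  dif_neg fun ⟨Q, hQ, hxQ⟩ => hx ⟨Q, hQ, hxQ⟩

theorem dens_of_mem (h𝒬 : IsPartitionSequence 𝒬) {k : ℕ} {Q : Set X} {x : X}
    (hQ : Q ∈ 𝒬 k) (hx : x ∈ Q) (ω : Ω) :
    dens P 𝒬 B k ω x = (P (hit B Q))⁻¹ * (hit B Q).indicator (fun _ => 1) ω := by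
  rw [dens, tsum_eq_single ⟨Q, hQ⟩, indicator_of_mem hx]
  intro S hS
  refine indicator_of_notMem (fun hxS => hS ?_) _
  exact Subtype.ext (h𝒬.eq_of_mem S.2 hQ hxS hx)

theorem dens_of_notMem {k : ℕ} {x : X} (hx : x ∉ ⋃₀ 𝒬 k) (ω : Ω) : dens P 𝒬 B k ω x = 0 := by
  rw [dens, ENNReal.tsum_eq_zero]
  exact fun Q => indicator_of_notMem (fun hxQ => hx ⟨Q, Q.2, hxQ⟩) _

theorem measurable_dens (h𝒬 : IsPartitionSequence 𝒬) (hB : IsRandomClosedSet P 𝒬 B) (k : ℕ) :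
    Measurable fun p : Ω × X => dens P 𝒬 B k p.1 p.2 := by
  have := (h𝒬.countable k).to_subtype
  refine Measurable.tsum fun Q => ?_
  have : (fun p : Ω × X => (Q : Set X).indicator (fun _ => (P (hit B (Q : Set X)))⁻¹ *
      (hit B (Q : Set X)).indicator (fun _ => (1 : ℝ≥0∞)) p.1) p.2) =
      fun p : Ω × X => (Q : Set X).indicator (fun _ => 1) p.2 * ((P (hit B (Q : Set X)))⁻¹ *
      (hit B (Q : Set X)).indicator (fun _ => (1 : ℝ≥0∞)) p.1) := by
    ext p
    by_cases h : p.2 ∈ (Q : Set X) <;> simp [h]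
  rw [this]
  exact ((measurable_const.indicator (h𝒬.measurableSet k Q Q.2)).comp measurable_snd).mul
    (((measurable_const.indicator (hB.measurableSet_hit k Q Q.2)).comp measurable_fst).const_mul _)

theorem measurable_dens_right (h𝒬 : IsPartitionSequence 𝒬) (hB : IsRandomClosedSet P 𝒬 B)
    (k : ℕ) (ω : Ω) : Measurable (dens P 𝒬 B k ω) :=
  (measurable_dens h𝒬 hB k).comp measurable_prodMk_left

theorem measurable_dens_left (h𝒬 : IsPartitionSequence 𝒬) (hB : IsRandomClosedSet P 𝒬 B)
    (k : ℕ) (x : X) : Measurable fun ω => dens P 𝒬 B k ω x :=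
  (measurable_dens h𝒬 hB k).comp measurable_prodMk_right

theorem approxCond_eq_withDensity (h𝒬 : IsPartitionSequence 𝒬) (k : ℕ) (ν : Measure X) (ω : Ω) :
    approxCond P 𝒬 B k ν ω = ν.withDensity (dens P 𝒬 B k ω) := by
  have := (h𝒬.countable k).to_subtype
  have h : dens P 𝒬 B k ω = ∑' Q : 𝒬 k, (Q : Set X).indicator
    (fun _ => (P (hit B (Q : Set X)))⁻¹ * (hit B (Q : Set X)).indicator (fun _ => 1) ω) := by
    ext x
    rw [tsum_apply (Pi.summable.2 fun _ => ENNReal.summable), dens]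
  rw [h, withDensity_tsum fun Q : 𝒬 k =>
    measurable_const.indicator (h𝒬.measurableSet k Q Q.2), approxCond]
  congr 1
  ext1 Q
  rw [withDensity_indicator (h𝒬.measurableSet k Q Q.2), withDensity_const]

theorem lintegral_approxCond (h𝒬 : IsPartitionSequence 𝒬) (hB : IsRandomClosedSet P 𝒬 B) (k : ℕ)
    (ν : Measure X) (ω : Ω) {g : X → ℝ≥0∞} (hg : Measurable g) :
    ∫⁻ x, g x ∂approxCond P 𝒬 B k ν ω = ∫⁻ x, dens P 𝒬 B k ω x * g x ∂ν := by
  rw [approxCond_eq_withDensity h𝒬,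
    lintegral_withDensity_eq_lintegral_mul _ (measurable_dens_right h𝒬 hB k ω) hg]
  rfl

theorem measurable_lintegral_approxCond (h𝒬 : IsPartitionSequence 𝒬)
    (hB : IsRandomClosedSet P 𝒬 B) (k : ℕ)
    (ν : Measure X) [SFinite ν] {g : X → ℝ≥0∞} (hg : Measurable g) :
    Measurable fun ω => ∫⁻ x, g x ∂approxCond P 𝒬 B k ν ω := by
  simp_rw [lintegral_approxCond h𝒬 hB k ν _ hg]
  exact ((measurable_dens h𝒬 hB k).mul (hg.comp measurable_snd)).lintegral_prod_right'

theorem measurable_approxCond_apply (h𝒬 : IsPartitionSequence 𝒬)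
    (hB : IsRandomClosedSet P 𝒬 B) (k : ℕ)
    (ν : Measure X) [SFinite ν] {A : Set X} (hA : MeasurableSet A) :
    Measurable fun ω => approxCond P 𝒬 B k ν ω A := by
  simpa [lintegral_indicator_one hA] using measurable_lintegral_approxCond h𝒬 hB k ν
    (measurable_one.indicator hA)

/-- The factor `P(Q ∩ B ≠ ∅)⁻¹` normalises the hitting indicator of the one cell that contains `x`.
This is why `𝒞ₖ` preserves mass in mean. -/
theorem lintegral_dens [IsProbabilityMeasure P] (h𝒬 : IsPartitionSequence 𝒬)
    (hB : IsRandomClosedSet P 𝒬 B) {k : ℕ} {x : X} (hx : x ∈ ⋃₀ 𝒬 k) :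
    ∫⁻ ω, dens P 𝒬 B k ω x ∂P = 1 := by
  obtain ⟨Q, hQ, hxQ⟩ := hx
  simp_rw [dens_of_mem h𝒬 hQ hxQ]
  rw [lintegral_const_mul _ (measurable_const.indicator (hB.measurableSet_hit k Q hQ)),
    lintegral_indicator (hB.measurableSet_hit k Q hQ), setLIntegral_one,
    ENNReal.inv_mul_cancel (hB.hit_pos k Q hQ).ne' (measure_ne_top _ _)]

theorem kernelF_of_mem (h𝒬 : IsPartitionSequence 𝒬) {k n : ℕ} {Q S : Set X} {x y : X}
    (hQ : Q ∈ 𝒬 k) (hx : x ∈ Q) (hS : S ∈ 𝒬 n) (hy : y ∈ S) :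
    kernelF P 𝒬 B k n x y =
      P (hit B Q ∩ hit B S) / (P (hit B Q) * P (hit B S)) := by
  rw [kernelF, cell_eq h𝒬 hQ hx, cell_eq h𝒬 hS hy, if_pos]
  exact ⟨(nonempty_of_mem hx).ne_empty, (nonempty_of_mem hy).ne_empty⟩

/-- The product of two hitting indicators is the indicator of the joint event. If a point lies in no
cell, both sides vanish, which matches the convention `F_{k,n} = 0` there. -/
theorem lintegral_dens_mul_dens [IsProbabilityMeasure P] (h𝒬 : IsPartitionSequence 𝒬)
    (hB : IsRandomClosedSet P 𝒬 B) (k n : ℕ) (x y : X) :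
    ∫⁻ ω, dens P 𝒬 B k ω x * dens P 𝒬 B n ω y ∂P = kernelF P 𝒬 B k n x y := by
  by_cases hx : x ∈ ⋃₀ 𝒬 k
  · by_cases hy : y ∈ ⋃₀ 𝒬 n
    · obtain ⟨Q, hQ, hxQ⟩ := hx
      obtain ⟨S, hS, hyS⟩ := hy
      rw [kernelF_of_mem h𝒬 hQ hxQ hS hyS]
      simp_rw [dens_of_mem h𝒬 hQ hxQ, dens_of_mem h𝒬 hS hyS]
      have hm := (hB.measurableSet_hit k Q hQ).inter (hB.measurableSet_hit n S hS)
      have : ∀ ω, (P (hit B Q))⁻¹ * (hit B Q).indicator (fun _ => (1 : ℝ≥0∞)) ω *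
          ((P (hit B S))⁻¹ * (hit B S).indicator (fun _ => 1) ω) =
          ((P (hit B Q))⁻¹ * (P (hit B S))⁻¹) *
            (hit B Q ∩ hit B S).indicator (fun _ => 1) ω := by
        intro ω
        by_cases h1 : ω ∈ hit B Q <;> by_cases h2 : ω ∈ hit B S <;> simp [h1, h2]
      simp_rw [this]
      rw [lintegral_const_mul _ (measurable_const.indicator hm), lintegral_indicator hm,
        setLIntegral_one, ENNReal.div_eq_inv_mul, ENNReal.mul_inv]
      · exact Or.inl (hB.hit_pos k Q hQ).ne'
      · exact Or.inl (measure_ne_top _ _)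
    · simp [dens_of_notMem hy, kernelF, cell_eq_empty hy]
  · simp [dens_of_notMem hx, kernelF, cell_eq_empty hx]

theorem measurable_kernelF [IsProbabilityMeasure P] (h𝒬 : IsPartitionSequence 𝒬)
    (hB : IsRandomClosedSet P 𝒬 B) (k n : ℕ) :
    Measurable fun p : X × X => kernelF P 𝒬 B k n p.1 p.2 := by
  -- As a parameter integral of jointly measurable densities, the kernel is measurable without any
  -- discussion of cells.
  simp_rw [← lintegral_dens_mul_dens h𝒬 hB]
  refine Measurable.lintegral_prod_left' (f := fun q : Ω × (X × X) =>
    dens P 𝒬 B k q.1 q.2.1 * dens P 𝒬 B n q.1 q.2.2) ?_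
  exact ((measurable_dens h𝒬 hB k).comp
      (measurable_fst.prodMk (measurable_fst.comp measurable_snd))).mul
    ((measurable_dens h𝒬 hB n).comp (measurable_fst.prodMk (measurable_snd.comp measurable_snd)))

/-- `E ∫ g d𝒞ₖ(ν) = ∫ g dν` if `ν` lives on `X₀`. -/
theorem lintegral_lintegral_approxCond [IsProbabilityMeasure P] (h𝒬 : IsPartitionSequence 𝒬)
    (hB : IsRandomClosedSet P 𝒬 B) (k : ℕ) {ν : Measure X} [SFinite ν]
    (hν : ν (coreSet 𝒬)ᶜ = 0) {g : X → ℝ≥0∞} (hg : Measurable g) :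
    ∫⁻ ω, ∫⁻ x, g x ∂approxCond P 𝒬 B k ν ω ∂P = ∫⁻ x, g x ∂ν := by
  simp_rw [lintegral_approxCond h𝒬 hB k ν _ hg]
  rw [lintegral_lintegral_swap
    ((measurable_dens h𝒬 hB k).mul (hg.comp measurable_snd)).aemeasurable]
  refine lintegral_congr_ae ?_
  filter_upwards [compl_mem_ae_iff.2 hν] with x hx
  rw [compl_compl] at hx
  rw [lintegral_mul_const _ (measurable_dens_left h𝒬 hB k x),
    lintegral_dens h𝒬 hB (mem_iInter.1 hx k), one_mul]

/-- `E (∫ g d𝒞ₖ(ν) · ∫ g' d𝒞ₙ(τ)) = ∫∫ F_{k,n} g g' dν dτ`. -/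
theorem lintegral_mul_approxCond [IsProbabilityMeasure P] (h𝒬 : IsPartitionSequence 𝒬)
    (hB : IsRandomClosedSet P 𝒬 B) (k n : ℕ) (ν τ : Measure X) [SFinite ν] [SFinite τ] :
    ∫⁻ ω, approxCond P 𝒬 B k ν ω univ * approxCond P 𝒬 B n τ ω univ ∂P =
      ∫⁻ p, kernelF P 𝒬 B k n p.1 p.2 ∂(ν.prod τ) := by
  have h1 (k : ℕ) (ν : Measure X) (ω : Ω) : approxCond P 𝒬 B k ν ω univ =
      ∫⁻ x, dens P 𝒬 B k ω x ∂ν := by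
    rw [approxCond_eq_withDensity h𝒬, withDensity_apply _ MeasurableSet.univ, setLIntegral_univ]
  simp_rw [h1, ← lintegral_dens_mul_dens h𝒬 hB]
  rw [lintegral_lintegral_swap]
  · refine lintegral_congr fun ω => ?_
    rw [lintegral_prod_mul (measurable_dens_right h𝒬 hB k ω).aemeasurable
      (measurable_dens_right h𝒬 hB n ω).aemeasurable]
  · refine Measurable.aemeasurable ?_
    exact ((measurable_dens h𝒬 hB k).comp
        (measurable_snd.prodMk (measurable_fst.comp measurable_fst))).mul
      ((measurable_dens h𝒬 hB n).comp (measurable_snd.prodMk (measurable_snd.comp measurable_fst)))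

end Density

/-! ### Uniqueness and stability of the regular part -/

section Decomposition

variable {X : Type*} [MetricSpace X] [MeasurableSpace X] [SecondCountableTopology X] [BorelSpace X]
  {φ : ℝ≥0 → ℝ≥0∞} {ν νR νS : Measure X}

theorem IsRegularDecomposition.singular_eq [IsLocallyFiniteMeasure ν]
    (h : IsRegularDecomposition φ ν νR νS) {E : Set X} (hE : MeasurableSet E)
    (hR : νR = ν.restrict E) : νS = ν.restrict Eᶜ := by
  have := h.locallyFinite_singular
  have h1 : ν.restrict E + νS = ν.restrict E + ν.restrict Eᶜ := by
    rw [← hR, ← h.eq_add, hR, Measure.restrict_add_restrict_compl hE]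
  exact (Measure.add_right_inj (ν.restrict E) _ _).1 h1

/-- The regular and the singular part are unique. -/
theorem IsRegularDecomposition.unique [IsLocallyFiniteMeasure ν] {νR' νS' : Measure X}
    (h : IsRegularDecomposition φ ν νR νS) (h' : IsRegularDecomposition φ ν νR' νS') :
    νR = νR' ∧ νS = νS' := by
  obtain ⟨A, hAm, hAd, hR, hRs, hAe⟩ := h.exists_pieces
  obtain ⟨A', hAm', hAd', hR', hRs', hAe'⟩ := h'.exists_pieces
  have hE : MeasurableSet (⋃ n, A n) := MeasurableSet.iUnion hAm
  have hE' : MeasurableSet (⋃ n, A' n) := MeasurableSet.iUnion hAm'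
  have hS := h.singular_eq hE hR
  have hS' := h'.singular_eq hE' hR'
  -- A piece of finite energy, cut down to the carrier of a singular part, is singular to itself and
  -- hence null. Applied in both directions, this shows that the two carriers agree up to a null
  -- set.
  have key : ∀ {E : Set X} {A : ℕ → Set X} {σ : Measure X}, MeasurableSet E →
      (∀ n, MeasurableSet (A n)) → (∀ n, energy φ (ν.restrict (A n)) < ∞) →
      σ = ν.restrict Eᶜ → (∀ μ : Measure X, IsLocallyFiniteMeasure μ → energy φ μ < ∞ → σ ⟂ₘ μ) →
      ν ((⋃ n, A n) ∩ Eᶜ) = 0 := by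
    intro E A σ hE hA hAe hσ hs
    rw [iUnion_inter]
    refine measure_iUnion_null fun n => ?_
    have h1 : ν.restrict (A n ∩ Eᶜ) ⟂ₘ ν.restrict (A n ∩ Eᶜ) := by
      refine (hs _ inferInstance (hAe n)).mono ?_ (Measure.restrict_mono inter_subset_left le_rfl)
      rw [hσ]
      exact Measure.restrict_mono inter_subset_right le_rfl
    rw [Measure.MutuallySingular.self_iff, Measure.restrict_eq_zero] at h1
    exact h1
  have h1 := key hE hAm' hAe' hS h.singular
  have h2 := key hE' hAm hAe hS' h'.singular
  have hae : (⋃ n, A n) =ᵐ[ν] (⋃ n, A' n) := by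
    refine (ae_le_set.2 ?_).antisymm (ae_le_set.2 ?_)
    · rwa [sdiff_eq]
    · rwa [sdiff_eq]
  rw [hR, hR', hS, hS']
  exact ⟨Measure.restrict_congr_set hae, Measure.restrict_congr_set hae.compl⟩

theorem regularPart_eq [IsLocallyFiniteMeasure ν] (h : IsRegularDecomposition φ ν νR νS) :
    regularPart φ ν = νR ∧ singularPart φ ν = νS :=
  (isRegularDecomposition_parts φ ν).unique h

/-- A set that carries the regular part of `ν` and is disjoint from a carrier of the singular part
does so for all measures that are absolutely continuous with respect to `ν`. -/
theorem IsRegularDecomposition.of_absolutelyContinuous [IsLocallyFiniteMeasure ν]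
    (h : IsRegularDecomposition φ ν νR νS) {A : ℕ → Set X} (hAm : ∀ n, MeasurableSet (A n))
    (hR : νR = ν.restrict (⋃ n, A n)) (hAe : ∀ n, energy φ (ν.restrict (A n)) < ∞)
    {η : Measure X} [IsLocallyFiniteMeasure η] (hη : η ≪ ν) :
    IsRegularDecomposition φ η (η.restrict (⋃ n, A n)) (η.restrict (⋃ n, A n)ᶜ) := by
  have hE : MeasurableSet (⋃ n, A n) := MeasurableSet.iUnion hAm
  have hS := h.singular_eq hE hR
  have hgm : Measurable (η.rnDeriv ν) := Measure.measurable_rnDeriv η ν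
  -- On the set where the density of `η` is at most `m` one has `η ≤ m ν`, so the pieces stay of
  -- finite energy. The density is finite almost everywhere, so these sets exhaust the carrier.
  let D : ℕ → Set X := fun i => A i.unpair.1 ∩ {x | η.rnDeriv ν x ≤ (i.unpair.2 : ℝ≥0∞)}
  have hDm : ∀ i, MeasurableSet (D i) := fun i =>
    (hAm _).inter (measurableSet_le hgm measurable_const)
  have hDe : ∀ i, energy φ (η.restrict (D i)) < ∞ := by
    intro i
    refine (energy_mono φ ?_).trans_lt (energy_smul_lt_top φ (hAe i.unpair.1) i.unpair.2)
    refine Measure.le_iff.2 fun t ht => ?_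
    rw [Measure.restrict_apply ht, ← Measure.withDensity_rnDeriv_eq η ν hη,
      withDensity_apply _ (ht.inter (hDm i)), Measure.smul_apply, smul_eq_mul,
      Measure.restrict_apply ht]
    calc ∫⁻ x in t ∩ D i, η.rnDeriv ν x ∂ν ≤ ∫⁻ _ in t ∩ D i, (i.unpair.2 : ℝ≥0∞) ∂ν :=
          setLIntegral_mono measurable_const fun x hx => hx.2.2
      _ = i.unpair.2 * ν (t ∩ D i) := by simp
      _ ≤ _ := by gcongr; exact inter_subset_left
  have hae : (⋃ i, D i) =ᵐ[η] ⋃ n, A n := by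
    have hfin : ∀ᵐ x ∂η, η.rnDeriv ν x < ∞ := hη.ae_le (Measure.rnDeriv_lt_top η ν)
    filter_upwards [hfin] with x hx
    refine propext ⟨fun hxD => ?_, fun hxA => ?_⟩
    · obtain ⟨i, hi⟩ := mem_iUnion.1 hxD
      exact mem_iUnion.2 ⟨_, hi.1⟩
    · obtain ⟨n, hn⟩ := mem_iUnion.1 hxA
      obtain ⟨m, hm⟩ := ENNReal.exists_nat_gt hx.ne
      exact mem_iUnion.2 ⟨Nat.pair n m, by simpa [D] using ⟨hn, hm.le⟩⟩
  have hU : ⋃ n, disjointed D n = ⋃ n, D n := iUnion_disjointed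
  refine ⟨inferInstance, inferInstance, (Measure.restrict_add_restrict_compl hE).symm,
    ⟨(⋃ n, A n)ᶜ, hE.compl, ?_, ?_⟩, ?_, disjointed D, MeasurableSet.disjointed hDm,
    disjoint_disjointed D, ?_, ?_, ?_⟩
  · rw [Measure.restrict_apply hE.compl, compl_inter_self, measure_empty]
  · rw [compl_compl, Measure.restrict_apply hE, inter_compl_self, measure_empty]
  · intro μ hμ he
    refine (h.singular μ hμ he).mono_ac ?_ Measure.AbsolutelyContinuous.rfl
    rw [hS]
    exact hη.restrict _
  · rw [hU, Measure.restrict_congr_set hae]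
  · rw [← Measure.restrict_iUnion (disjoint_disjointed D) (MeasurableSet.disjointed hDm), hU,
      Measure.restrict_congr_set hae]
  · exact fun n => (energy_mono φ (Measure.restrict_mono (disjointed_subset D n) le_rfl)).trans_lt
      (hDe n)

/-- There is a set that carries the regular parts of all measures that are absolutely
continuous with respect to `ν`, while its complement carries the singular parts. -/
theorem exists_regularSet (φ : ℝ≥0 → ℝ≥0∞) (ν : Measure X) [IsLocallyFiniteMeasure ν] :
    ∃ A : ℕ → Set X, (∀ n, MeasurableSet (A n)) ∧ Pairwise (Function.onFun Disjoint A) ∧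
      (∀ n, energy φ (ν.restrict (A n)) < ∞) ∧
      ∀ η : Measure X, IsLocallyFiniteMeasure η → η ≪ ν →
        regularPart φ η = η.restrict (⋃ n, A n) ∧ singularPart φ η = η.restrict (⋃ n, A n)ᶜ := by
  have h := isRegularDecomposition_parts φ ν
  obtain ⟨A, hAm, hAd, hR, -, hAe⟩ := h.exists_pieces
  exact ⟨A, hAm, hAd, hAe, fun η _ hη =>
    regularPart_eq (h.of_absolutelyContinuous hAm hR hAe hη)⟩

theorem regularPart_le (φ : ℝ≥0 → ℝ≥0∞) (ν : Measure X) [IsLocallyFiniteMeasure ν] :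
    regularPart φ ν ≤ ν := by
  obtain ⟨A, -, -, -, h⟩ := exists_regularSet φ ν
  rw [(h ν inferInstance Measure.AbsolutelyContinuous.rfl).1]
  exact Measure.restrict_le_self

theorem singularPart_le (φ : ℝ≥0 → ℝ≥0∞) (ν : Measure X) [IsLocallyFiniteMeasure ν] :
    singularPart φ ν ≤ ν := by
  obtain ⟨A, -, -, -, h⟩ := exists_regularSet φ ν
  rw [(h ν inferInstance Measure.AbsolutelyContinuous.rfl).2]
  exact Measure.restrict_le_self

instance isLocallyFiniteMeasure_regularPart (φ : ℝ≥0 → ℝ≥0∞) (ν : Measure X)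
    [IsLocallyFiniteMeasure ν] : IsLocallyFiniteMeasure (regularPart φ ν) :=
  (isRegularDecomposition_parts φ ν).locallyFinite_regular

instance isLocallyFiniteMeasure_singularPart (φ : ℝ≥0 → ℝ≥0∞) (ν : Measure X)
    [IsLocallyFiniteMeasure ν] : IsLocallyFiniteMeasure (singularPart φ ν) :=
  (isRegularDecomposition_parts φ ν).locallyFinite_singular

theorem regularPart_regularPart (φ : ℝ≥0 → ℝ≥0∞) (ν : Measure X) [IsLocallyFiniteMeasure ν] :
    regularPart φ (regularPart φ ν) = regularPart φ ν := by
  obtain ⟨A, hA, -, -, h⟩ := exists_regularSet φ ν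
  have h1 := (h ν inferInstance Measure.AbsolutelyContinuous.rfl).1
  rw [(h (regularPart φ ν) inferInstance
    (Measure.absolutelyContinuous_of_le (regularPart_le φ ν))).1, h1,
    Measure.restrict_restrict (MeasurableSet.iUnion hA), inter_self]

theorem regularPart_singularPart (φ : ℝ≥0 → ℝ≥0∞) (ν : Measure X) [IsLocallyFiniteMeasure ν] :
    regularPart φ (singularPart φ ν) = 0 := by
  obtain ⟨A, hA, -, -, h⟩ := exists_regularSet φ ν
  have h1 := (h ν inferInstance Measure.AbsolutelyContinuous.rfl).2
  rw [(h (singularPart φ ν) inferInstance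
    (Measure.absolutelyContinuous_of_le (singularPart_le φ ν))).1, h1,
    Measure.restrict_restrict (MeasurableSet.iUnion hA), inter_compl_self, Measure.restrict_empty]

end Decomposition

/-! ### Mutual energies -/

section Energy

variable {X : Type*} [MetricSpace X] [MeasurableSpace X] [SecondCountableTopology X] [BorelSpace X]
  {φ : ℝ≥0 → ℝ≥0∞}

/-- Monotonicity reduces this to `a / b + b / a ≥ 2`. It is the pointwise inequality behind
`two_mul_prod_le`. -/
theorem two_le_div_add_div {a b α β : ℝ≥0∞} (ha : a ≤ α) (hb : b ≤ β) (ha0 : a ≠ 0) (hb0 : b ≠ 0)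
    (hat : a ≠ ∞) (hbt : b ≠ ∞) : 2 ≤ α / b + β / a := by
  refine le_trans ?_ (add_le_add (ENNReal.div_le_div_right ha b) (ENNReal.div_le_div_right hb a))
  lift a to ℝ≥0 using hat
  lift b to ℝ≥0 using hbt
  have ha0' : a ≠ 0 := by exact_mod_cast ha0
  have hb0' : b ≠ 0 := by exact_mod_cast hb0
  rw [← ENNReal.coe_div hb0', ← ENNReal.coe_div ha0']
  norm_cast
  rw [← NNReal.coe_le_coe]
  push_cast
  have h1 : (0 : ℝ) < a := NNReal.coe_pos.2 (pos_iff_ne_zero.2 ha0')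
  have h2 : (0 : ℝ) < b := NNReal.coe_pos.2 (pos_iff_ne_zero.2 hb0')
  rw [div_add_div _ _ h2.ne' h1.ne', le_div_iff₀ (by positivity)]
  nlinarith [sq_nonneg ((a : ℝ) - b)]

/-- If `S` and `T` are relations such that points with a common `R`-neighbour are related, then
twice the mutual mass of `R` is at most the sum of the masses of `S` and `T`. -/
theorem two_mul_prod_le {Y Z : Type*} [MeasurableSpace Y] [MeasurableSpace Z] (ν : Measure Y)
    (τ : Measure Z) [IsFiniteMeasure ν] [IsFiniteMeasure τ] {R : Set (Y × Z)} {S : Set (Y × Y)}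
    {T : Set (Z × Z)} (hR : MeasurableSet R) (hS : MeasurableSet S) (hT : MeasurableSet T)
    (hRS : ∀ x x' y, (x, y) ∈ R → (x', y) ∈ R → (x, x') ∈ S)
    (hRT : ∀ x y y', (x, y) ∈ R → (x, y') ∈ R → (y, y') ∈ T) :
    2 * ν.prod τ R ≤ ν.prod ν S + τ.prod τ T := by
  -- Section masses of `R` (`a`, `b`), of `S` (`α`) and of `T` (`β`). For `(x, y) ∈ R` the
  -- hypotheses give `a y ≤ α x` and `b x ≤ β y`, so `α x / b x + β y / a y ≥ 2`. Integrating `α x /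
  -- b x` over the section of `R` at `x`, which has mass `b x`, yields at most `α x`.
  let a : Z → ℝ≥0∞ := fun y => ν ((fun x => (x, y)) ⁻¹' R)
  let b : Y → ℝ≥0∞ := fun x => τ (Prod.mk x ⁻¹' R)
  let α : Y → ℝ≥0∞ := fun x => ν (Prod.mk x ⁻¹' S)
  let β : Z → ℝ≥0∞ := fun y => τ (Prod.mk y ⁻¹' T)
  have ham : Measurable a := measurable_measure_prodMk_right hR
  have hbm : Measurable b := measurable_measure_prodMk_left hR
  have hαm : Measurable α := measurable_measure_prodMk_left hS
  have hβm : Measurable β := measurable_measure_prodMk_left hT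
  -- By Fubini the points of `R` that lie on a section of mass zero form a null set, so the
  -- quotients may be used almost everywhere.
  have hnull1 : ∀ᵐ p ∂(ν.prod τ), p ∈ R → b p.1 ≠ 0 := by
    rw [ae_iff]
    have hm : MeasurableSet {p : Y × Z | ¬ (p ∈ R → b p.1 ≠ 0)} := by
      have : {p : Y × Z | ¬ (p ∈ R → b p.1 ≠ 0)} = R ∩ Prod.fst ⁻¹' (b ⁻¹' {0}) := by
        ext p; simp
      rw [this]
      exact hR.inter (measurable_fst (hbm (measurableSet_singleton 0)))
    rw [Measure.prod_apply hm, lintegral_eq_zero_iff (measurable_measure_prodMk_left hm)]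
    refine Eventually.of_forall fun x => ?_
    by_cases hx : b x = 0
    · refine measure_mono_null ?_ hx
      intro y hy
      by_contra h
      exact hy fun h' => absurd h' h
    · have : Prod.mk x ⁻¹' {p : Y × Z | ¬ (p ∈ R → b p.1 ≠ 0)} = ∅ := by
        ext y; simp [hx]
      simp only [this, measure_empty, Pi.zero_apply]
  have hnull2 : ∀ᵐ p ∂(ν.prod τ), p ∈ R → a p.2 ≠ 0 := by
    rw [ae_iff]
    have hm : MeasurableSet {p : Y × Z | ¬ (p ∈ R → a p.2 ≠ 0)} := by
      have : {p : Y × Z | ¬ (p ∈ R → a p.2 ≠ 0)} = R ∩ Prod.snd ⁻¹' (a ⁻¹' {0}) := by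
        ext p; simp
      rw [this]
      exact hR.inter (measurable_snd (ham (measurableSet_singleton 0)))
    rw [Measure.prod_apply_symm hm, lintegral_eq_zero_iff (measurable_measure_prodMk_right hm)]
    refine Eventually.of_forall fun y => ?_
    by_cases hy : a y = 0
    · refine measure_mono_null ?_ hy
      intro x hx
      by_contra h
      exact hx fun h' => absurd h' h
    · have : (fun x => (x, y)) ⁻¹' {p : Y × Z | ¬ (p ∈ R → a p.2 ≠ 0)} = ∅ := by
        ext x; simp [hy]
      simp only [this, measure_empty, Pi.zero_apply]
  have hm1 : Measurable fun p : Y × Z => α p.1 / b p.1 :=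
    (hαm.comp measurable_fst).div (hbm.comp measurable_fst)
  have hm2 : Measurable fun p : Y × Z => β p.2 / a p.2 :=
    (hβm.comp measurable_snd).div (ham.comp measurable_snd)
  have h1 : ∫⁻ p in R, α p.1 / b p.1 ∂(ν.prod τ) ≤ ν.prod ν S := by
    rw [← lintegral_indicator hR, lintegral_prod _ (hm1.indicator hR).aemeasurable,
      Measure.prod_apply hS]
    refine lintegral_mono fun x => ?_
    have : ∀ y, R.indicator (fun p : Y × Z => α p.1 / b p.1) (x, y) =
        α x / b x * (Prod.mk x ⁻¹' R).indicator (fun _ => 1) y := by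
      intro y
      by_cases h : (x, y) ∈ R <;> simp [h, indicator]
    simp_rw [this]
    rw [lintegral_const_mul _ (measurable_const.indicator (measurable_prodMk_left hR)),
      lintegral_indicator (measurable_prodMk_left hR), setLIntegral_one]
    rw [mul_comm]
    exact ENNReal.mul_div_le
  have h2 : ∫⁻ p in R, β p.2 / a p.2 ∂(ν.prod τ) ≤ τ.prod τ T := by
    rw [← lintegral_indicator hR, lintegral_prod_symm _ (hm2.indicator hR).aemeasurable,
      Measure.prod_apply hT]
    refine lintegral_mono fun y => ?_
    have : ∀ x, R.indicator (fun p : Y × Z => β p.2 / a p.2) (x, y) =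
        β y / a y * ((fun x => (x, y)) ⁻¹' R).indicator (fun _ => 1) x := by
      intro x
      by_cases h : (x, y) ∈ R <;> simp [h, indicator]
    simp_rw [this]
    rw [lintegral_const_mul _ (measurable_const.indicator (measurable_prodMk_right hR)),
      lintegral_indicator (measurable_prodMk_right hR), setLIntegral_one]
    rw [mul_comm]
    exact ENNReal.mul_div_le
  refine le_trans ?_ (add_le_add h1 h2)
  rw [← lintegral_add_left hm1,
    ← setLIntegral_const]
  refine setLIntegral_mono_ae' hR ?_
  filter_upwards [hnull1, hnull2] with p hp1 hp2 hp
  refine two_le_div_add_div ?_ ?_ (hp2 hp) (hp1 hp) (measure_ne_top _ _) (measure_ne_top _ _)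
  · exact measure_mono fun x' hx' => hRS p.1 x' p.2 hp hx'
  · exact measure_mono fun y' hy' => hRT p.1 p.2 y' hp hy'

theorem volume_setOf_ofReal_lt (x : ℝ≥0∞) :
    volume (Ioi (0 : ℝ) ∩ {t | ENNReal.ofReal t < x}) = x := by
  by_cases hx : x = ∞
  · simp [hx]
  · have : Ioi (0 : ℝ) ∩ {t | ENNReal.ofReal t < x} = Ioo 0 x.toReal := by
      ext t
      simp only [mem_inter_iff, mem_Ioi, mem_ofPred_eq, mem_Ioo, and_congr_right_iff]
      exact fun ht => ENNReal.ofReal_lt_iff_lt_toReal ht.le hx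
    rw [this, Real.volume_Ioo, sub_zero, ENNReal.ofReal_toReal hx]

/-- The layer cake formula for `[0, ∞]`-valued functions. -/
theorem lintegral_eq_lintegral_ofReal_lt {α : Type*} [MeasurableSpace α] (μ : Measure α)
    [SFinite μ] {f : α → ℝ≥0∞} (hf : Measurable f) :
    ∫⁻ a, f a ∂μ = ∫⁻ t in Ioi (0 : ℝ), μ {a | ENNReal.ofReal t < f a} := by
  have hm : MeasurableSet {p : α × ℝ | ENNReal.ofReal p.2 < f p.1} :=
    measurableSet_lt (ENNReal.measurable_ofReal.comp measurable_snd) (hf.comp measurable_fst)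
  have h1 : ∀ a, f a = ∫⁻ t in Ioi (0 : ℝ),
      {p : α × ℝ | ENNReal.ofReal p.2 < f p.1}.indicator (fun _ => 1) (a, t) := by
    intro a
    have : (fun t => {p : α × ℝ | ENNReal.ofReal p.2 < f p.1}.indicator
        (fun _ => (1 : ℝ≥0∞)) (a, t)) = (Prod.mk a ⁻¹' {p : α × ℝ |
          ENNReal.ofReal p.2 < f p.1}).indicator fun _ => 1 := rfl
    rw [this, lintegral_indicator (measurable_prodMk_left hm), setLIntegral_one,
      Measure.restrict_apply (measurable_prodMk_left hm), inter_comm]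
    exact (volume_setOf_ofReal_lt (f a)).symm
  rw [lintegral_congr h1]
  rw [lintegral_lintegral_swap (f := fun a t => {p : α × ℝ | ENNReal.ofReal p.2 < f p.1}.indicator
    (fun _ => (1 : ℝ≥0∞)) (a, t)) (measurable_const.indicator hm).aemeasurable]
  refine lintegral_congr fun t => ?_
  have : (fun a => {p : α × ℝ | ENNReal.ofReal p.2 < f p.1}.indicator
      (fun _ => (1 : ℝ≥0∞)) (a, t)) = ((fun a => (a, t)) ⁻¹' {p : α × ℝ |
        ENNReal.ofReal p.2 < f p.1}).indicator fun _ => 1 := rfl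
  rw [this, lintegral_indicator (measurable_prodMk_right hm), setLIntegral_one]
  rfl

theorem measurable_kernel (hφ : IsRegularityKernel φ) :
    Measurable fun p : X × X => φ (nndist p.1 p.2) :=
  hφ.continuous.measurable.comp (measurable_fst.nndist measurable_snd)

theorem measurable_kernel_half (hφ : IsRegularityKernel φ) :
    Measurable fun p : X × X => φ (nndist p.1 p.2 / 2) :=
  hφ.continuous.measurable.comp ((measurable_fst.nndist measurable_snd).div_const 2)

theorem energy_eq_lintegral_prod (hφ : IsRegularityKernel φ) (μ : Measure X) [SFinite μ] :
    energy φ μ = ∫⁻ p, φ (nndist p.1 p.2) ∂(μ.prod μ) := by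
  rw [lintegral_prod_symm _ (measurable_kernel hφ).aemeasurable, energy]

/-- The mutual energy of two finite measures is at most the average of their energies with respect
to the kernel `φ(r/2)`. -/
theorem two_mul_mutual_energy_le (hφ : IsRegularityKernel φ) (ν τ : Measure X)
    [IsFiniteMeasure ν] [IsFiniteMeasure τ] :
    2 * ∫⁻ p, φ (nndist p.1 p.2) ∂(ν.prod τ) ≤
      ∫⁻ p, φ (nndist p.1 p.2 / 2) ∂(ν.prod ν) + ∫⁻ p, φ (nndist p.1 p.2 / 2) ∂(τ.prod τ) := by
  have hm := measurable_kernel (X := X) hφ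
  have hm' := measurable_kernel_half (X := X) hφ
  have hset : ∀ t : ℝ, MeasurableSet {p : X × X | ENNReal.ofReal t < φ (nndist p.1 p.2)} :=
    fun t => measurableSet_lt measurable_const hm
  have hset' : ∀ t : ℝ, MeasurableSet {p : X × X | ENNReal.ofReal t < φ (nndist p.1 p.2 / 2)} :=
    fun t => measurableSet_lt measurable_const hm'
  have hmeas : Measurable fun t : ℝ =>
      (ν.prod ν) {p : X × X | ENNReal.ofReal t < φ (nndist p.1 p.2 / 2)} := by
    refine measurable_measure_prodMk_left (s := {q : ℝ × (X × X) |
      ENNReal.ofReal q.1 < φ (nndist q.2.1 q.2.2 / 2)}) ?_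
    exact measurableSet_lt (ENNReal.measurable_ofReal.comp measurable_fst)
      (hm'.comp measurable_snd)
  -- The layer cake formula reduces the claim to superlevel sets of the kernels.
  rw [lintegral_eq_lintegral_ofReal_lt _ hm, lintegral_eq_lintegral_ofReal_lt _ hm',
    lintegral_eq_lintegral_ofReal_lt _ hm', ← lintegral_const_mul' _ _ (by simp),
    ← lintegral_add_left hmeas]
  refine lintegral_mono fun t => ?_
  -- Half of `d(x,z)` is at most the larger of `d(x,y)` and `d(z,y)`, and `φ` decreases. This is
  -- where the kernel `φ(r/2)` comes from.
  have hdist : ∀ x y z : X, ENNReal.ofReal t < φ (nndist x y) → ENNReal.ofReal t < φ (nndist z y) →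
      ENNReal.ofReal t < φ (nndist x z / 2) := by
    intro x y z h1 h2
    have h3 : nndist x z / 2 ≤ max (nndist x y) (nndist z y) := by
      rw [div_le_iff₀ two_pos, mul_two]
      refine (nndist_triangle_right x z y).trans ?_
      exact add_le_add (le_max_left _ _) (le_max_right _ _)
    refine lt_of_lt_of_le ?_ (hφ.antitone h3)
    rcases max_choice (nndist x y) (nndist z y) with h | h <;> rw [h] <;> assumption
  refine two_mul_prod_le ν τ (hset t) (hset' t) (hset' t) ?_ ?_
  · exact fun x x' y h1 h2 => hdist x y x' h1 h2
  · intro x y y' h1 h2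
    refine hdist y x y' ?_ ?_
    · rw [nndist_comm]; exact h1
    · rw [nndist_comm]; exact h2

/-- `φ(r/2) ≤ C φ(r) + C`. -/
theorem KernelRestriction.half {δ : ℝ≥0} (hδ : 0 < δ) (h : KernelRestriction φ δ)
    (hφ : IsRegularityKernel φ) (hφ0 : φ 0 = ∞) :
    ∃ C : ℝ≥0, 0 < C ∧ ∀ r : ℝ≥0, φ (r / 2) ≤ C * φ r + C := by
  obtain ⟨c₂, c₃, hc⟩ := h
  -- Iterating the growth condition replaces the factor `1 + 2δ` by any of its powers, and some
  -- power is at least 2.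
  have key : ∀ n : ℕ, ∃ C : ℝ≥0, ∀ r : ℝ≥0, 0 < r → φ r ≤ C * φ (r * (1 + 2 * δ) ^ n) + C := by
    intro n
    induction n with
    | zero => exact ⟨1, fun r _ => by simp⟩
    | succ n ih =>
      obtain ⟨C, hC⟩ := ih
      refine ⟨C * c₂ + (C * c₃ + C), fun r hr => (hC r hr).trans ?_⟩
      have hpos : 0 < r * (1 + 2 * δ) ^ n := by positivity
      have h1 := hc _ hpos
      rw [mul_assoc, ← pow_succ] at h1
      calc (C : ℝ≥0∞) * φ (r * (1 + 2 * δ) ^ n) + C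
          ≤ C * (c₂ * φ (r * (1 + 2 * δ) ^ (n + 1)) + c₃) + C := by gcongr
        _ = (C * c₂) * φ (r * (1 + 2 * δ) ^ (n + 1)) + (C * c₃ + C) := by ring
        _ ≤ _ := by
          push_cast
          exact add_le_add (by gcongr; exact le_self_add) le_add_self
  obtain ⟨n, hn⟩ : ∃ n : ℕ, 2 ≤ (1 + 2 * δ) ^ n :=
    (pow_unbounded_of_one_lt 2 (by simpa using hδ)).imp fun n hn => hn.le
  obtain ⟨C, hC⟩ := key n
  -- `C + 1` is positive, so that at `r = 0` the right-hand side is `∞` as well.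
  refine ⟨C + 1, by positivity, fun r => ?_⟩
  rcases eq_or_ne r 0 with rfl | hr
  · rw [hφ0, ENNReal.mul_top (by simp)]; simp
  have hr' : 0 < r / 2 := by positivity
  refine (hC _ hr').trans ?_
  have : r ≤ r / 2 * (1 + 2 * δ) ^ n := by
    calc r = r / 2 * 2 := by rw [div_mul_cancel₀ _ two_ne_zero]
      _ ≤ _ := by gcongr
  push_cast
  gcongr
  · exact le_self_add
  · exact hφ.antitone this
  · exact le_self_add

end Energy

/-! ### Convergence of the second moments to the integral of `F` -/

section Kernels

variable {X : Type*} [MetricSpace X] [MeasurableSpace X] [SecondCountableTopology X] [BorelSpace X]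
  {Ω : Type*} [MeasurableSpace Ω]

/-- The standing assumptions on the kernel, the partitions and the random closed set. -/
structure Admissible (P : Measure Ω) (φ : ℝ≥0 → ℝ≥0∞) (𝒬 : ℕ → Set (Set X)) (B : Ω → Set X)
    (δ : ℝ≥0) (F : X → X → ℝ≥0∞) : Prop where
  kernel : IsRegularityKernel φ
  kernel_zero : φ 0 = ∞
  partition : IsPartitionSequence 𝒬
  randomSet : IsRandomClosedSet P 𝒬 B
  lower : LowerHitting P φ 𝒬 B
  delta_pos : 0 < δ
  restriction : KernelRestriction φ δ
  independence : CapacityIndependence P φ 𝒬 B δ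
  subdivision : BoundedSubdivision 𝒬 δ
  eq_lowerF : ∀ x y, F x y = lowerF P 𝒬 B x y
  eq_upperF : ∀ x y, F x y = upperF P 𝒬 B x y
  polar : ∀ D : Set X, IsCompact D → D ⊆ coreSet 𝒬 → capacity φ D = 0 → ∀ᵐ ω ∂P, B ω ∩ D = ∅

variable {P : Measure Ω} {φ : ℝ≥0 → ℝ≥0∞} {𝒬 : ℕ → Set (Set X)} {B : Ω → Set X}
  {δ : ℝ≥0} {F : X → X → ℝ≥0∞}

/-! #### Distances of cells -/

theorem setDist_comm (Q S : Set X) : setDist Q S = setDist S Q := by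
  refine (Equiv.prodComm Q S).iInf_congr fun p => ?_
  exact nndist_comm _ _

theorem edist_le_setDist {Q S : Set X} {x y : X} (hx : x ∈ Q) (hy : y ∈ S) :
    edist x y ≤ setDist Q S + 2 * max (Metric.ediam Q) (Metric.ediam S) := by
  have : Nonempty (Q × S) := ⟨⟨⟨x, hx⟩, ⟨y, hy⟩⟩⟩
  have h : ∀ p : Q × S, edist x y ≤
      (nndist (p.1 : X) (p.2 : X) : ℝ≥0∞) + 2 * max (Metric.ediam Q) (Metric.ediam S) := by
    intro p
    calc edist x y ≤ edist x p.1 + edist (p.1 : X) p.2 + edist (p.2 : X) y := edist_triangle4 _ _ _ _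
      _ ≤ max (Metric.ediam Q) (Metric.ediam S) + nndist (p.1 : X) (p.2 : X) +
          max (Metric.ediam Q) (Metric.ediam S) := by
        rw [edist_nndist (p.1 : X)]
        gcongr
        · exact (Metric.edist_le_ediam_of_mem hx p.1.2).trans (le_max_left _ _)
        · exact (Metric.edist_le_ediam_of_mem p.2.2 hy).trans (le_max_right _ _)
      _ = _ := by ring
  rw [setDist, ENNReal.coe_iInf, ENNReal.iInf_add]
  exact le_iInf h

/-- The largest diameter of a cell of order `k`. -/
noncomputable def mesh (𝒬 : ℕ → Set (Set X)) (k : ℕ) : ℝ≥0∞ := ⨆ Q ∈ 𝒬 k, Metric.ediam Q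

theorem ediam_le_mesh {k : ℕ} {Q : Set X} (hQ : Q ∈ 𝒬 k) : Metric.ediam Q ≤ mesh 𝒬 k :=
  le_iSup₂ (f := fun Q (_ : Q ∈ 𝒬 k) => Metric.ediam Q) Q hQ

/-- Cells that are not far satisfy `δ dist(Q,S) ≤ mesh`, hence `δ d(x,y) ≤ (1 + 2δ) mesh`, which
fails for large `k`. So only the diagonal can obstruct passing to the limit. -/
theorem eventually_far (h𝒬 : IsPartitionSequence 𝒬) (hδ : 0 < δ) {x y : X} (hxy : x ≠ y) :
    ∀ᶠ k in atTop, ∀ Q ∈ 𝒬 k, ∀ S ∈ 𝒬 k, x ∈ Q → y ∈ S →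
      max (Metric.ediam Q) (Metric.ediam S) < ((δ * setDist Q S : ℝ≥0) : ℝ≥0∞) := by
  have h0 : Tendsto (fun k => (1 + 2 * (δ : ℝ≥0∞)) * mesh 𝒬 k) atTop (𝓝 0) := by
    have : (1 + 2 * (δ : ℝ≥0∞)) ≠ ∞ := by finiteness
    have h1 := ENNReal.Tendsto.const_mul h𝒬.tendsto_diam (Or.inr this)
    rwa [mul_zero] at h1
  have hpos : 0 < (δ : ℝ≥0∞) * edist x y := by
    have : 0 < edist x y := edist_pos.2 hxy
    have : 0 < (δ : ℝ≥0∞) := by exact_mod_cast hδ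
    positivity
  filter_upwards [(tendsto_order.1 h0).2 _ hpos] with k hk Q hQ S hS hx hy
  by_contra hcon
  rw [not_lt] at hcon
  have hD : max (Metric.ediam Q) (Metric.ediam S) ≤ mesh 𝒬 k :=
    max_le (ediam_le_mesh hQ) (ediam_le_mesh hS)
  refine absurd hk (not_lt.2 ?_)
  calc (δ : ℝ≥0∞) * edist x y
      ≤ δ * (setDist Q S + 2 * max (Metric.ediam Q) (Metric.ediam S)) := by
        gcongr; exact edist_le_setDist hx hy
    _ = (δ * setDist Q S : ℝ≥0) + 2 * δ * max (Metric.ediam Q) (Metric.ediam S) := by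
        push_cast; ring
    _ ≤ mesh 𝒬 k + 2 * δ * mesh 𝒬 k := by
        gcongr
        exact hcon.trans hD
    _ = _ := by ring

/-! #### The limit kernel -/

theorem measurableSet_coreSet (h𝒬 : IsPartitionSequence 𝒬) : MeasurableSet (coreSet 𝒬) :=
  MeasurableSet.iInter fun k =>
    MeasurableSet.sUnion (h𝒬.countable k) fun Q hQ => h𝒬.measurableSet k Q hQ

/-- The lower envelopes that define `lowerF`. -/
noncomputable def infF (P : Measure Ω) (𝒬 : ℕ → Set (Set X)) (B : Ω → Set X) (N : ℕ) (x y : X) :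
    ℝ≥0∞ :=
  ⨅ (k : ℕ) (_ : N ≤ k) (n : ℕ) (_ : N ≤ n), kernelF P 𝒬 B k n x y

theorem monotone_infF (x y : X) : Monotone fun N => infF P 𝒬 B N x y := by
  intro N N' h
  refine le_iInf₂ fun k hk => le_iInf₂ fun n hn => ?_
  exact (iInf₂_le k (h.trans hk)).trans (iInf₂_le n (h.trans hn))

theorem infF_le {N k n : ℕ} (hk : N ≤ k) (hn : N ≤ n) (x y : X) :
    infF P 𝒬 B N x y ≤ kernelF P 𝒬 B k n x y :=
  (iInf₂_le k hk).trans (iInf₂_le n hn)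

theorem measurable_infF [IsProbabilityMeasure P] (h𝒬 : IsPartitionSequence 𝒬)
    (hB : IsRandomClosedSet P 𝒬 B) (N : ℕ) :
    Measurable fun p : X × X => infF P 𝒬 B N p.1 p.2 :=
  Measurable.iInf fun k => Measurable.iInf fun _ => Measurable.iInf fun n => Measurable.iInf fun _ =>
    measurable_kernelF h𝒬 hB k n

theorem Admissible.eq_iSup_infF (h : Admissible P φ 𝒬 B δ F) (x y : X) :
    F x y = ⨆ N, infF P 𝒬 B N x y := by
  rw [h.eq_lowerF]
  exact (tendsto_atTop_iSup (monotone_infF x y)).liminf_eq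

/-- `F_{k,k}` is squeezed between the lower and the upper envelope, which have the common limit `F`.
-/
theorem Admissible.tendsto_kernelF (h : Admissible P φ 𝒬 B δ F) (x y : X) :
    Tendsto (fun k => kernelF P 𝒬 B k k x y) atTop (𝓝 (F x y)) := by
  let b : ℕ → ℝ≥0∞ := fun N =>
    ⨆ (k : ℕ) (_ : N ≤ k) (n : ℕ) (_ : N ≤ n), kernelF P 𝒬 B k n x y
  have hanti : Antitone b := by
    intro N N' hN
    refine iSup₂_le fun k hk => iSup₂_le fun n hn => ?_
    exact le_iSup₂_of_le k (hN.trans hk) (le_iSup₂_of_le n (hN.trans hn) le_rfl)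
  have h1 : Tendsto (fun N => infF P 𝒬 B N x y) atTop (𝓝 (F x y)) := by
    rw [h.eq_iSup_infF]
    exact tendsto_atTop_iSup (monotone_infF x y)
  have h2 : Tendsto b atTop (𝓝 (F x y)) := by
    have h3 := tendsto_atTop_iInf hanti
    have h4 : F x y = ⨅ N, b N := by
      rw [h.eq_upperF]; exact h3.limsup_eq
    rwa [h4]
  refine tendsto_of_tendsto_of_tendsto_of_le_of_le h1 h2 (fun k => infF_le le_rfl le_rfl x y) ?_
  exact fun k => le_iSup₂_of_le k le_rfl (le_iSup₂_of_le k le_rfl le_rfl)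

theorem Admissible.measurable [IsProbabilityMeasure P] (h : Admissible P φ 𝒬 B δ F) :
    Measurable fun p : X × X => F p.1 p.2 :=
  measurable_of_tendsto_metrizable (fun k => measurable_kernelF h.partition h.randomSet k k)
    (tendsto_pi_nhds.2 fun p => h.tendsto_kernelF p.1 p.2)

theorem kernelF_le_of_far [IsProbabilityMeasure P] (h𝒬 : IsPartitionSequence 𝒬)
    {c : ℝ≥0} {k n : ℕ} {Q S : Set X} {x y : X} (hQ : Q ∈ 𝒬 k) (hx : x ∈ Q) (hS : S ∈ 𝒬 n) (hy : y ∈ S)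
    (hc : P (hit B Q ∩ hit B S) ≤ c * P (hit B Q) * P (hit B S) * φ (setDist Q S)) :
    kernelF P 𝒬 B k n x y ≤ c * φ (setDist Q S) := by
  rw [kernelF_of_mem h𝒬 hQ hx hS hy]
  refine ENNReal.div_le_of_le_mul (hc.trans (le_of_eq ?_))
  ring

/-- `F ≤ c φ`. -/
theorem Admissible.exists_le [IsProbabilityMeasure P] (h : Admissible P φ 𝒬 B δ F) :
    ∃ c : ℝ≥0, 0 < c ∧ ∀ x y, F x y ≤ c * φ (nndist x y) := by
  obtain ⟨c, hc0, hc⟩ := h.independence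
  refine ⟨c, hc0, fun x y => ?_⟩
  -- On the diagonal the bound is trivial, as `φ(0) = ∞` and `c > 0`. Off the diagonal the cells are
  -- eventually far and `dist(Q,S) ≥ d(x,y) - 2 mesh`, so continuity of `φ` gives the bound in the
  -- limit.
  rcases eq_or_ne x y with rfl | hxy
  · rw [nndist_self, h.kernel_zero, ENNReal.mul_top (by exact_mod_cast hc0.ne')]
    exact le_top
  have hlim : Tendsto (fun k => (c : ℝ≥0∞) * φ (nndist x y - 2 * (mesh 𝒬 k).toNNReal)) atTop
      (𝓝 (c * φ (nndist x y))) := by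
    refine ENNReal.Tendsto.const_mul ?_ (Or.inr ENNReal.coe_ne_top)
    refine (h.kernel.continuous.tendsto _).comp ?_
    have h1 : Tendsto (fun k => (mesh 𝒬 k).toNNReal) atTop (𝓝 0) :=
      (ENNReal.tendsto_toNNReal ENNReal.zero_ne_top).comp h.partition.tendsto_diam
    simpa using (tendsto_const_nhds (x := nndist x y)).sub (h1.const_mul 2)
  refine le_of_tendsto_of_tendsto (h.tendsto_kernelF x y) hlim ?_
  have hfin : ∀ᶠ k in atTop, mesh 𝒬 k < ∞ :=
    (tendsto_order.1 h.partition.tendsto_diam).2 _ ENNReal.zero_lt_top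
  filter_upwards [eventually_far h.partition h.delta_pos hxy, hfin] with k hk hkfin
  by_cases hx : x ∈ ⋃₀ 𝒬 k
  · by_cases hy : y ∈ ⋃₀ 𝒬 k
    · obtain ⟨Q, hQ, hxQ⟩ := hx
      obtain ⟨S, hS, hyS⟩ := hy
      refine (kernelF_le_of_far h.partition hQ hxQ hS hyS
        (hc k k Q hQ S hS (hk Q hQ S hS hxQ hyS))).trans ?_
      gcongr
      refine h.kernel.antitone ?_
      rw [tsub_le_iff_right, ← ENNReal.coe_le_coe]
      push_cast
      rw [ENNReal.coe_toNNReal hkfin.ne]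
      refine (edist_le_setDist hxQ hyS).trans ?_
      gcongr
      exact max_le (ediam_le_mesh hQ) (ediam_le_mesh hS)
    · simp [kernelF, cell_eq_empty hy]
  · simp [kernelF, cell_eq_empty hx]

/-! #### The diagonal part -/

/-- The set of pairs of points in distant cells of order `k`. -/
def farSet (𝒬 : ℕ → Set (Set X)) (δ : ℝ≥0) (k : ℕ) : Set (X × X) :=
  ⋃ p : 𝒬 k × 𝒬 k, {q | max (Metric.ediam (p.1 : Set X)) (Metric.ediam (p.2 : Set X)) <
    ((δ * setDist (p.1 : Set X) p.2 : ℝ≥0) : ℝ≥0∞) ∧ q ∈ (p.1 : Set X) ×ˢ (p.2 : Set X)}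

theorem measurableSet_farSet (h𝒬 : IsPartitionSequence 𝒬) (δ : ℝ≥0) (k : ℕ) :
    MeasurableSet (farSet 𝒬 δ k) := by
  have := (h𝒬.countable k).to_subtype
  refine MeasurableSet.iUnion fun p => ?_
  exact (MeasurableSet.const _).inter
    ((h𝒬.measurableSet k _ p.1.2).prod (h𝒬.measurableSet k _ p.2.2))

theorem mem_farSet {k : ℕ} {Q S : Set X} {x y : X} (hQ : Q ∈ 𝒬 k) (hS : S ∈ 𝒬 k)
    (hx : x ∈ Q) (hy : y ∈ S) (hfar : max (Metric.ediam Q) (Metric.ediam S) <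
      ((δ * setDist Q S : ℝ≥0) : ℝ≥0∞)) : (x, y) ∈ farSet 𝒬 δ k :=
  mem_iUnion.2 ⟨⟨⟨Q, hQ⟩, ⟨S, hS⟩⟩, hfar, hx, hy⟩

/-- The normalised restriction of `ν` to `Q` is a test measure for the capacity, so `C_φ(Q) ≥ ν(Q)²
/ I_φ(ν|_Q)`. The lower hitting bound then turns this into a bound by the energy. -/
theorem mul_sq_le_energy [IsProbabilityMeasure P] {a : ℝ≥0} {Q : Set X}
    (hlow : a * capacity φ Q ≤ P (hit B Q)) (hpos : 0 < P (hit B Q)) (hQ : MeasurableSet Q)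
    (ν : Measure X) [IsFiniteMeasure ν] :
    a * (ν Q ^ 2 / P (hit B Q)) ≤ energy φ (ν.restrict Q) := by
  rcases eq_or_ne (ν Q) 0 with h0 | h0
  · simp [h0]
  have hprob : IsProbabilityMeasure ((ν Q)⁻¹ • ν.restrict Q) :=
    ⟨by simp [ENNReal.inv_mul_cancel h0 (measure_ne_top ν Q)]⟩
  have hcapm : (energy φ ((ν Q)⁻¹ • ν.restrict Q))⁻¹ ≤ capacity φ Q := by
    refine le_iSup_of_le _ (le_iSup_of_le hprob (le_iSup_of_le ?_ le_rfl))
    simp [Measure.restrict_apply hQ.compl]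
  have hen : energy φ ((ν Q)⁻¹ • ν.restrict Q) =
      (ν Q)⁻¹ * ((ν Q)⁻¹ * energy φ (ν.restrict Q)) := by
    unfold energy
    simp only [lintegral_smul_measure, smul_eq_mul]
    rw [lintegral_const_mul' _ _ (ENNReal.inv_ne_top.2 h0)]
  have hinv : (energy φ ((ν Q)⁻¹ • ν.restrict Q))⁻¹ = ν Q ^ 2 / energy φ (ν.restrict Q) := by
    have ht : ν Q ≠ ∞ := measure_ne_top ν Q
    rw [hen, ENNReal.mul_inv (Or.inl (ENNReal.inv_ne_zero.2 ht)) (Or.inl (ENNReal.inv_ne_top.2 h0)),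
      ENNReal.mul_inv (Or.inl (ENNReal.inv_ne_zero.2 ht)) (Or.inl (ENNReal.inv_ne_top.2 h0)),
      inv_inv, sq, ENNReal.div_eq_inv_mul]
    ring
  rw [hinv] at hcapm
  have h1 : a * ν Q ^ 2 / energy φ (ν.restrict Q) ≤ P (hit B Q) := by
    rw [mul_div_assoc]
    exact (mul_le_mul_right hcapm _).trans hlow
  rw [ENNReal.div_le_iff_le_mul (Or.inr (measure_ne_top _ _)) (Or.inr hpos.ne')] at h1
  rw [← mul_div_assoc]
  refine ENNReal.div_le_of_le_mul ?_
  rwa [mul_comm (energy _ _)]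

/-- The kernel is `∞` on the diagonal, so a finite integral makes the diagonal a null set. -/
theorem ae_ne_of_lintegral_kernel (h : Admissible P φ 𝒬 B δ F) {ρ : Measure (X × X)}
    (hρ : ∫⁻ p, φ (nndist p.1 p.2) ∂ρ ≠ ∞) : ∀ᵐ p ∂ρ, p.1 ≠ p.2 := by
  filter_upwards [ae_lt_top (measurable_kernel h.kernel) hρ] with p hp heq
  rw [heq, nndist_self, h.kernel_zero] at hp
  exact lt_irrefl _ hp

/-- The energies of the restrictions of `ν` to the cells of order `k` add up to a null sequence. -/
theorem Admissible.tendsto_tsum_energy (h : Admissible P φ 𝒬 B δ F) {ν : Measure X}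
    [IsFiniteMeasure ν] (hν : energy φ ν < ∞) :
    Tendsto (fun k => ∑' Q : 𝒬 k, energy φ (ν.restrict (Q : Set X))) atTop (𝓝 0) := by
  have h𝒬 := h.partition
  rw [energy_eq_lintegral_prod h.kernel] at hν
  have hmeas : ∀ k, ∀ Q : 𝒬 k, MeasurableSet ((Q : Set X) ×ˢ (Q : Set X)) := fun k Q =>
    (h𝒬.measurableSet k Q Q.2).prod (h𝒬.measurableSet k Q Q.2)
  have hU : ∀ k, MeasurableSet (⋃ Q : 𝒬 k, (Q : Set X) ×ˢ (Q : Set X)) := fun k => by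
    have := (h𝒬.countable k).to_subtype
    exact MeasurableSet.iUnion (hmeas k)
  -- The energies add up to the integral of `φ` over the disjoint squares `Q × Q`. Any point off the
  -- diagonal leaves all squares as the mesh shrinks, so dominated convergence with majorant `φ`
  -- applies.
  have hsum : ∀ k, ∑' Q : 𝒬 k, energy φ (ν.restrict (Q : Set X)) =
      ∫⁻ p, (⋃ Q : 𝒬 k, (Q : Set X) ×ˢ (Q : Set X)).indicator
        (fun p => φ (nndist p.1 p.2)) p ∂(ν.prod ν) := by
    intro k
    have := (h𝒬.countable k).to_subtype
    rw [lintegral_indicator (hU k), lintegral_iUnion (hmeas k)]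
    · refine tsum_congr fun Q => ?_
      rw [energy_eq_lintegral_prod h.kernel, Measure.prod_restrict]
    · intro Q S hQS
      refine Set.disjoint_left.2 fun p hp hp' => hQS ?_
      exact Subtype.ext (h𝒬.eq_of_mem Q.2 S.2 hp.1 hp'.1)
  simp_rw [hsum]
  have hlim := tendsto_lintegral_of_dominated_convergence (μ := ν.prod ν) (f := fun _ => 0)
    (F := fun k p => (⋃ Q : 𝒬 k, (Q : Set X) ×ˢ (Q : Set X)).indicator
        (fun p => φ (nndist p.1 p.2)) p)
    (fun p => φ (nndist p.1 p.2))
    (fun k => (measurable_kernel h.kernel).indicator (hU k))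
    (fun k => Eventually.of_forall fun p => indicator_le_self' (fun _ _ => zero_le) p)
    hν.ne ?_
  · simpa using hlim
  · filter_upwards [ae_ne_of_lintegral_kernel h hν.ne] with p hp
    have hpos : 0 < edist p.1 p.2 := edist_pos.2 hp
    refine tendsto_const_nhds.congr' ?_
    filter_upwards [(tendsto_order.1 h𝒬.tendsto_diam).2 _ hpos] with k hk
    refine (indicator_of_notMem ?_ _).symm
    intro hmem
    obtain ⟨Q, hQ⟩ := mem_iUnion.1 hmem
    exact absurd hk (not_lt.2 ((Metric.edist_le_ediam_of_mem hQ.1 hQ.2).trans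
      (ediam_le_mesh Q.2)))

/-- With `u = m/p` and `v = m'/q` the left side is `2ruv ≤ r u² + r v²`, and `r ≤ p`, `r ≤ q`
finish. Here `r` is a joint hitting probability, and the interaction of two cells is split into
terms that involve one cell each. -/
theorem two_mul_near_term_le {m m' p q r : ℝ≥0∞} (hp0 : p ≠ 0) (hpt : p ≠ ∞) (hq0 : q ≠ 0)
    (hqt : q ≠ ∞) (hm : m ≠ ∞) (hm' : m' ≠ ∞) (hrp : r ≤ p) (hrq : r ≤ q) :
    2 * (m * m' * (r / (p * q))) ≤ m ^ 2 / p + m' ^ 2 / q := by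
  have hrt : r ≠ ∞ := ne_top_of_le_ne_top hpt hrp
  lift m to ℝ≥0 using hm
  lift m' to ℝ≥0 using hm'
  lift p to ℝ≥0 using hpt
  lift q to ℝ≥0 using hqt
  lift r to ℝ≥0 using hrt
  have hp0' : p ≠ 0 := by exact_mod_cast hp0
  have hq0' : q ≠ 0 := by exact_mod_cast hq0
  rw [← ENNReal.coe_mul p, ← ENNReal.coe_div (mul_ne_zero hp0' hq0'), ← ENNReal.coe_pow,
    ← ENNReal.coe_pow, ← ENNReal.coe_div hp0', ← ENNReal.coe_div hq0']
  norm_cast at hrp hrq ⊢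
  rw [← NNReal.coe_le_coe] at hrp hrq ⊢
  push_cast
  have h1 : (0 : ℝ) < p := NNReal.coe_pos.2 (pos_iff_ne_zero.2 hp0')
  have h2 : (0 : ℝ) < q := NNReal.coe_pos.2 (pos_iff_ne_zero.2 hq0')
  have h3 : (0 : ℝ) ≤ r := r.2
  have e1 : (r : ℝ) * (m / p) ^ 2 ≤ (m : ℝ) ^ 2 / p := by
    calc (r : ℝ) * (m / p) ^ 2 ≤ p * (m / p) ^ 2 := by gcongr
      _ = (m : ℝ) ^ 2 / p := by field_simp
  have e2 : (r : ℝ) * (m' / q) ^ 2 ≤ (m' : ℝ) ^ 2 / q := by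
    calc (r : ℝ) * (m' / q) ^ 2 ≤ q * (m' / q) ^ 2 := by gcongr
      _ = (m' : ℝ) ^ 2 / q := by field_simp
  have e3 : (2 : ℝ) * (m * m' * (r / (p * q))) = r * (2 * (m / p) * (m' / q)) := by field_simp
  rw [e3]
  have e4 : 2 * ((m : ℝ) / p) * (m' / q) ≤ (m / p) ^ 2 + (m' / q) ^ 2 := two_mul_le_add_sq _ _
  calc (r : ℝ) * (2 * (m / p) * (m' / q)) ≤ r * ((m / p) ^ 2 + (m' / q) ^ 2) := by gcongr
    _ ≤ _ := by rw [mul_add]; exact add_le_add e1 e2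

open Classical in
theorem tsum_near_le {M : ℕ} {k : ℕ} {Q : Set X} (hM : {S ∈ 𝒬 k |
      ((δ * setDist Q S : ℝ≥0) : ℝ≥0∞) ≤ max (Metric.ediam Q) (Metric.ediam S)}.encard ≤ M)
    (c : ℝ≥0∞) :
    ∑' S : 𝒬 k, (if ((δ * setDist Q (S : Set X) : ℝ≥0) : ℝ≥0∞) ≤
      max (Metric.ediam Q) (Metric.ediam (S : Set X)) then c else 0) ≤ M * c := by
  have h1 : ∑' S : 𝒬 k, (if ((δ * setDist Q (S : Set X) : ℝ≥0) : ℝ≥0∞) ≤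
      max (Metric.ediam Q) (Metric.ediam (S : Set X)) then c else 0) =
      ∑' S : {S ∈ 𝒬 k | ((δ * setDist Q S : ℝ≥0) : ℝ≥0∞) ≤
        max (Metric.ediam Q) (Metric.ediam S)}, c := by
    rw [tsum_subtype (𝒬 k) fun S => if ((δ * setDist Q S : ℝ≥0) : ℝ≥0∞) ≤
      max (Metric.ediam Q) (Metric.ediam S) then c else 0, tsum_subtype _ fun _ => c]
    refine tsum_congr fun S => ?_
    by_cases hS : S ∈ 𝒬 k <;> by_cases hn : ((δ * setDist Q S : ℝ≥0) : ℝ≥0∞) ≤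
      max (Metric.ediam Q) (Metric.ediam S) <;> simp [indicator, hS]
  rw [h1, ENNReal.tsum_set_const]
  gcongr
  have h2 := ENat.toENNReal_mono hM
  simpa using h2

/-- The contribution of neighbouring cells to `∫∫ F_{k,k} dν dτ` tends to zero. -/
theorem Admissible.tendsto_near [IsProbabilityMeasure P] (h : Admissible P φ 𝒬 B δ F)
    {ν τ : Measure X} [IsFiniteMeasure ν] [IsFiniteMeasure τ] (hν : energy φ ν < ∞)
    (hτ : energy φ τ < ∞) :
    Tendsto (fun k => ∫⁻ p in (farSet 𝒬 δ k)ᶜ, kernelF P 𝒬 B k k p.1 p.2 ∂(ν.prod τ)) atTop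
      (𝓝 0) := by
  classical
  have h𝒬 := h.partition
  have hB := h.randomSet
  obtain ⟨a, ha, hlow⟩ := h.lower
  obtain ⟨M, hM⟩ := h.subdivision
  let near : Set X → Set X → Prop := fun Q S => ((δ * setDist Q S : ℝ≥0) : ℝ≥0∞) ≤
    max (Metric.ediam Q) (Metric.ediam S)
  have near_comm : ∀ Q S, near Q S ↔ near S Q := fun Q S => by
    simp only [near, setDist_comm Q S, max_comm]
  let κ : Set X → Set X → ℝ≥0∞ := fun Q S =>
    P (hit B Q ∩ hit B S) / (P (hit B Q) * P (hit B S))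
  -- The integral over near pairs is at most a double sum over near cells. Splitting each term by
  -- `two_mul_near_term_le` leaves one sum for `ν` and one for `τ`.
  have hstep : ∀ k, 2 * ∫⁻ p in (farSet 𝒬 δ k)ᶜ, kernelF P 𝒬 B k k p.1 p.2 ∂(ν.prod τ) ≤
      M * ((a : ℝ≥0∞)⁻¹ * ∑' Q : 𝒬 k, energy φ (ν.restrict (Q : Set X))) +
      M * ((a : ℝ≥0∞)⁻¹ * ∑' Q : 𝒬 k, energy φ (τ.restrict (Q : Set X))) := by
    intro k
    have := (h𝒬.countable k).to_subtype
    have hpt : ∀ p ∈ (farSet 𝒬 δ k)ᶜ, kernelF P 𝒬 B k k p.1 p.2 ≤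
        ∑' Q : 𝒬 k, ∑' S : 𝒬 k, if near Q S then
          ((Q : Set X) ×ˢ (S : Set X)).indicator (fun _ => κ Q S) p else 0 := by
      intro p hp
      by_cases hx : p.1 ∈ ⋃₀ 𝒬 k
      · by_cases hy : p.2 ∈ ⋃₀ 𝒬 k
        · obtain ⟨Q, hQ, hxQ⟩ := hx
          obtain ⟨S, hS, hyS⟩ := hy
          refine le_trans ?_ (ENNReal.le_tsum (⟨Q, hQ⟩ : 𝒬 k))
          refine le_trans ?_ (ENNReal.le_tsum (⟨S, hS⟩ : 𝒬 k))
          have hn : near Q S := by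
            by_contra hcon
            exact hp (mem_farSet hQ hS hxQ hyS (not_le.1 hcon))
          rw [if_pos hn, indicator_of_mem (show p ∈ Q ×ˢ S from ⟨hxQ, hyS⟩),
            kernelF_of_mem h𝒬 hQ hxQ hS hyS]
        · simp [kernelF, cell_eq_empty hy]
      · simp [kernelF, cell_eq_empty hx]
    have hmeas : ∀ Q S : 𝒬 k, Measurable fun p : X × X => if near Q S then
        ((Q : Set X) ×ˢ (S : Set X)).indicator (fun _ => κ Q S) p else 0 := by
      intro Q S
      by_cases hn : near Q S
      · simp only [if_pos hn]
        exact measurable_const.indicator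
          ((h𝒬.measurableSet k Q Q.2).prod (h𝒬.measurableSet k S S.2))
      · simp only [if_neg hn]
        exact measurable_const
    have h1 : ∫⁻ p in (farSet 𝒬 δ k)ᶜ, kernelF P 𝒬 B k k p.1 p.2 ∂(ν.prod τ) ≤
        ∑' Q : 𝒬 k, ∑' S : 𝒬 k, if near Q S then ν Q * τ S * κ Q S else 0 := by
      calc _ ≤ ∫⁻ p in (farSet 𝒬 δ k)ᶜ, ∑' Q : 𝒬 k, ∑' S : 𝒬 k, (if near Q S then
          ((Q : Set X) ×ˢ (S : Set X)).indicator (fun _ => κ Q S) p else 0) ∂(ν.prod τ) :=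
            setLIntegral_mono' (measurableSet_farSet h𝒬 δ k).compl hpt
        _ ≤ ∫⁻ p, ∑' Q : 𝒬 k, ∑' S : 𝒬 k, (if near Q S then
          ((Q : Set X) ×ˢ (S : Set X)).indicator (fun _ => κ Q S) p else 0) ∂(ν.prod τ) :=
            setLIntegral_le_lintegral _ _
        _ = _ := by
          rw [lintegral_tsum fun Q => (Measurable.tsum fun S => hmeas Q S).aemeasurable]
          refine tsum_congr fun Q => ?_
          rw [lintegral_tsum fun S => (hmeas Q S).aemeasurable]
          refine tsum_congr fun S => ?_
          by_cases hn : near Q S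
          · simp only [if_pos hn]
            rw [lintegral_indicator ((h𝒬.measurableSet k Q Q.2).prod (h𝒬.measurableSet k S S.2)),
              setLIntegral_const, Measure.prod_prod, mul_comm]
          · simp only [if_neg hn, lintegral_zero]
    have hterm : ∀ Q S : 𝒬 k, 2 * (if near Q S then ν Q * τ S * κ Q S else 0) ≤
        (if near Q S then ν Q ^ 2 / P (hit B (Q : Set X)) else 0) +
        (if near S Q then τ S ^ 2 / P (hit B (S : Set X)) else 0) := by
      intro Q S
      by_cases hn : near Q S
      · rw [if_pos hn, if_pos hn, if_pos ((near_comm _ _).1 hn)]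
        exact two_mul_near_term_le (hB.hit_pos k Q Q.2).ne' (measure_ne_top _ _)
          (hB.hit_pos k S S.2).ne' (measure_ne_top _ _) (measure_ne_top _ _) (measure_ne_top _ _)
          (measure_mono inter_subset_left) (measure_mono inter_subset_right)
      · simp [hn]
    -- The summand does not depend on `S`, so a row contributes at most `M` copies of it;
    -- `mul_sq_le_energy` bounds the summand by an energy.
    have hrow : ∀ (σ : Measure X) [IsFiniteMeasure σ], ∑' Q : 𝒬 k, ∑' S : 𝒬 k,
        (if near Q S then σ Q ^ 2 / P (hit B (Q : Set X)) else 0) ≤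
        M * ((a : ℝ≥0∞)⁻¹ * ∑' Q : 𝒬 k, energy φ (σ.restrict (Q : Set X))) := by
      intro σ _
      rw [← ENNReal.tsum_mul_left, ← ENNReal.tsum_mul_left]
      refine ENNReal.tsum_le_tsum fun Q => ?_
      refine (tsum_near_le (hM k Q Q.2) _).trans ?_
      gcongr
      have ha0 : (a : ℝ≥0∞) ≠ 0 := by exact_mod_cast ha.ne'
      rw [← ENNReal.div_eq_inv_mul, ENNReal.le_div_iff_mul_le (Or.inl ha0)
        (Or.inl ENNReal.coe_ne_top), mul_comm]
      exact mul_sq_le_energy (hlow k Q Q.2) (hB.hit_pos k Q Q.2) (h𝒬.measurableSet k Q Q.2) σ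
    calc _ ≤ 2 * ∑' Q : 𝒬 k, ∑' S : 𝒬 k, (if near Q S then ν Q * τ S * κ Q S else 0) := by gcongr
      _ ≤ ∑' Q : 𝒬 k, ∑' S : 𝒬 k,
          ((if near Q S then ν Q ^ 2 / P (hit B (Q : Set X)) else 0) +
            (if near S Q then τ S ^ 2 / P (hit B (S : Set X)) else 0)) := by
        simp_rw [← ENNReal.tsum_mul_left]
        exact ENNReal.tsum_le_tsum fun Q => ENNReal.tsum_le_tsum fun S => hterm Q S
      _ = (∑' Q : 𝒬 k, ∑' S : 𝒬 k, (if near Q S then ν Q ^ 2 / P (hit B (Q : Set X)) else 0)) +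
          ∑' S : 𝒬 k, ∑' Q : 𝒬 k, (if near S Q then τ S ^ 2 / P (hit B (S : Set X)) else 0) := by
        simp_rw [ENNReal.tsum_add]
        congr 1
        exact ENNReal.tsum_comm
      _ ≤ _ := add_le_add (hrow ν) (hrow τ)
  have hlim : Tendsto (fun k => M * ((a : ℝ≥0∞)⁻¹ * ∑' Q : 𝒬 k, energy φ (ν.restrict (Q : Set X))) +
      M * ((a : ℝ≥0∞)⁻¹ * ∑' Q : 𝒬 k, energy φ (τ.restrict (Q : Set X)))) atTop (𝓝 0) := by
    have ha0 : (a : ℝ≥0∞)⁻¹ ≠ ∞ := ENNReal.inv_ne_top.2 (by exact_mod_cast ha.ne')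
    have h1 : ∀ (σ : Measure X) [IsFiniteMeasure σ], energy φ σ < ∞ → Tendsto (fun k => (M : ℝ≥0∞) *
        ((a : ℝ≥0∞)⁻¹ * ∑' Q : 𝒬 k, energy φ (σ.restrict (Q : Set X)))) atTop (𝓝 0) := by
      intro σ _ hσ
      have := ENNReal.Tendsto.const_mul (ENNReal.Tendsto.const_mul (h.tendsto_tsum_energy hσ)
        (Or.inr ha0)) (Or.inr (ENNReal.natCast_ne_top M))
      simpa using this
    simpa using (h1 ν hν).add (h1 τ hτ)
  refine tendsto_of_tendsto_of_tendsto_of_le_of_le tendsto_const_nhds hlim (fun k => zero_le)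
    fun k => le_trans ?_ (hstep k)
  exact le_mul_of_one_le_left' (by norm_num)

/-- `∫∫ F_{k,k} dν dτ → ∫∫ F dν dτ`. -/
theorem Admissible.tendsto_lintegral_kernelF [IsProbabilityMeasure P]
    (h : Admissible P φ 𝒬 B δ F) {ν τ : Measure X} [IsFiniteMeasure ν] [IsFiniteMeasure τ]
    (hν : energy φ ν < ∞) (hτ : energy φ τ < ∞)
    (hντ : ∫⁻ p, φ (nndist p.1 p.2) ∂(ν.prod τ) < ∞)
    (hν0 : ν (coreSet 𝒬)ᶜ = 0) (hτ0 : τ (coreSet 𝒬)ᶜ = 0) :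
    Tendsto (fun k => ∫⁻ p, kernelF P 𝒬 B k k p.1 p.2 ∂(ν.prod τ)) atTop
      (𝓝 (∫⁻ p, F p.1 p.2 ∂(ν.prod τ))) := by
  have h𝒬 := h.partition
  have hB := h.randomSet
  obtain ⟨c, hc0, hc⟩ := h.independence
  obtain ⟨c₂, c₃, hres⟩ := h.restriction
  -- For far cells `d(x,y) ≤ dist(Q,S) + 2 max diam ≤ (1 + 2δ) dist(Q,S)`, so capacity independence
  -- and the growth condition give `F_{k,k} ≤ c φ(dist(Q,S)) ≤ c (c₂ φ(d(x,y)) + c₃)`. The distance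
  -- is positive since strict inequality in the definition of far excludes 0.
  have hfar := tendsto_lintegral_of_dominated_convergence (μ := ν.prod τ)
    (f := fun p => F p.1 p.2)
    (F := fun k p => (farSet 𝒬 δ k).indicator (fun p => kernelF P 𝒬 B k k p.1 p.2) p)
    (fun p => c * (c₂ * φ (nndist p.1 p.2) + c₃))
    (fun k => (measurable_kernelF h𝒬 hB k k).indicator (measurableSet_farSet h𝒬 δ k))
    (fun k => Eventually.of_forall fun p => ?_) ?_ ?_
  · have := hfar.add (h.tendsto_near hν hτ)
    rw [add_zero] at this
    refine this.congr fun k => ?_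
    rw [lintegral_indicator (measurableSet_farSet h𝒬 δ k),
      lintegral_add_compl _ (measurableSet_farSet h𝒬 δ k)]
  · by_cases hp : p ∈ farSet 𝒬 δ k
    swap
    · simp only [indicator_of_notMem hp]
      exact bot_le
    simp only [indicator_of_mem hp]
    obtain ⟨⟨⟨Q, hQ⟩, ⟨S, hS⟩⟩, hf, hx, hy⟩ := mem_iUnion.1 hp
    refine (kernelF_le_of_far h𝒬 hQ hx hS hy (hc k k Q hQ S hS hf)).trans ?_
    gcongr
    have hpos : 0 < setDist Q S := by
      by_contra h0
      rw [not_lt, nonpos_iff_eq_zero] at h0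
      simp [h0] at hf
    refine (hres _ hpos).trans ?_
    gcongr
    refine h.kernel.antitone ?_
    rw [← ENNReal.coe_le_coe, ← edist_nndist]
    refine (edist_le_setDist hx hy).trans ?_
    calc (setDist Q S : ℝ≥0∞) + 2 * max (Metric.ediam Q) (Metric.ediam S)
        ≤ setDist Q S + 2 * (δ * setDist Q S : ℝ≥0) := by gcongr
      _ = _ := by push_cast; ring
  · have hm := measurable_kernel (X := X) h.kernel
    rw [lintegral_const_mul _ ((hm.const_mul _).add_const _),
      lintegral_add_right _ measurable_const, lintegral_const_mul _ hm, lintegral_const]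
    exact ENNReal.mul_ne_top ENNReal.coe_ne_top (ENNReal.add_ne_top.2
      ⟨ENNReal.mul_ne_top ENNReal.coe_ne_top hντ.ne,
        ENNReal.mul_ne_top ENNReal.coe_ne_top (measure_ne_top _ _)⟩)
  -- Almost every pair consists of distinct points of `X₀`. Their cells exist at every order and are
  -- eventually far, so the indicator is eventually 1.
  · have hx0 : ∀ᵐ p ∂(ν.prod τ), p.1 ∈ coreSet 𝒬 :=
      Measure.quasiMeasurePreserving_fst.ae (mem_ae_iff.2 hν0)
    have hy0 : ∀ᵐ p ∂(ν.prod τ), p.2 ∈ coreSet 𝒬 :=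
      Measure.quasiMeasurePreserving_snd.ae (mem_ae_iff.2 hτ0)
    filter_upwards [ae_ne_of_lintegral_kernel h hντ.ne, hx0, hy0] with p hp hx hy
    refine (h.tendsto_kernelF p.1 p.2).congr' ?_
    filter_upwards [eventually_far h𝒬 h.delta_pos hp] with k hk
    obtain ⟨Q, hQ, hxQ⟩ := mem_iInter.1 hx k
    obtain ⟨S, hS, hyS⟩ := mem_iInter.1 hy k
    rw [indicator_of_mem]
    exact mem_farSet hQ hS hxQ hyS (hk Q hQ S hS hxQ hyS)

theorem Admissible.lintegral_lt_top [IsProbabilityMeasure P]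
    (h : Admissible P φ 𝒬 B δ F) {ρ : Measure (X × X)}
    (hρ : ∫⁻ p, φ (nndist p.1 p.2) ∂ρ < ∞) : ∫⁻ p, F p.1 p.2 ∂ρ < ∞ := by
  obtain ⟨c, -, hc⟩ := h.exists_le
  refine (lintegral_mono fun p : X × X => hc p.1 p.2).trans_lt ?_
  rw [lintegral_const_mul _ (measurable_kernel h.kernel)]
  exact ENNReal.mul_lt_top ENNReal.coe_lt_top hρ

/-- Eventually `∫∫ F_{k,n} dν dτ` is almost as large as `∫∫ F dν dτ`. -/
theorem Admissible.exists_lintegral_le [IsProbabilityMeasure P]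
    (h : Admissible P φ 𝒬 B δ F) {ρ : Measure (X × X)} (hρ : ∫⁻ p, F p.1 p.2 ∂ρ < ∞)
    {ε : ℝ≥0∞} (hε : 0 < ε) : ∃ N, ∀ k n, N ≤ k → N ≤ n →
      ∫⁻ p, F p.1 p.2 ∂ρ ≤ ∫⁻ p, kernelF P 𝒬 B k n p.1 p.2 ∂ρ + ε := by
  -- By monotone convergence some lower envelope has an integral above `∫ F - ε`, and it lies below
  -- all `F_{k,n}` with `k, n ≥ N`.
  have h1 : ∫⁻ p, F p.1 p.2 ∂ρ = ⨆ N, ∫⁻ p, infF P 𝒬 B N p.1 p.2 ∂ρ := by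
    rw [← lintegral_iSup (fun N => measurable_infF h.partition h.randomSet N)
      (fun N N' hN p => monotone_infF p.1 p.2 hN)]
    exact lintegral_congr fun p => h.eq_iSup_infF p.1 p.2
  rcases eq_or_ne (∫⁻ p, F p.1 p.2 ∂ρ) 0 with h0 | h0
  · exact ⟨0, fun k n _ _ => by rw [h0]; exact zero_le⟩
  have h2 : ∫⁻ p, F p.1 p.2 ∂ρ - ε < ⨆ N, ∫⁻ p, infF P 𝒬 B N p.1 p.2 ∂ρ := by
    rw [← h1]
    exact ENNReal.sub_lt_self hρ.ne h0 hε.ne'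
  obtain ⟨N, hN⟩ := lt_iSup_iff.1 h2
  refine ⟨N, fun k n hk hn => ?_⟩
  rw [← tsub_le_iff_right]
  exact hN.le.trans (lintegral_mono fun p => infF_le hk hn p.1 p.2)

end Kernels

/-! ### Convergence in `L²` -/

section SquareIntegrable

variable {Ω : Type*} [MeasurableSpace Ω] {P : Measure Ω}

theorem eLpNorm_two_sq (f : Ω → ℝ) : eLpNorm f 2 P ^ 2 = ∫⁻ ω, ‖f ω‖ₑ ^ 2 ∂P := by
  have h := eLpNorm_nnreal_pow_eq_lintegral (μ := P) (f := f) (p := 2) two_ne_zero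
  simpa using h

theorem ennDist_sq_add {a b : ℝ≥0∞} (ha : a ≠ ∞) (hb : b ≠ ∞) :
    ennDist a b ^ 2 + 2 * (a * b) = a * a + b * b := by
  have key : ∀ {a b : ℝ≥0∞}, b ≠ ∞ → a ≤ b →
      ennDist a b ^ 2 + 2 * (a * b) = a * a + b * b := by
    intro a b hb h
    obtain ⟨c, rfl⟩ := exists_add_of_le h
    have ha : a ≠ ∞ := ne_top_of_le_ne_top hb h
    rw [ennDist, tsub_eq_zero_of_le h, zero_add, ENNReal.add_sub_cancel_left ha]
    ring
  rcases le_total a b with h | h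
  · exact key hb h
  · rw [ennDist_comm, mul_comm a b, add_comm (a * a)]
    exact key ha h

/-- A sequence of nonnegative random variables whose mixed second moments converge has a limit in
`L²`. -/
theorem exists_memLp_two_limit {m : ℕ → Ω → ℝ≥0∞} (hm : ∀ k, Measurable (m k))
    (hfin : ∀ k, ∀ᵐ ω ∂P, m k ω ≠ ∞) {I : ℝ≥0∞} (hI : I ≠ ∞)
    (hdiag : Tendsto (fun k => ∫⁻ ω, m k ω * m k ω ∂P) atTop (𝓝 I))
    (hoff : ∀ ε > 0, ∃ N, ∀ k n, N ≤ k → N ≤ n → I ≤ ∫⁻ ω, m k ω * m n ω ∂P + ε) :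
    ∃ Z : Ω → ℝ, MemLp Z 2 P ∧ (∀ᶠ k in atTop, MemLp (fun ω => (m k ω).toReal) 2 P) ∧
      Tendsto (fun k => eLpNorm ((fun ω => (m k ω).toReal) - Z) 2 P) atTop (𝓝 0) := by
  have hsq : ∀ k, eLpNorm (fun ω => (m k ω).toReal) 2 P ^ 2 = ∫⁻ ω, m k ω * m k ω ∂P := by
    intro k
    rw [eLpNorm_two_sq]
    refine lintegral_congr_ae ?_
    filter_upwards [hfin k] with ω hω
    rw [Real.enorm_of_nonneg ENNReal.toReal_nonneg, ENNReal.ofReal_toReal hω, sq]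
  have hmem : ∀ᶠ k in atTop, MemLp (fun ω => (m k ω).toReal) 2 P := by
    filter_upwards [(tendsto_order.1 hdiag).2 _ hI.lt_top] with k hk
    refine ⟨(hm k).ennreal_toReal.aestronglyMeasurable, ?_⟩
    rw [← hsq] at hk
    exact (ENNReal.pow_lt_top_iff.1 hk).resolve_right two_ne_zero
  -- `E (mₖ - mₙ)² = E mₖ² + E mₙ² - 2 E mₖ mₙ ≤ 2(I + ε) - 2(I - ε) = 4ε`. The computation adds
  -- `2I` to both sides, because subtraction in `[0, ∞]` is truncated.
  have hcau : ∀ ε > 0, ∃ N, ∀ k n, N ≤ k → N ≤ n →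
      eLpNorm ((fun ω => (m k ω).toReal) - fun ω => (m n ω).toReal) 2 P ^ 2 ≤ 4 * ε := by
    intro ε hε
    obtain ⟨N₁, hN₁⟩ := hoff ε hε
    obtain ⟨N₂, hN₂⟩ := eventually_atTop.1 ((ENNReal.tendsto_nhds hI).1 hdiag ε hε)
    refine ⟨max N₁ N₂, fun k n hk hn => ?_⟩
    have h1 := hN₁ k n ((le_max_left _ _).trans hk) ((le_max_left _ _).trans hn)
    have h2 := (hN₂ k ((le_max_right _ _).trans hk)).2
    have h3 := (hN₂ n ((le_max_right _ _).trans hn)).2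
    have hd : eLpNorm ((fun ω => (m k ω).toReal) - fun ω => (m n ω).toReal) 2 P ^ 2 =
        ∫⁻ ω, ennDist (m k ω) (m n ω) ^ 2 ∂P := by
      rw [eLpNorm_two_sq]
      refine lintegral_congr_ae ?_
      filter_upwards [hfin k, hfin n] with ω hω hω'
      rw [Pi.sub_apply, enorm_toReal_sub hω hω']
    have hsum : ∫⁻ ω, ennDist (m k ω) (m n ω) ^ 2 ∂P + 2 * ∫⁻ ω, m k ω * m n ω ∂P =
        ∫⁻ ω, m k ω * m k ω ∂P + ∫⁻ ω, m n ω * m n ω ∂P := by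
      have hkn : Measurable fun ω => m k ω * m n ω := (hm k).mul (hm n)
      have hnn : Measurable fun ω => m n ω * m n ω := (hm n).mul (hm n)
      rw [← lintegral_const_mul _ hkn, ← lintegral_add_right _ (hkn.const_mul _),
        ← lintegral_add_right _ hnn]
      refine lintegral_congr_ae ?_
      filter_upwards [hfin k, hfin n] with ω hω hω'
      exact ennDist_sq_add hω hω'
    rw [hd]
    have h2I : 2 * I ≠ ∞ := ENNReal.mul_ne_top (by simp) hI
    refine (ENNReal.add_le_add_iff_right h2I).1 ?_
    calc ∫⁻ ω, ennDist (m k ω) (m n ω) ^ 2 ∂P + 2 * I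
        ≤ ∫⁻ ω, ennDist (m k ω) (m n ω) ^ 2 ∂P + 2 * (∫⁻ ω, m k ω * m n ω ∂P + ε) := by gcongr
      _ = ∫⁻ ω, m k ω * m k ω ∂P + ∫⁻ ω, m n ω * m n ω ∂P + 2 * ε := by rw [← hsum]; ring
      _ ≤ (I + ε) + (I + ε) + 2 * ε := by gcongr
      _ = 4 * ε + 2 * I := by ring
  -- Square integrability is known only from some index on, so a shifted sequence is taken in `Lp`.
  obtain ⟨N₀, hN₀⟩ := eventually_atTop.1 hmem
  let u : ℕ → Lp ℝ 2 P := fun k => (hN₀ (k + N₀) (Nat.le_add_left _ _)).toLp _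
  have hu : CauchySeq u := by
    refine EMetric.cauchySeq_iff.2 fun ε hε => ?_
    have h4 : 0 < ε ^ 2 / 4 := ENNReal.div_pos (pow_ne_zero 2 hε.ne') (by simp)
    obtain ⟨ε', hε', hlt⟩ := exists_between h4
    obtain ⟨N, hN⟩ := hcau ε' hε'
    refine ⟨N, fun k hk n hn => ?_⟩
    rw [Lp.edist_toLp_toLp]
    by_contra hcon
    have h5 := hN (k + N₀) (n + N₀) (by omega) (by omega)
    have h6 : ε ^ 2 ≤ 4 * ε' := le_trans (by gcongr; exact not_lt.1 hcon) h5
    have h7 : 4 * ε' < ε ^ 2 := by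
      rw [mul_comm]
      exact ENNReal.mul_lt_of_lt_div hlt
    exact absurd h7 (not_lt.2 h6)
  obtain ⟨g, hg⟩ := cauchySeq_tendsto_of_complete hu
  refine ⟨g, Lp.memLp g, hmem, ?_⟩
  rw [← tendsto_add_atTop_iff_nat N₀]
  rw [Lp.tendsto_Lp_iff_tendsto_eLpNorm'] at hg
  refine hg.congr fun k => eLpNorm_congr_ae ?_
  exact (MemLp.coeFn_toLp _).sub EventuallyEq.rfl

/-- This is the continuity of the inner product of `L²`. -/
theorem tendsto_integral_mul {U V : ℕ → Ω → ℝ} {Z W : Ω → ℝ} (hZ : MemLp Z 2 P) (hW : MemLp W 2 P)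
    (hU : ∀ᶠ k in atTop, MemLp (U k) 2 P) (hV : ∀ᶠ k in atTop, MemLp (V k) 2 P)
    (hUZ : Tendsto (fun k => eLpNorm (U k - Z) 2 P) atTop (𝓝 0))
    (hVW : Tendsto (fun k => eLpNorm (V k - W) 2 P) atTop (𝓝 0)) :
    Tendsto (fun k => ∫ ω, U k ω * V k ω ∂P) atTop (𝓝 (∫ ω, Z ω * W ω ∂P)) := by
  obtain ⟨N₀, hN₀⟩ := eventually_atTop.1 (hU.and hV)
  rw [← tendsto_add_atTop_iff_nat N₀] at hUZ hVW ⊢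
  have hU' := fun k => (hN₀ (k + N₀) (Nat.le_add_left _ _)).1
  have hV' := fun k => (hN₀ (k + N₀) (Nat.le_add_left _ _)).2
  have h1 := (Lp.tendsto_Lp_iff_tendsto_eLpNorm'' (fun k => U (k + N₀)) hU' Z hZ).2 hUZ
  have h2 := (Lp.tendsto_Lp_iff_tendsto_eLpNorm'' (fun k => V (k + N₀)) hV' W hW).2 hVW
  have h3 := Filter.Tendsto.inner (𝕜 := ℝ) h1 h2
  have key : ∀ {f g : Ω → ℝ} (hf : MemLp f 2 P) (hg : MemLp g 2 P),
      inner ℝ (hf.toLp f) (hg.toLp g) = ∫ ω, f ω * g ω ∂P := by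
    intro f g hf hg
    rw [L2.inner_def]
    refine integral_congr_ae ?_
    filter_upwards [hf.coeFn_toLp, hg.coeFn_toLp] with ω h1 h2
    rw [h1, h2]
    simp [mul_comm]
  simpa only [key] using h3

end SquareIntegrable

/-! ### Masses of the approximations for measures of finite energy -/

section EnergyLimit

variable {X : Type*} [MetricSpace X] [MeasurableSpace X] [SecondCountableTopology X] [BorelSpace X]
  {Ω : Type*} [MeasurableSpace Ω] {P : Measure Ω} {φ : ℝ≥0 → ℝ≥0∞} {𝒬 : ℕ → Set (Set X)}
  {B : Ω → Set X} {δ : ℝ≥0} {F : X → X → ℝ≥0∞}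

/-- Convergence of the values on `A` thereby becomes convergence of total masses for `ν.restrict A`,
whose energy is no larger than that of `ν`. -/
theorem approxCond_apply_univ (h𝒬 : IsPartitionSequence 𝒬) (k : ℕ) (ν : Measure X) {A : Set X}
    (hA : MeasurableSet A) (ω : Ω) :
    approxCond P 𝒬 B k (ν.restrict A) ω univ = approxCond P 𝒬 B k ν ω A := by
  rw [approxCond_eq_withDensity h𝒬, approxCond_eq_withDensity h𝒬, withDensity_apply _ hA,
    withDensity_apply _ MeasurableSet.univ, Measure.restrict_univ]

theorem lintegral_approxCond_apply [IsProbabilityMeasure P] (h𝒬 : IsPartitionSequence 𝒬)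
    (hB : IsRandomClosedSet P 𝒬 B) (k : ℕ) {ν : Measure X} [SFinite ν]
    (hν : ν (coreSet 𝒬)ᶜ = 0) {A : Set X} (hA : MeasurableSet A) :
    ∫⁻ ω, approxCond P 𝒬 B k ν ω A ∂P = ν A := by
  simpa [lintegral_indicator_one hA] using
    lintegral_lintegral_approxCond h𝒬 hB k hν (measurable_one.indicator hA)

theorem ae_approxCond_lt_top [IsProbabilityMeasure P] (h𝒬 : IsPartitionSequence 𝒬)
    (hB : IsRandomClosedSet P 𝒬 B) {ν : Measure X} [SFinite ν]
    (hν : ν (coreSet 𝒬)ᶜ = 0) {A : Set X} (hA : MeasurableSet A) (hfin : ν A ≠ ∞) :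
    ∀ᵐ ω ∂P, ∀ k, approxCond P 𝒬 B k ν ω A < ∞ := by
  refine ae_all_iff.2 fun k => ae_lt_top (measurable_approxCond_apply h𝒬 hB k ν hA) ?_
  rwa [lintegral_approxCond_apply h𝒬 hB k hν hA]

/-- The total masses of `𝒞ₖ(ν)` converge in `L²` if `ν` has finite energy. -/
theorem Admissible.exists_limit_mass [IsProbabilityMeasure P]
    (h : Admissible P φ 𝒬 B δ F) {ν : Measure X} [IsFiniteMeasure ν]
    (hν : energy φ ν < ∞) (hν0 : ν (coreSet 𝒬)ᶜ = 0) :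
    ∃ Z : Ω → ℝ, MemLp Z 2 P ∧
      (∀ᶠ k in atTop, MemLp (fun ω => (approxCond P 𝒬 B k ν ω univ).toReal) 2 P) ∧
      Tendsto (fun k => eLpNorm ((fun ω => (approxCond P 𝒬 B k ν ω univ).toReal) - Z) 2 P)
        atTop (𝓝 0) := by
  have h𝒬 := h.partition
  have hB := h.randomSet
  have hν' := hν
  rw [energy_eq_lintegral_prod h.kernel] at hν'
  have hF := h.lintegral_lt_top hν'
  have hfin := ae_approxCond_lt_top h𝒬 hB hν0 MeasurableSet.univ (measure_ne_top ν univ)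
  refine exists_memLp_two_limit (fun k => measurable_approxCond_apply h𝒬 hB k ν MeasurableSet.univ)
    (fun k => hfin.mono fun ω hω => (hω k).ne) hF.ne ?_ ?_
  · simp_rw [lintegral_mul_approxCond h𝒬 hB]
    exact h.tendsto_lintegral_kernelF hν hν hν' hν0 hν0
  · intro ε hε
    simp_rw [lintegral_mul_approxCond h𝒬 hB]
    exact h.exists_lintegral_le hF hε

/-- `E (𝒞(ν)(X) 𝒞(τ)(X)) = ∫∫ F dν dτ` for measures of finite energy and finite mutual energy. -/
theorem Admissible.integral_mul_limit [IsProbabilityMeasure P]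
    (h : Admissible P φ 𝒬 B δ F) {ν τ : Measure X} [IsFiniteMeasure ν] [IsFiniteMeasure τ]
    (hν : energy φ ν < ∞) (hτ : energy φ τ < ∞)
    (hντ : ∫⁻ p, φ (nndist p.1 p.2) ∂(ν.prod τ) < ∞)
    (hν0 : ν (coreSet 𝒬)ᶜ = 0) (hτ0 : τ (coreSet 𝒬)ᶜ = 0) {Z W : Ω → ℝ}
    (hZ : MemLp Z 2 P) (hW : MemLp W 2 P)
    (hUm : ∀ᶠ k in atTop, MemLp (fun ω => (approxCond P 𝒬 B k ν ω univ).toReal) 2 P)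
    (hVm : ∀ᶠ k in atTop, MemLp (fun ω => (approxCond P 𝒬 B k τ ω univ).toReal) 2 P)
    (hUZ : Tendsto (fun k => eLpNorm ((fun ω => (approxCond P 𝒬 B k ν ω univ).toReal) - Z) 2 P)
      atTop (𝓝 0))
    (hVW : Tendsto (fun k => eLpNorm ((fun ω => (approxCond P 𝒬 B k τ ω univ).toReal) - W) 2 P)
      atTop (𝓝 0)) :
    ∫ ω, Z ω * W ω ∂P = (∫⁻ p, F p.1 p.2 ∂(ν.prod τ)).toReal := by
  have h𝒬 := h.partition
  have hB := h.randomSet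
  have h1 := tendsto_integral_mul hZ hW hUm hVm hUZ hVW
  have h2 := (ENNReal.tendsto_toReal (h.lintegral_lt_top hντ).ne).comp
    (h.tendsto_lintegral_kernelF hν hτ hντ hν0 hτ0)
  refine tendsto_nhds_unique h1 (h2.congr fun k => ?_)
  have hfin := ae_approxCond_lt_top h𝒬 hB hν0 MeasurableSet.univ (measure_ne_top ν univ)
  have hfin' := ae_approxCond_lt_top h𝒬 hB hτ0 MeasurableSet.univ (measure_ne_top τ univ)
  rw [Function.comp_apply, ← lintegral_mul_approxCond h𝒬 hB, ← integral_toReal]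
  · simp_rw [ENNReal.toReal_mul]
  · exact ((measurable_approxCond_apply h𝒬 hB k ν MeasurableSet.univ).mul
      (measurable_approxCond_apply h𝒬 hB k τ MeasurableSet.univ)).aemeasurable
  · filter_upwards [hfin, hfin'] with ω hω hω'
    exact ENNReal.mul_lt_top (hω k) (hω' k)

end EnergyLimit

/-! ### Random measures as limits -/

section Limits

variable {Ω : Type*} [MeasurableSpace Ω] {P : Measure Ω}

theorem ennDist_lintegral_le {f g : Ω → ℝ≥0∞} (hf : Measurable f) (hg : Measurable g) :
    ennDist (∫⁻ ω, f ω ∂P) (∫⁻ ω, g ω ∂P) ≤ ∫⁻ ω, ennDist (f ω) (g ω) ∂P := by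
  have h : ∀ {f g : Ω → ℝ≥0∞}, Measurable f → Measurable g →
      ∫⁻ ω, f ω ∂P - ∫⁻ ω, g ω ∂P ≤ ∫⁻ ω, (f ω - g ω) ∂P := fun hf hg =>
    lintegral_sub_le _ _ hg
  have hfg : Measurable fun ω => f ω - g ω := hf.sub hg
  simp only [ennDist]
  rw [lintegral_add_left hfg]
  exact add_le_add (h hf hg) (h hg hf)

theorem lintegral_eq_of_tendsto {m : ℕ → Ω → ℝ≥0∞} {Z : Ω → ℝ≥0∞} {c : ℝ≥0∞}
    (hm : ∀ k, Measurable (m k)) (hZ : Measurable Z) (hc : ∀ k, ∫⁻ ω, m k ω ∂P = c)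
    (h : Tendsto (fun k => ∫⁻ ω, ennDist (m k ω) (Z ω) ∂P) atTop (𝓝 0)) :
    ∫⁻ ω, Z ω ∂P = c := by
  have h1 : ∀ k, ennDist c (∫⁻ ω, Z ω ∂P) ≤ ∫⁻ ω, ennDist (m k ω) (Z ω) ∂P := fun k => by
    rw [← hc k]; exact ennDist_lintegral_le (hm k) hZ
  have h2 : ennDist c (∫⁻ ω, Z ω ∂P) ≤ 0 := ge_of_tendsto' h h1
  exact (eq_of_ennDist_eq_zero (nonpos_iff_eq_zero.1 h2)).symm

/-- Pointwise `Z - Z' ≤ |m - Z| + |m' - Z'|`, so the truncated difference `Z - Z'` has mean 0. -/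
theorem ae_le_of_tendsto {m m' : ℕ → Ω → ℝ≥0∞} {Z Z' : Ω → ℝ≥0∞}
    (hm : ∀ k, Measurable (m k)) (hZ : Measurable Z)
    (hZ' : Measurable Z') (hle : ∀ k ω, m k ω ≤ m' k ω)
    (h : Tendsto (fun k => ∫⁻ ω, ennDist (m k ω) (Z ω) ∂P) atTop (𝓝 0))
    (h' : Tendsto (fun k => ∫⁻ ω, ennDist (m' k ω) (Z' ω) ∂P) atTop (𝓝 0)) :
    ∀ᵐ ω ∂P, Z ω ≤ Z' ω := by
  have h1 : ∀ k, ∫⁻ ω, (Z ω - Z' ω) ∂P ≤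
      ∫⁻ ω, ennDist (m k ω) (Z ω) ∂P + ∫⁻ ω, ennDist (m' k ω) (Z' ω) ∂P := by
    intro k
    rw [← lintegral_add_left (measurable_ennDist (hm k) hZ)]
    refine lintegral_mono fun ω => ?_
    rw [tsub_le_iff_left]
    calc Z ω ≤ m k ω + ennDist (m k ω) (Z ω) := by rw [ennDist_comm]; exact le_add_ennDist _ _
      _ ≤ (Z' ω + ennDist (m' k ω) (Z' ω)) + ennDist (m k ω) (Z ω) := by
        gcongr; exact (hle k ω).trans (le_add_ennDist _ _)
      _ = _ := by ring
  have h2 : ∫⁻ ω, (Z ω - Z' ω) ∂P ≤ 0 :=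
    ge_of_tendsto' (by simpa using h.add h') h1
  have h3 := (lintegral_eq_zero_iff (hZ.sub hZ')).1 (nonpos_iff_eq_zero.1 h2)
  filter_upwards [h3] with ω hω
  exact tsub_eq_zero_iff_le.1 hω

theorem ae_eq_of_tendsto {m : ℕ → Ω → ℝ≥0∞} {Z Z' : Ω → ℝ≥0∞}
    (hm : ∀ k, Measurable (m k)) (hZ : Measurable Z) (hZ' : Measurable Z')
    (h : Tendsto (fun k => ∫⁻ ω, ennDist (m k ω) (Z ω) ∂P) atTop (𝓝 0))
    (h' : Tendsto (fun k => ∫⁻ ω, ennDist (m k ω) (Z' ω) ∂P) atTop (𝓝 0)) :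
    ∀ᵐ ω ∂P, Z ω = Z' ω := by
  filter_upwards [ae_le_of_tendsto hm hZ hZ' (fun _ _ => le_rfl) h h',
    ae_le_of_tendsto hm hZ' hZ (fun _ _ => le_rfl) h' h] with ω h1 h2 using le_antisymm h1 h2

/-- Countable sums of sequences that converge in `L¹`. -/
theorem tendsto_lintegral_ennDist_tsum {m : ℕ → ℕ → Ω → ℝ≥0∞} {Z : ℕ → Ω → ℝ≥0∞} {c : ℕ → ℝ≥0∞}
    (hm : ∀ k i, Measurable (m k i)) (hZ : ∀ i, Measurable (Z i))
    (hc : ∀ k i, ∫⁻ ω, m k i ω ∂P ≤ c i) (hZc : ∀ i, ∫⁻ ω, Z i ω ∂P ≤ c i)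
    (hsum : ∑' i, c i ≠ ∞)
    (h : ∀ i, Tendsto (fun k => ∫⁻ ω, ennDist (m k i ω) (Z i ω) ∂P) atTop (𝓝 0)) :
    Tendsto (fun k => ∫⁻ ω, ennDist (∑' i, m k i ω) (∑' i, Z i ω) ∂P) atTop (𝓝 0) := by
  have h1 : Tendsto (fun k => ∑' i, ∫⁻ ω, ennDist (m k i ω) (Z i ω) ∂P) atTop (𝓝 0) := by
    refine tendsto_tsum_zero_of_dominated (b := fun i => 2 * c i) ?_ ?_ h
    · rw [ENNReal.tsum_mul_left]
      exact ENNReal.mul_ne_top (by simp) hsum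
    · intro k i
      calc ∫⁻ ω, ennDist (m k i ω) (Z i ω) ∂P ≤ ∫⁻ ω, (m k i ω + Z i ω) ∂P :=
            lintegral_mono fun ω => ennDist_le_add _ _
        _ = ∫⁻ ω, m k i ω ∂P + ∫⁻ ω, Z i ω ∂P := lintegral_add_left (hm k i) _
        _ ≤ c i + c i := add_le_add (hc k i) (hZc i)
        _ = 2 * c i := (two_mul _).symm
  refine tendsto_of_tendsto_of_tendsto_of_le_of_le tendsto_const_nhds h1 (fun _ => bot_le)
    fun k => ?_
  rw [← lintegral_tsum fun i => (measurable_ennDist (hm k i) (hZ i)).aemeasurable]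
  exact lintegral_mono fun ω => ennDist_tsum_le _ _

/-- The complement step of the Dynkin argument: `u`, `v` are total masses, and `a`, `b` the values
on a set. Each of the two truncated differences obeys the bound, whence the factor 2. -/
theorem ennDist_le_of_add_eq {a a' b b' u v : ℝ≥0∞} (h1 : a + a' = u) (h2 : b + b' = v)
    (ha : a ≠ ∞) (hb : b ≠ ∞) : ennDist a' b' ≤ 2 * (ennDist u v + ennDist a b) := by
  have key : ∀ {a a' b b' u v : ℝ≥0∞}, a + a' = u → b + b' = v → a ≠ ∞ →
      a' - b' ≤ ennDist u v + ennDist a b := by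
    intro a a' b b' u v h1 h2 ha
    rw [tsub_le_iff_left]
    refine (ENNReal.add_le_add_iff_left ha).1 ?_
    calc a + a' = u := h1
      _ ≤ v + ennDist u v := le_add_ennDist _ _
      _ ≤ (a + ennDist a b + b') + ennDist u v := by
        rw [← h2]
        gcongr
        rw [ennDist_comm]; exact le_add_ennDist _ _
      _ = _ := by ring
  rw [ennDist, two_mul]
  refine add_le_add (key h1 h2 ha) ((key h2 h1 hb).trans ?_)
  rw [ennDist_comm v, ennDist_comm b]

end Limits

/-! ### Assembling limits of values into a random measure -/

section RandomMeasures

variable {Ω : Type*} [MeasurableSpace Ω] {P : Measure Ω}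

/-- A random distribution function on `ℚ` is the distribution function of a random measure. -/
theorem exists_randomMeasure_of_cdf {z : ℚ → Ω → ℝ≥0∞} {t : Ω → ℝ≥0∞}
    (hz : ∀ q, Measurable (z q)) (ht : Measurable t) (hfin : ∀ᵐ ω ∂P, t ω < ∞)
    (hmono : ∀ᵐ ω ∂P, ∀ q r, q ≤ r → z q ω ≤ z r ω) (hle : ∀ᵐ ω ∂P, ∀ q, z q ω ≤ t ω)
    (htop : ∀ᵐ ω ∂P, ⨆ n : ℕ, z n ω = t ω) (hbot : ∀ᵐ ω ∂P, ⨅ n : ℕ, z (-n) ω = 0)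
    (hright : ∀ᵐ ω ∂P, ∀ q : ℚ, ⨅ n : ℕ, z (q + 1 / (n + 1)) ω = z q ω) :
    ∃ N : Ω → Measure ℝ, Measurable N ∧ (∀ ω, IsFiniteMeasure (N ω)) ∧
      ∀ᵐ ω ∂P, (∀ q : ℚ, N ω (Iic (q : ℝ)) = z q ω) ∧ N ω univ = t ω := by
  -- Division by the total mass gives distribution functions of probability measures, for which a
  -- measurable Stieltjes construction is available. Multiplying back by `(t ω).toNNReal` keeps the
  -- measure finite for every `ω`, even where the hypotheses fail.
  let f : Ω → ℚ → ℝ := fun ω q => (z q ω / t ω).toReal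
  have hf : Measurable f := measurable_pi_lambda _ fun q => ((hz q).div ht).ennreal_toReal
  let μ : Ω → Measure ℝ := fun ω => (ProbabilityTheory.stieltjesOfMeasurableRat f hf ω).measure
  have hμ : Measurable μ := ProbabilityTheory.measurable_measure_stieltjesOfMeasurableRat hf
  let N : Ω → Measure ℝ := fun ω => ((t ω).toNNReal : ℝ≥0∞) • μ ω
  have hNm : Measurable N := by
    refine Measure.measurable_of_measurable_coe _ fun s hs => ?_
    simp only [N, Measure.smul_apply, smul_eq_mul]
    exact (measurable_coe_nnreal_ennreal.comp ht.ennreal_toNNReal).mul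
      ((Measure.measurable_coe hs).comp hμ)
  refine ⟨N, hNm, fun ω => ⟨?_⟩, ?_⟩
  · simp only [N, Measure.smul_apply, smul_eq_mul]
    exact ENNReal.mul_lt_top ENNReal.coe_lt_top (measure_lt_top _ _)
  filter_upwards [hfin, hmono, hle, htop, hbot, hright] with ω h1 h2 h3 h4 h5 h6
  have huniv : N ω univ = t ω := by
    simp only [N, μ, Measure.smul_apply, smul_eq_mul,
      ProbabilityTheory.measure_stieltjesOfMeasurableRat_univ, mul_one]
    exact ENNReal.coe_toNNReal h1.ne
  refine ⟨fun q => ?_, huniv⟩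
  -- If the total mass is 0, the quotients `0 / 0 = 0` form no distribution function, but then all
  -- values are 0 anyway.
  rcases eq_or_ne (t ω) 0 with h0 | h0
  · have hq : z q ω = 0 := nonpos_iff_eq_zero.1 (h0 ▸ h3 q)
    rw [hq]
    exact measure_mono_null (subset_univ _) (huniv.trans h0)
  have hdiv : ∀ q, z q ω / t ω ≠ ∞ := fun q =>
    (ENNReal.div_lt_top (ne_top_of_le_ne_top h1.ne (h3 q)) h0).ne
  have hmonof : Monotone (f ω) := fun q r hqr =>
    ENNReal.toReal_mono (hdiv r) (ENNReal.div_le_div_right (h2 q r hqr) _)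
  have hmonoz : Monotone fun q => z q ω := fun q r hqr => h2 q r hqr
  have lim : ∀ {l : Filter ℚ} {c : ℝ≥0∞}, Tendsto (fun q => z q ω) l (𝓝 c) → c ≤ t ω →
      Tendsto (f ω) l (𝓝 (c / t ω).toReal) := by
    intro l c h hc
    refine (ENNReal.tendsto_toReal
      (ENNReal.div_lt_top (ne_top_of_le_ne_top h1.ne hc) h0).ne).comp ?_
    exact ENNReal.Tendsto.div_const h (Or.inr h0)
  have hpt : ProbabilityTheory.IsRatStieltjesPoint f ω := by
    refine ⟨hmonof, ?_, ?_, fun q => ?_⟩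
    · have h7 : ⨆ q, z q ω = t ω :=
        le_antisymm (iSup_le h3) (h4 ▸ iSup_le fun n => le_iSup (fun q => z q ω) (n : ℚ))
      have h8 := lim (tendsto_atTop_iSup hmonoz) h7.le
      rwa [h7, ENNReal.div_self h0 h1.ne, ENNReal.toReal_one] at h8
    · have h7 : ⨅ q, z q ω = 0 :=
        nonpos_iff_eq_zero.1 (h5 ▸ le_iInf fun n => iInf_le (fun q => z q ω) (-(n : ℚ)))
      have h8 := lim (tendsto_atBot_iInf hmonoz) (h7.le.trans bot_le)
      rwa [h7, ENNReal.zero_div, ENNReal.toReal_zero] at h8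
    · have hlim : Tendsto (fun n : ℕ => f ω (q + 1 / (n + 1))) atTop (𝓝 (f ω q)) := by
        have hanti : Antitone fun n : ℕ => z (q + 1 / (n + 1)) ω := by
          intro n n' hn
          refine h2 _ _ ?_
          gcongr
        have h7 := tendsto_atTop_iInf hanti
        rw [h6 q] at h7
        refine (ENNReal.tendsto_toReal (hdiv q)).comp ?_
        exact ENNReal.Tendsto.div_const h7 (Or.inr h0)
      have hbdd : BddBelow (range fun r : Ioi q => f ω r) :=
        ⟨0, by rintro _ ⟨r, rfl⟩; exact ENNReal.toReal_nonneg⟩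
      refine le_antisymm (ge_of_tendsto' hlim fun n => ?_) ?_
      · have hpos : q < q + 1 / ((n : ℚ) + 1) := lt_add_of_pos_right _ (by positivity)
        exact ciInf_le hbdd (⟨_, hpos⟩ : Ioi q)
      · have : Nonempty (Ioi q) := ⟨⟨q + 1, lt_add_one q⟩⟩
        exact le_ciInf fun r => hmonof r.2.le
  simp only [N, μ, Measure.smul_apply, smul_eq_mul,
    ProbabilityTheory.measure_stieltjesOfMeasurableRat_Iic]
  rw [ProbabilityTheory.stieltjesOfMeasurableRat_eq,
    ProbabilityTheory.toRatCDF_of_isRatStieltjesPoint hpt, ENNReal.ofReal_toReal (hdiv q),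
    ENNReal.coe_toNNReal h1.ne, ENNReal.mul_div_cancel h0 h1.ne]

/-- An inequality between functions with the same finite integral is an equality almost everywhere.
The infimum lies above `t`, and its integral is at most the limit of the integrals of `z n`;
monotonicity in `n` plays no role. -/
theorem ae_iInf_eq {z : ℕ → Ω → ℝ≥0∞} {t : Ω → ℝ≥0∞} (hz : ∀ n, Measurable (z n))
    (hle : ∀ n, ∀ᵐ ω ∂P, t ω ≤ z n ω) (hfin : ∫⁻ ω, t ω ∂P ≠ ∞)
    (hlim : Tendsto (fun n => ∫⁻ ω, z n ω ∂P) atTop (𝓝 (∫⁻ ω, t ω ∂P))) :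
    ∀ᵐ ω ∂P, ⨅ n, z n ω = t ω := by
  have h1 : ∀ᵐ ω ∂P, t ω ≤ ⨅ n, z n ω := by
    filter_upwards [ae_all_iff.2 hle] with ω hω using le_iInf hω
  have h2 : ∫⁻ ω, ⨅ n, z n ω ∂P ≤ ∫⁻ ω, t ω ∂P :=
    ge_of_tendsto' hlim fun n => lintegral_mono fun ω => iInf_le _ n
  exact (ae_eq_of_ae_le_of_lintegral_le h1 hfin (Measurable.iInf hz).aemeasurable h2).symm

theorem ae_iSup_eq {z : ℕ → Ω → ℝ≥0∞} {t : Ω → ℝ≥0∞}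
    (ht : Measurable t) (hle : ∀ n, ∀ᵐ ω ∂P, z n ω ≤ t ω) (hfin : ∫⁻ ω, t ω ∂P ≠ ∞)
    (hlim : Tendsto (fun n => ∫⁻ ω, z n ω ∂P) atTop (𝓝 (∫⁻ ω, t ω ∂P))) :
    ∀ᵐ ω ∂P, ⨆ n, z n ω = t ω := by
  have h1 : ∀ᵐ ω ∂P, ⨆ n, z n ω ≤ t ω := by
    filter_upwards [ae_all_iff.2 hle] with ω hω using iSup_le hω
  have h2 : ∫⁻ ω, t ω ∂P ≤ ∫⁻ ω, ⨆ n, z n ω ∂P :=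
    le_of_tendsto' hlim fun n => lintegral_mono fun ω => le_iSup (fun n => z n ω) n
  exact ae_eq_of_ae_le_of_lintegral_le h1
    (ne_top_of_le_ne_top hfin (lintegral_mono_ae h1)) ht.aemeasurable h2

/-- If the values of the random measures `m k` on all Borel sets converge in `L¹`, then the limits
are the values of a random measure. -/
theorem exists_randomMeasure {X : Type*} [MeasurableSpace X] [StandardBorelSpace X]
    {m : ℕ → Ω → Measure X} (hm : ∀ k A, MeasurableSet A → Measurable fun ω => m k ω A)
    {ν : Measure X} [IsFiniteMeasure ν]
    (hE : ∀ k A, MeasurableSet A → ∫⁻ ω, m k ω A ∂P = ν A)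
    (hlim : ∀ A, MeasurableSet A → ∃ Z : Ω → ℝ≥0∞, Measurable Z ∧
      Tendsto (fun k => ∫⁻ ω, ennDist (m k ω A) (Z ω) ∂P) atTop (𝓝 0)) :
    ∃ N : Ω → Measure X, Measurable N ∧ (∀ ω, IsFiniteMeasure (N ω)) ∧
      ∀ A, MeasurableSet A →
        Tendsto (fun k => ∫⁻ ω, ennDist (m k ω A) (N ω A) ∂P) atTop (𝓝 0) := by
  -- A standard Borel space embeds measurably into `ℝ`, so the limits on preimages of rational
  -- half-lines serve as a random distribution function.
  let e := embeddingReal X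
  have he : MeasurableEmbedding e := measurableEmbedding_embeddingReal X
  let S : ℝ → Set X := fun q => e ⁻¹' Iic q
  have hS : ∀ q, MeasurableSet (S q) := fun q => he.measurable measurableSet_Iic
  have hSmono : Monotone S := fun q r hqr => preimage_mono (Iic_subset_Iic.2 hqr)
  choose z hzm hz using fun q : ℚ => hlim (S q) (hS q)
  obtain ⟨t, htm, ht⟩ := hlim univ MeasurableSet.univ
  have hzE : ∀ q : ℚ, ∫⁻ ω, z q ω ∂P = ν (S q) := fun q =>
    lintegral_eq_of_tendsto (fun k => hm k _ (hS q)) (hzm q) (fun k => hE k _ (hS q)) (hz q)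
  have htE : ∫⁻ ω, t ω ∂P = ν univ :=
    lintegral_eq_of_tendsto (fun k => hm k _ MeasurableSet.univ) htm
      (fun k => hE k _ MeasurableSet.univ) ht
  have hmono : ∀ q r : ℚ, q ≤ r → ∀ᵐ ω ∂P, z q ω ≤ z r ω := fun q r hqr =>
    ae_le_of_tendsto (fun k => hm k _ (hS q)) (hzm q) (hzm r)
      (fun k ω => measure_mono (hSmono (by exact_mod_cast hqr))) (hz q) (hz r)
  have hle : ∀ q : ℚ, ∀ᵐ ω ∂P, z q ω ≤ t ω := fun q =>
    ae_le_of_tendsto (fun k => hm k _ (hS q)) (hzm q) htm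
      (fun k ω => measure_mono (subset_univ _)) (hz q) ht
  -- The limits at `±∞` and right continuity hold in mean, by continuity of `ν` along monotone
  -- sequences of sets. With the almost sure order relations they hold almost surely.
  have h4 : ∀ᵐ ω ∂P, ⨆ n : ℕ, z n ω = t ω := by
    refine ae_iSup_eq htm (fun n => hle n)
      (by rw [htE]; exact measure_ne_top _ _) ?_
    simp_rw [hzE, htE]
    have hU : ⋃ n : ℕ, S ((n : ℚ) : ℝ) = univ := by
      refine eq_univ_of_forall fun x => ?_
      obtain ⟨n, hn⟩ := exists_nat_ge (e x)
      exact mem_iUnion.2 ⟨n, by simpa [S] using hn⟩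
    rw [← hU]
    refine tendsto_measure_iUnion_atTop fun n n' hn => hSmono ?_
    exact_mod_cast hn
  have h5 : ∀ᵐ ω ∂P, ⨅ n : ℕ, z (-n) ω = 0 := by
    have := ae_iInf_eq (P := P) (z := fun n : ℕ => z (-n)) (t := fun _ => 0) (fun n => hzm _)
      (fun n => Eventually.of_forall fun _ => bot_le) (by simp) ?_
    · exact this
    simp_rw [hzE, lintegral_zero]
    have hI : ⋂ n : ℕ, S ((-n : ℚ) : ℝ) = ∅ := by
      refine eq_empty_of_forall_notMem fun x hx => ?_
      obtain ⟨n, hn⟩ := exists_nat_gt (-e x)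
      have := mem_iInter.1 hx n
      simp only [S, mem_preimage, mem_Iic] at this
      push_cast at this
      linarith
    rw [← measure_empty (μ := ν), ← hI]
    refine tendsto_measure_iInter_atTop (fun n => (hS _).nullMeasurableSet)
      (fun n n' hn => hSmono ?_) ⟨0, measure_ne_top _ _⟩
    push_cast
    simpa using hn
  have h6 : ∀ᵐ ω ∂P, ∀ q : ℚ, ⨅ n : ℕ, z (q + 1 / (n + 1)) ω = z q ω := by
    refine ae_all_iff.2 fun q => ae_iInf_eq (fun n => hzm _) (fun n => hmono _ _ ?_)
      (by rw [hzE]; exact measure_ne_top _ _) ?_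
    · exact le_add_of_nonneg_right (by positivity)
    simp_rw [hzE]
    have hI : ⋂ n : ℕ, S ((q + 1 / (n + 1) : ℚ) : ℝ) = S q := by
      ext x
      simp only [S, mem_iInter, mem_preimage, mem_Iic]
      constructor
      · intro h
        refine le_of_forall_pos_lt_add fun ε hε => ?_
        obtain ⟨n, hn⟩ := exists_nat_one_div_lt hε
        have h1 := h n
        push_cast at h1
        linarith
      · intro h n
        push_cast
        have : (0 : ℝ) ≤ 1 / ((n : ℝ) + 1) := by positivity
        linarith
    rw [← hI]
    refine tendsto_measure_iInter_atTop (fun n => (hS _).nullMeasurableSet)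
      (fun n n' hn => hSmono ?_) ⟨0, measure_ne_top _ _⟩
    have : q + 1 / ((n' : ℚ) + 1) ≤ q + 1 / ((n : ℚ) + 1) := by gcongr
    exact_mod_cast this
  obtain ⟨N', hN'm, hN'fin, hN'⟩ := exists_randomMeasure_of_cdf (P := P) hzm htm
    (ae_lt_top htm (by rw [htE]; exact measure_ne_top _ _))
    (ae_all_iff.2 fun q => ae_all_iff.2 fun r => ae_all_iff.2 fun h => hmono q r h)
    (ae_all_iff.2 hle) h4 h5 h6
  have hN'coe : ∀ T, MeasurableSet T → Measurable fun ω => N' ω T := fun T hT =>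
    (Measure.measurable_coe hT).comp hN'm
  have huniv : Tendsto (fun k => ∫⁻ ω, ennDist (m k ω (e ⁻¹' univ)) (N' ω univ) ∂P) atTop
      (𝓝 0) := by
    refine ht.congr fun k => lintegral_congr_ae ?_
    filter_upwards [hN'] with ω hω
    rw [hω.2, preimage_univ]
  have hmfin : ∀ k, ∀ᵐ ω ∂P, m k ω univ < ∞ := fun k =>
    ae_lt_top (hm k _ MeasurableSet.univ) (by
      rw [hE k _ MeasurableSet.univ]; exact measure_ne_top _ _)
  -- Half-lines form a generating π-system on which the claim holds by construction. It passes to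
  -- complements through the total mass, and to disjoint unions because the means `ν (e ⁻¹' T i)`
  -- are summable.
  have key : ∀ T, MeasurableSet T →
      Tendsto (fun k => ∫⁻ ω, ennDist (m k ω (e ⁻¹' T)) (N' ω T) ∂P) atTop (𝓝 0) := by
    intro T hT
    induction T, hT using MeasurableSpace.induction_on_inter
      (BorelSpace.measurable_eq.trans Real.borel_eq_generateFrom_Iic_rat)
      Real.isPiSystem_Iic_rat with
    | empty => simp [ennDist]
    | basic T hT =>
      obtain ⟨q, rfl⟩ := mem_iUnion.1 hT
      refine (hz q).congr fun k => lintegral_congr_ae ?_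
      filter_upwards [hN'] with ω hω
      rw [hω.1 q]
    | compl T hT ih =>
      have hlim2 : Tendsto (fun k => 2 * (∫⁻ ω, ennDist (m k ω (e ⁻¹' univ)) (N' ω univ) ∂P +
          ∫⁻ ω, ennDist (m k ω (e ⁻¹' T)) (N' ω T) ∂P)) atTop (𝓝 0) := by
        have := ENNReal.Tendsto.const_mul (huniv.add ih) (Or.inr (ENNReal.ofNat_ne_top (n := 2)))
        simpa using this
      refine tendsto_of_tendsto_of_tendsto_of_le_of_le tendsto_const_nhds hlim2 (fun _ => bot_le)
        fun k => ?_
      have hm1 := measurable_ennDist (hm k _ (he.measurable MeasurableSet.univ))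
        (hN'coe _ MeasurableSet.univ)
      rw [← lintegral_add_left hm1, ← lintegral_const_mul' _ _ ENNReal.ofNat_ne_top]
      refine lintegral_mono_ae ?_
      filter_upwards [hmfin k] with ω hω
      refine ennDist_le_of_add_eq ?_ (measure_add_measure_compl hT)
        (measure_lt_top_mono (subset_univ _) hω).ne (measure_ne_top _ _)
      rw [preimage_compl, measure_add_measure_compl (he.measurable hT), preimage_univ]
    | iUnion T hd hT ih =>
      have hsum : ∑' i, ν (e ⁻¹' T i) ≠ ∞ := by
        rw [← measure_iUnion (fun i j hij => (hd hij).preimage e) fun i => he.measurable (hT i)]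
        exact measure_ne_top _ _
      refine (tendsto_lintegral_ennDist_tsum (fun k i => hm k _ (he.measurable (hT i)))
        (fun i => hN'coe _ (hT i)) (fun k i => (hE k _ (he.measurable (hT i))).le)
        (fun i => (lintegral_eq_of_tendsto (fun k => hm k _ (he.measurable (hT i)))
          (hN'coe _ (hT i)) (fun k => hE k _ (he.measurable (hT i))) (ih i)).le) hsum ih).congr
        fun k => lintegral_congr fun ω => ?_
      rw [measure_iUnion hd hT, preimage_iUnion,
        measure_iUnion (fun i j hij => (hd hij).preimage e) fun i => he.measurable (hT i)]
  have happ : ∀ ω A, ((N' ω).comap e) A = N' ω (e '' A) := fun ω A => he.comap_apply _ _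
  refine ⟨fun ω => (N' ω).comap e, Measure.measurable_of_measurable_coe _ fun A hA => ?_,
    fun ω => ⟨?_⟩, fun A hA => ?_⟩
  · simp_rw [happ]
    exact hN'coe _ (he.measurableSet_image.2 hA)
  · rw [happ]
    exact measure_lt_top _ _
  · have := key _ (he.measurableSet_image.2 hA)
    simp_rw [happ]
    rwa [preimage_image_eq _ he.injective] at this

end RandomMeasures

/-! ### The limit for the regular part and its properties -/

section General

variable {X : Type*} [MetricSpace X] [MeasurableSpace X] [SecondCountableTopology X] [BorelSpace X]
  {Ω : Type*} [MeasurableSpace Ω] {P : Measure Ω} {φ : ℝ≥0 → ℝ≥0∞} {𝒬 : ℕ → Set (Set X)}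
  {B : Ω → Set X} {δ : ℝ≥0} {F : X → X → ℝ≥0∞}

/-- `N` is the limit of `𝒞ₖ(ν_R)`: `𝒞ₖ(ν_R)(A) → N(A)` in `L¹` for all `A` of finite measure. -/
def IsLimit (P : Measure Ω) (φ : ℝ≥0 → ℝ≥0∞) (𝒬 : ℕ → Set (Set X)) (B : Ω → Set X)
    (ν : Measure X) (N : Ω → Measure X) : Prop :=
  ∀ A, MeasurableSet A → regularPart φ ν A < ∞ →
    Tendsto (fun k => ∫⁻ ω, ennDist (approxCond P 𝒬 B k (regularPart φ ν) ω A) (N ω A) ∂P)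
      atTop (𝓝 0)

/-- The exceptional null set of the hypothesis depends on `A`. A countable algebra generates the
σ-algebra, so countably many sets `A` suffice for uniqueness of measures on each `V i`. -/
theorem ae_eq_of_forall_ae_eq [CompleteSpace X] {N N' : Ω → Measure X} {V : ℕ → Set X}
    (hU : ⋃ i, V i = univ)
    (hfin : ∀ᵐ ω ∂P, ∀ i, N ω (V i) < ∞)
    (h : ∀ i A, MeasurableSet A → ∀ᵐ ω ∂P, N ω (A ∩ V i) = N' ω (A ∩ V i)) :
    ∀ᵐ ω ∂P, N ω = N' ω := by
  let 𝒢 : Set (Set X) := generateSetAlgebra (MeasurableSpace.countableGeneratingSet X)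
  have h𝒢c : 𝒢.Countable :=
    countable_generateSetAlgebra MeasurableSpace.countable_countableGeneratingSet
  have h𝒢g : ‹MeasurableSpace X› = MeasurableSpace.generateFrom 𝒢 := by
    rw [generateFrom_generateSetAlgebra_eq, MeasurableSpace.generateFrom_countableGeneratingSet]
  have h𝒢m : ∀ S ∈ 𝒢, MeasurableSet S := fun S hS => by
    rw [h𝒢g]; exact MeasurableSpace.measurableSet_generateFrom hS
  have h1 : ∀ᵐ ω ∂P, ∀ S ∈ 𝒢, ∀ i, N ω (S ∩ V i) = N' ω (S ∩ V i) :=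
    (ae_ball_iff h𝒢c).2 fun S hS => ae_all_iff.2 fun i => h i S (h𝒢m S hS)
  have h2 : ∀ᵐ ω ∂P, ∀ i, N ω (univ ∩ V i) = N' ω (univ ∩ V i) :=
    ae_all_iff.2 fun i => h i univ MeasurableSet.univ
  filter_upwards [hfin, h1, h2] with ω hω1 hω2 hω3
  refine (Measure.ext_iff_of_iUnion_eq_univ hU).2 fun i => ?_
  have : IsFiniteMeasure ((N ω).restrict (V i)) := ⟨by simpa using hω1 i⟩
  refine ext_of_generate_finite 𝒢 h𝒢g 
    (fun _ hs _ ht _ => isSetAlgebra_generateSetAlgebra.inter_mem hs ht) (fun S hS => ?_) ?_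
  · rw [Measure.restrict_apply (h𝒢m S hS), Measure.restrict_apply (h𝒢m S hS)]
    exact hω2 S hS i
  · rw [Measure.restrict_apply MeasurableSet.univ, Measure.restrict_apply MeasurableSet.univ]
    exact hω3 i

/-- Replacing `Z` by its positive part does not increase its distance to a nonnegative variable. -/
theorem tendsto_ofReal_ennDist {m : ℕ → Ω → ℝ≥0∞} (hfin : ∀ k, ∀ᵐ ω ∂P, m k ω < ∞) {Z : Ω → ℝ}
    (h : Tendsto (fun k => eLpNorm ((fun ω => (m k ω).toReal) - Z) 1 P) atTop (𝓝 0)) :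
    Tendsto (fun k => ∫⁻ ω, ennDist (m k ω) (ENNReal.ofReal (Z ω)) ∂P) atTop (𝓝 0) := by
  refine tendsto_of_tendsto_of_tendsto_of_le_of_le tendsto_const_nhds h (fun _ => bot_le)
    fun k => ?_
  rw [eLpNorm_one_eq_lintegral_enorm]
  refine lintegral_mono_ae ?_
  filter_upwards [hfin k] with ω hω
  rw [← enorm_toReal_sub hω.ne ENNReal.ofReal_ne_top, Pi.sub_apply, ENNReal.toReal_ofReal',
    Real.enorm_eq_ofReal_abs, Real.enorm_eq_ofReal_abs]
  refine ENNReal.ofReal_le_ofReal ?_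
  have h0 : (0 : ℝ) ≤ (m k ω).toReal := ENNReal.toReal_nonneg
  calc |(m k ω).toReal - max (Z ω) 0| = |max (m k ω).toReal 0 - max (Z ω) 0| := by
        rw [max_eq_left h0]
    _ ≤ |(m k ω).toReal - Z ω| := abs_max_sub_max_le_abs _ _ _

theorem energy_restrict_lt_top {ν : Measure X} (hν : energy φ ν < ∞) (A : Set X) :
    energy φ (ν.restrict A) < ∞ :=
  (energy_mono φ Measure.restrict_le_self).trans_lt hν

theorem restrict_compl_eq_zero {ν : Measure X} {S : Set X} (hν : ν S = 0) (A : Set X) :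
    ν.restrict A S = 0 :=
  Measure.restrict_le_self.absolutelyContinuous hν

/-- `N` is the conditional measure of the finite measure `ν` of finite energy. -/
structure IsEnergyLimit (P : Measure Ω) (φ : ℝ≥0 → ℝ≥0∞) (𝒬 : ℕ → Set (Set X)) (B : Ω → Set X)
    (ν : Measure X) (N : Ω → Measure X) : Prop where
  finite : IsFiniteMeasure ν
  energy_lt_top : energy φ ν < ∞
  null : ν (coreSet 𝒬)ᶜ = 0
  measurable : Measurable N
  finite_random : ∀ ω, IsFiniteMeasure (N ω)
  tendsto : ∀ A, MeasurableSet A → Tendsto (fun k =>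
    ∫⁻ ω, ennDist (approxCond P 𝒬 B k ν ω A) (N ω A) ∂P) atTop (𝓝 0)

/-- The conditional measure of a finite measure of finite energy. -/
theorem Admissible.exists_of_energy [CompleteSpace X] [IsProbabilityMeasure P]
    (h : Admissible P φ 𝒬 B δ F) {ν : Measure X} [IsFiniteMeasure ν]
    (hν : energy φ ν < ∞) (hν0 : ν (coreSet 𝒬)ᶜ = 0) :
    ∃ N : Ω → Measure X, IsEnergyLimit P φ 𝒬 B ν N := by
  have h𝒬 := h.partition
  have hB := h.randomSet
  suffices hlim : ∀ A, MeasurableSet A → ∃ Z : Ω → ℝ≥0∞, Measurable Z ∧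
      Tendsto (fun k => ∫⁻ ω, ennDist (approxCond P 𝒬 B k ν ω A) (Z ω) ∂P) atTop (𝓝 0) by
    obtain ⟨N, h1, h2, h3⟩ := exists_randomMeasure (ν := ν)
      (fun k A hA => measurable_approxCond_apply h𝒬 hB k ν hA)
      (fun k A hA => lintegral_approxCond_apply h𝒬 hB k hν0 hA) hlim
    exact ⟨N, inferInstance, hν, hν0, h1, h2, h3⟩
  intro A hA
  obtain ⟨Z, hZ, -, hlim⟩ := h.exists_limit_mass (energy_restrict_lt_top hν A)
    (restrict_compl_eq_zero hν0 A)
  simp_rw [approxCond_apply_univ h𝒬 _ ν hA] at hlim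
  have hm : ∀ k, Measurable fun ω => approxCond P 𝒬 B k ν ω A := fun k =>
    measurable_approxCond_apply h𝒬 hB k ν hA
  have hfin := ae_approxCond_lt_top h𝒬 hB hν0 hA (measure_ne_top ν A)
  have h1 : Tendsto (fun k => eLpNorm ((fun ω => (approxCond P 𝒬 B k ν ω A).toReal) - Z) 1 P)
      atTop (𝓝 0) := by
    refine tendsto_of_tendsto_of_tendsto_of_le_of_le tendsto_const_nhds hlim (fun _ => bot_le)
      fun k => ?_
    exact eLpNorm_le_eLpNorm_of_exponent_le (by norm_num)
      ((hm k).ennreal_toReal.aestronglyMeasurable.sub hZ.aestronglyMeasurable)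
  have h2 := tendsto_ofReal_ennDist (fun k => hfin.mono fun ω hω => hω k) h1
  obtain ⟨Z', hZ', hZZ'⟩ := hZ.aestronglyMeasurable.aemeasurable
  refine ⟨fun ω => ENNReal.ofReal (Z' ω), hZ'.ennreal_ofReal, h2.congr fun k => ?_⟩
  refine lintegral_congr_ae ?_
  filter_upwards [hZZ'] with ω hω
  rw [hω]

theorem approxCond_sum (h𝒬 : IsPartitionSequence 𝒬) (k : ℕ) (ν : ℕ → Measure X) (ω : Ω)
    (A : Set X) (hA : MeasurableSet A) :
    approxCond P 𝒬 B k (Measure.sum ν) ω A = ∑' i, approxCond P 𝒬 B k (ν i) ω A := by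
  simp_rw [approxCond_eq_withDensity h𝒬]
  rw [withDensity_sum, Measure.sum_apply _ hA]

theorem measurable_measure_sum {N : ℕ → Ω → Measure X} (hN : ∀ i, Measurable (N i)) :
    Measurable fun ω => Measure.sum fun i => N i ω := by
  refine Measure.measurable_of_measurable_coe _ fun A hA => ?_
  simp_rw [Measure.sum_apply _ hA]
  exact Measurable.tsum fun i => (Measure.measurable_coe hA).comp (hN i)

/-- The carriers of finite energy are cut by disjoint sets of finite `ν`-measure, so that every
piece has both finite mass and finite energy. -/
theorem exists_finite_pieces (φ : ℝ≥0 → ℝ≥0∞) (ν : Measure X) [IsLocallyFiniteMeasure ν] :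
    ∃ W : ℕ → Set X, (∀ i, ν (W i) < ∞) ∧ (∀ i, energy φ (ν.restrict (W i)) < ∞) ∧
      regularPart φ ν = Measure.sum fun i => ν.restrict (W i) := by
  obtain ⟨A, hAm, hAd, hAe, hA⟩ := exists_regularSet φ ν
  let V := disjointed (spanningSets ν)
  have hVm : ∀ i, MeasurableSet (V i) := MeasurableSet.disjointed (measurableSet_spanningSets ν)
  have hVd := disjoint_disjointed (spanningSets ν)
  have hVU : ⋃ i, V i = univ := iUnion_disjointed.trans (iUnion_spanningSets ν)
  let W : ℕ → Set X := fun i => A i.unpair.1 ∩ V i.unpair.2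
  have hWm : ∀ i, MeasurableSet (W i) := fun i => (hAm _).inter (hVm _)
  have hWd : Pairwise (Function.onFun Disjoint W) := by
    intro i j hij
    by_cases h1 : i.unpair.1 = j.unpair.1
    · have h2 : i.unpair.2 ≠ j.unpair.2 := fun h2 => hij (by
        rw [← Nat.pair_unpair i, h1, h2, Nat.pair_unpair])
      exact (hVd h2).mono inter_subset_right inter_subset_right
    · exact (hAd h1).mono inter_subset_left inter_subset_left
  have hWU : ⋃ i, W i = ⋃ n, A n := by
    ext x
    simp only [mem_iUnion]
    constructor
    · rintro ⟨i, hi⟩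
      exact ⟨_, hi.1⟩
    · rintro ⟨n, hn⟩
      obtain ⟨m, hm⟩ := mem_iUnion.1 (hVU ▸ mem_univ x)
      exact ⟨Nat.pair n m, by simpa [W] using ⟨hn, hm⟩⟩
  have hR : regularPart φ ν = ν.restrict (⋃ i, W i) := by
    rw [hWU]
    exact (hA ν inferInstance Measure.AbsolutelyContinuous.rfl).1
  refine ⟨W, fun i => ?_, fun i => ?_, ?_⟩
  · exact (measure_mono (inter_subset_right.trans (disjointed_subset _ _))).trans_lt
      (measure_spanningSets_lt_top ν _)
  · exact (energy_mono φ (Measure.restrict_mono inter_subset_left le_rfl)).trans_lt (hAe _)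
  · rw [hR, Measure.restrict_iUnion hWd hWm]

theorem IsEnergyLimit.lintegral_apply [IsProbabilityMeasure P] {ν : Measure X}
    {N : Ω → Measure X} (hN : IsEnergyLimit P φ 𝒬 B ν N) (h𝒬 : IsPartitionSequence 𝒬)
    (hB : IsRandomClosedSet P 𝒬 B) {A : Set X} (hA : MeasurableSet A) :
    ∫⁻ ω, N ω A ∂P = ν A :=
  have := hN.finite
  lintegral_eq_of_tendsto (fun k => measurable_approxCond_apply h𝒬 hB k _ hA)
    ((Measure.measurable_coe hA).comp hN.measurable)
    (fun k => lintegral_approxCond_apply h𝒬 hB k hN.null hA) (hN.tendsto A hA)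

/-- The conditional measure is the sum of the conditional measures of the pieces of finite energy. -/
theorem isLimit_sum [IsProbabilityMeasure P] (h𝒬 : IsPartitionSequence 𝒬)
    (hB : IsRandomClosedSet P 𝒬 B) {ν : Measure X} {νs : ℕ → Measure X}
    (hR : regularPart φ ν = Measure.sum νs) {N : ℕ → Ω → Measure X}
    (hN : ∀ i, IsEnergyLimit P φ 𝒬 B (νs i) (N i)) :
    IsLimit P φ 𝒬 B ν fun ω => Measure.sum fun i => N i ω := by
  intro A hA hfinA
  have := fun i => (hN i).finite
  rw [hR, Measure.sum_apply _ hA] at hfinA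
  have := tendsto_lintegral_ennDist_tsum
    (fun k i => measurable_approxCond_apply h𝒬 hB k (νs i) hA)
    (fun i => (Measure.measurable_coe hA).comp (hN i).measurable)
    (fun k i => (lintegral_approxCond_apply h𝒬 hB k (hN i).null hA).le)
    (fun i => ((hN i).lintegral_apply h𝒬 hB hA).le) hfinA.ne fun i => (hN i).tendsto A hA
  rw [hR]
  simp_rw [approxCond_sum h𝒬 _ _ _ A hA, Measure.sum_apply _ hA]
  exact this

theorem Admissible.exists_energyLimit_pieces [CompleteSpace X] [IsProbabilityMeasure P]
    (h : Admissible P φ 𝒬 B δ F) {ν : Measure X} [IsLocallyFiniteMeasure ν]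
    (hν0 : ν (coreSet 𝒬)ᶜ = 0) :
    ∃ (νs : ℕ → Measure X) (N : ℕ → Ω → Measure X), regularPart φ ν = Measure.sum νs ∧
      ∀ i, IsEnergyLimit P φ 𝒬 B (νs i) (N i) := by
  obtain ⟨W, hWf, hWe, hR⟩ := exists_finite_pieces φ ν
  have hfin : ∀ i, IsFiniteMeasure (ν.restrict (W i)) := fun i => ⟨by simpa using hWf i⟩
  choose N hN using fun i => h.exists_of_energy (hWe i) (restrict_compl_eq_zero hν0 (W i))
  exact ⟨fun i => ν.restrict (W i), N, hR, hN⟩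

/-- Existence of the limit of `𝒞ₖ(ν_R)`. -/
theorem Admissible.exists_isLimit [CompleteSpace X] [IsProbabilityMeasure P]
    (h : Admissible P φ 𝒬 B δ F) {ν : Measure X} [IsLocallyFiniteMeasure ν]
    (hν0 : ν (coreSet 𝒬)ᶜ = 0) {U : ℕ → Set X} (hUm : ∀ i, MeasurableSet (U i))
    (hU : ∀ i, ν (U i) < ∞) :
    ∃ N : Ω → Measure X, Measurable N ∧ (∀ ω i, N ω (U i) < ∞) ∧ IsLimit P φ 𝒬 B ν N := by
  have h𝒬 := h.partition
  have hB := h.randomSet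
  obtain ⟨νs, N, hR, hN⟩ := h.exists_energyLimit_pieces hν0
  let N₀ : Ω → Measure X := fun ω => Measure.sum fun i => N i ω
  have hNm := fun i => (hN i).measurable
  have hN₀m : Measurable N₀ := measurable_measure_sum hNm
  have hlim : IsLimit P φ 𝒬 B ν N₀ := isLimit_sum h𝒬 hB hR hN
  -- The mean of `N₀(Uᵢ)` is `ν_R(Uᵢ) < ∞`. On the exceptional event the measure is then reset to 0,
  -- so that finiteness on the sets `Uᵢ` holds for every `ω`.
  have hgood : ∀ᵐ ω ∂P, ∀ i, N₀ ω (U i) < ∞ := by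
    refine ae_all_iff.2 fun i => ae_lt_top ((Measure.measurable_coe (hUm i)).comp hN₀m) ?_
    have h1 : ∫⁻ ω, N₀ ω (U i) ∂P = regularPart φ ν (U i) := by
      simp_rw [N₀, Measure.sum_apply _ (hUm i)]
      have hm : ∀ j, Measurable fun ω => N j ω (U i) := fun j =>
        (Measure.measurable_coe (hUm i)).comp (hNm j)
      rw [lintegral_tsum fun j => (hm j).aemeasurable,
        hR, Measure.sum_apply _ (hUm i)]
      exact tsum_congr fun j => (hN j).lintegral_apply h𝒬 hB (hUm i)
    change ∫⁻ ω, N₀ ω (U i) ∂P ≠ ∞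
    rw [h1]
    exact ((regularPart_le φ ν (U i)).trans_lt (hU i)).ne
  have hgm : MeasurableSet {ω | ∀ i, N₀ ω (U i) < ∞} := by
    rw [ofPred_forall]
    exact MeasurableSet.iInter fun i =>
      measurableSet_lt ((Measure.measurable_coe (hUm i)).comp hN₀m) measurable_const
  classical
  refine ⟨{ω | ∀ i, N₀ ω (U i) < ∞}.piecewise N₀ fun _ => 0,
    hN₀m.piecewise hgm measurable_const, fun ω i => ?_, fun A hA hfinA => ?_⟩
  · by_cases hω : ω ∈ {ω | ∀ i, N₀ ω (U i) < ∞}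
    · rw [piecewise_eq_of_mem _ _ _ hω]
      exact hω i
    · rw [piecewise_eq_of_notMem _ _ _ hω]
      simp
  · refine (hlim A hA hfinA).congr fun k => lintegral_congr_ae ?_
    filter_upwards [hgood] with ω hω
    rw [piecewise_eq_of_mem _ _ _ (show ω ∈ {ω | ∀ i, N₀ ω (U i) < ∞} from hω)]

section Properties

variable {ν : Measure X} [IsLocallyFiniteMeasure ν] {N : Ω → Measure X}

theorem regularPart_coreSet (hν0 : ν (coreSet 𝒬)ᶜ = 0) :
    regularPart φ ν (coreSet 𝒬)ᶜ = 0 :=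
  (regularPart_le φ ν).absolutelyContinuous hν0

/-- `E 𝒞(ν) = ν_R`. -/
theorem IsLimit.bind_eq [IsProbabilityMeasure P] (hN : IsLimit P φ 𝒬 B ν N)
    (h𝒬 : IsPartitionSequence 𝒬) (hB : IsRandomClosedSet P 𝒬 B) (hNm : Measurable N)
    (hν0 : ν (coreSet 𝒬)ᶜ = 0) : P.bind N = regularPart φ ν := by
  let V := disjointed (spanningSets (regularPart φ ν))
  have hVm : ∀ i, MeasurableSet (V i) :=
    MeasurableSet.disjointed (measurableSet_spanningSets _)
  have hVd := disjoint_disjointed (spanningSets (regularPart φ ν))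
  have hVU : ⋃ i, V i = univ := iUnion_disjointed.trans (iUnion_spanningSets _)
  have hV : ∀ i, regularPart φ ν (V i) < ∞ := fun i =>
    (measure_mono (disjointed_subset _ _)).trans_lt (measure_spanningSets_lt_top _ i)
  refine (Measure.ext_iff_of_iUnion_eq_univ hVU).2 fun i => Measure.ext fun A hA => ?_
  have hAV := hA.inter (hVm i)
  rw [Measure.restrict_apply hA, Measure.restrict_apply hA,
    Measure.bind_apply hAV hNm.aemeasurable]
  exact lintegral_eq_of_tendsto (fun k => measurable_approxCond_apply h𝒬 hB k _ hAV)
    ((Measure.measurable_coe hAV).comp hNm)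
    (fun k => lintegral_approxCond_apply h𝒬 hB k (regularPart_coreSet hν0) hAV)
    (hN _ hAV ((measure_mono inter_subset_right).trans_lt (hV i)))

theorem lintegral_lintegral_of_bind_eq {ρ : Measure X} (hNm : Measurable N) (h : P.bind N = ρ)
    {g : X → ℝ≥0∞} (hg : Measurable g) : ∫⁻ ω, ∫⁻ x, g x ∂N ω ∂P = ∫⁻ x, g x ∂ρ := by
  rw [← h, Measure.lintegral_bind hNm.aemeasurable hg.aemeasurable]

theorem measurable_lintegral_random (hNm : Measurable N) {g : X → ℝ≥0∞} (hg : Measurable g) :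
    Measurable fun ω => ∫⁻ x, g x ∂N ω :=
  (Measure.measurable_lintegral hg).comp hNm

theorem ae_ae_of_bind_eq {ρ : Measure X} (hNm : Measurable N) (h : P.bind N = ρ)
    {p : X → Prop} (hp : ∀ᵐ x ∂ρ, p x) : ∀ᵐ ω ∂P, ∀ᵐ x ∂N ω, p x := by
  rw [← h] at hp
  exact Measure.ae_ae_of_ae_bind hNm.aemeasurable hp

/-- `∫ g d𝒞ₖ(ν_R) → ∫ g d𝒞(ν)` in `L¹`. -/
theorem IsLimit.tendsto_lintegral [IsProbabilityMeasure P] (hN : IsLimit P φ 𝒬 B ν N)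
    (h𝒬 : IsPartitionSequence 𝒬) (hB : IsRandomClosedSet P 𝒬 B) (hNm : Measurable N)
    (hν0 : ν (coreSet 𝒬)ᶜ = 0) {g : X → ℝ≥0∞} (hg : Measurable g)
    (hfin : ∫⁻ x, g x ∂regularPart φ ν ≠ ∞) :
    Tendsto (fun k => ∫⁻ ω, ennDist (∫⁻ x, g x ∂approxCond P 𝒬 B k (regularPart φ ν) ω)
      (∫⁻ x, g x ∂N ω) ∂P) atTop (𝓝 0) := by
  have hbind := hN.bind_eq h𝒬 hB hNm hν0
  have hR0 : regularPart φ ν (coreSet 𝒬)ᶜ = 0 := regularPart_coreSet hν0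
  -- simple functions first
  have hsimple : ∀ s : SimpleFunc X ℝ≥0, ∫⁻ x, s x ∂regularPart φ ν ≠ ∞ →
      Tendsto (fun k => ∫⁻ ω, ennDist (∫⁻ x, s x ∂approxCond P 𝒬 B k (regularPart φ ν) ω)
        (∫⁻ x, s x ∂N ω) ∂P) atTop (𝓝 0) := by
    intro s
    induction s using SimpleFunc.induction with
    | const c hS =>
      rename_i S
      intro hfin
      have e : ∀ x, ((SimpleFunc.piecewise S hS (SimpleFunc.const X c) (SimpleFunc.const X 0) x :
          ℝ≥0) : ℝ≥0∞) = S.indicator (fun _ => (c : ℝ≥0∞)) x := by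
        intro x
        by_cases hx : x ∈ S <;> simp [hx]
      have e' : ∀ μ : Measure X, ∫⁻ x, ((SimpleFunc.piecewise S hS (SimpleFunc.const X c)
          (SimpleFunc.const X 0) x : ℝ≥0) : ℝ≥0∞) ∂μ = c * μ S := by
        intro μ
        simp_rw [e]
        rw [lintegral_indicator hS, setLIntegral_const]
      simp_rw [e'] at hfin ⊢
      simp_rw [ennDist_mul_left _ _ _ ENNReal.coe_ne_top]
      -- For `c = 0` the set may have infinite measure, and the hypothesis on sets of finite measure
      -- is not available.
      rcases eq_or_ne c 0 with rfl | hc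
      · simp
      have hc' : (c : ℝ≥0∞) ≠ 0 := by exact_mod_cast hc
      have hS' : regularPart φ ν S < ∞ := by
        by_contra hcon
        rw [not_lt, top_le_iff] at hcon
        exact hfin (by rw [hcon, ENNReal.mul_top hc'])
      have := ENNReal.Tendsto.const_mul (hN S hS hS') (Or.inr (ENNReal.coe_ne_top (r := c)))
      rw [mul_zero] at this
      refine this.congr fun k => ?_
      rw [lintegral_const_mul' _ _ ENNReal.coe_ne_top]
    | add hd h1 h2 =>
      rename_i f g
      intro hfin
      have e : ∀ μ : Measure X, ∫⁻ x, (((f + g : SimpleFunc X ℝ≥0) x : ℝ≥0) : ℝ≥0∞) ∂μ =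
          ∫⁻ x, f x ∂μ + ∫⁻ x, g x ∂μ := by
        intro μ
        rw [← lintegral_add_left f.measurable.coe_nnreal_ennreal]
        simp
      simp_rw [e] at hfin ⊢
      have h3 := (h1 (ENNReal.add_ne_top.1 hfin).1).add (h2 (ENNReal.add_ne_top.1 hfin).2)
      rw [add_zero] at h3
      refine tendsto_of_tendsto_of_tendsto_of_le_of_le tendsto_const_nhds h3 (fun _ => bot_le)
        fun k => ?_
      rw [← lintegral_add_left (measurable_ennDist
        (measurable_lintegral_approxCond h𝒬 hB k _ f.measurable.coe_nnreal_ennreal)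
        (measurable_lintegral_random hNm f.measurable.coe_nnreal_ennreal))]
      exact lintegral_mono fun ω => ennDist_add_le _ _ _ _
  have hmeas : ∀ n, Measurable fun x => (SimpleFunc.eapproxDiff g n x : ℝ≥0∞) := fun n =>
    (SimpleFunc.measurable _).coe_nnreal_ennreal
  -- Writing `g` as a countable sum of simple functions replaces an approximation argument by
  -- countable additivity; the sum of the means is the finite integral of `g`.
  have hdec : ∀ μ : Measure X, ∫⁻ x, g x ∂μ =
      ∑' n, ∫⁻ x, (SimpleFunc.eapproxDiff g n x : ℝ≥0∞) ∂μ := by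
    intro μ
    rw [← lintegral_tsum fun n => (hmeas n).aemeasurable]
    exact lintegral_congr fun x => (SimpleFunc.tsum_eapproxDiff g hg x).symm
  rw [hdec] at hfin
  simp_rw [hdec]
  exact tendsto_lintegral_ennDist_tsum
    (fun k n => measurable_lintegral_approxCond h𝒬 hB k _ (hmeas n))
    (fun n => measurable_lintegral_random hNm (hmeas n))
    (fun k n => (lintegral_lintegral_approxCond h𝒬 hB k hR0 (hmeas n)).le)
    (fun n => (lintegral_lintegral_of_bind_eq hNm hbind (hmeas n)).le) hfin
    (fun n => hsimple _ (ENNReal.ne_top_of_tsum_ne_top hfin n))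

theorem IsLimit.ae_measure_lt_top [IsProbabilityMeasure P] (hN : IsLimit P φ 𝒬 B ν N)
    (h𝒬 : IsPartitionSequence 𝒬) (hB : IsRandomClosedSet P 𝒬 B) (hNm : Measurable N)
    (hν0 : ν (coreSet 𝒬)ᶜ = 0) {A : Set X} (hA : MeasurableSet A)
    (hfin : regularPart φ ν A < ∞) : ∀ᵐ ω ∂P, N ω A < ∞ := by
  refine ae_lt_top ((Measure.measurable_coe hA).comp hNm) ?_
  change ∫⁻ ω, N ω A ∂P ≠ ∞
  rw [← Measure.bind_apply hA hNm.aemeasurable, hN.bind_eq h𝒬 hB hNm hν0]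
  exact hfin.ne

/-- `𝒞(f dν) = f d𝒞(ν)`. -/
theorem IsLimit.withDensity_ae_eq [CompleteSpace X] [IsProbabilityMeasure P]
    (hN : IsLimit P φ 𝒬 B ν N)
    (h𝒬 : IsPartitionSequence 𝒬) (hB : IsRandomClosedSet P 𝒬 B) (hNm : Measurable N)
    (hν0 : ν (coreSet 𝒬)ᶜ = 0) {f : X → ℝ≥0∞} (hf : Measurable f)
    [IsLocallyFiniteMeasure (ν.withDensity f)] {N' : Ω → Measure X}
    (hN' : IsLimit P φ 𝒬 B (ν.withDensity f) N') (hNm' : Measurable N') :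
    ∀ᵐ ω ∂P, N' ω = (N ω).withDensity f := by
  obtain ⟨A, hAm, -, -, hA⟩ := exists_regularSet φ ν
  have hE : MeasurableSet (⋃ n, A n) := MeasurableSet.iUnion hAm
  -- One set carries the regular parts of all measures absolutely continuous with respect to `ν`, so
  -- taking the regular part commutes with the density.
  have hR : regularPart φ (ν.withDensity f) = (regularPart φ ν).withDensity f := by
    rw [(hA _ inferInstance (withDensity_absolutelyContinuous ν f)).1,
      (hA ν inferInstance Measure.AbsolutelyContinuous.rfl).1, restrict_withDensity hE]
  have hν0' : ν.withDensity f (coreSet 𝒬)ᶜ = 0 := withDensity_absolutelyContinuous ν f hν0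
  let V := spanningSets (ν.withDensity f)
  have hVfin : ∀ i, regularPart φ (ν.withDensity f) (V i) < ∞ := fun i =>
    (regularPart_le φ _ _).trans_lt (measure_spanningSets_lt_top _ i)
  refine ae_eq_of_forall_ae_eq (V := V) (iUnion_spanningSets _)
    (ae_all_iff.2 fun i => hN'.ae_measure_lt_top h𝒬 hB hNm' hν0'
      (measurableSet_spanningSets _ i) (hVfin i)) fun i S hS => ?_
  have hSV : MeasurableSet (S ∩ V i) := hS.inter (measurableSet_spanningSets (ν.withDensity f) i)
  have hSfin : regularPart φ (ν.withDensity f) (S ∩ V i) < ∞ :=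
    (measure_mono inter_subset_right).trans_lt (hVfin i)
  have h1 := hN' _ hSV hSfin
  have hg : Measurable ((S ∩ V i).indicator f) := hf.indicator hSV
  have hgfin : ∫⁻ x, (S ∩ V i).indicator f x ∂regularPart φ ν ≠ ∞ := by
    rw [lintegral_indicator hSV, ← withDensity_apply _ hSV, ← hR]
    exact hSfin.ne
  have h2 := hN.tendsto_lintegral h𝒬 hB hNm hν0 hg hgfin
  -- The two densities commute, so both random measures have values on `S ∩ V i` that are `L¹`
  -- limits of one and the same sequence.
  have e1 : ∀ k ω, approxCond P 𝒬 B k (regularPart φ (ν.withDensity f)) ω (S ∩ V i) =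
      ∫⁻ x, (S ∩ V i).indicator f x ∂approxCond P 𝒬 B k (regularPart φ ν) ω := by
    intro k ω
    have hd := measurable_dens_right h𝒬 hB k ω
    rw [lintegral_approxCond h𝒬 hB _ _ _ hg, hR, approxCond_eq_withDensity h𝒬,
      withDensity_apply _ hSV, restrict_withDensity hSV,
      lintegral_withDensity_eq_lintegral_mul _ hf hd, ← lintegral_indicator hSV]
    refine lintegral_congr fun x => ?_
    by_cases hx : x ∈ S ∩ V i
    · simp only [indicator_of_mem hx, Pi.mul_apply, mul_comm]
    · simp only [indicator_of_notMem hx, mul_zero]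
  have e2 : ∀ ω, (N ω).withDensity f (S ∩ V i) = ∫⁻ x, (S ∩ V i).indicator f x ∂N ω := by
    intro ω
    rw [withDensity_apply _ hSV, lintegral_indicator hSV]
  simp_rw [e1] at h1
  simp_rw [e2]
  exact ae_eq_of_tendsto (fun k => measurable_lintegral_approxCond h𝒬 hB k _ hg)
    ((Measure.measurable_coe hSV).comp hNm') (measurable_lintegral_random hNm hg) h1 h2

/-- The case of density 1 of `IsLimit.withDensity_ae_eq`. -/
theorem IsLimit.ae_eq [CompleteSpace X] [IsProbabilityMeasure P]
    (hN : IsLimit P φ 𝒬 B ν N)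
    (h𝒬 : IsPartitionSequence 𝒬) (hB : IsRandomClosedSet P 𝒬 B) (hNm : Measurable N)
    (hν0 : ν (coreSet 𝒬)ᶜ = 0) {N' : Ω → Measure X}
    (hN' : IsLimit P φ 𝒬 B ν N') (hNm' : Measurable N') :
    ∀ᵐ ω ∂P, N' ω = N ω := by
  have h1 : ν.withDensity 1 = ν := withDensity_one
  have h2 : IsLocallyFiniteMeasure (ν.withDensity 1) := by rwa [h1]
  have h3 : IsLimit P φ 𝒬 B (ν.withDensity 1) N' := by rwa [h1]
  filter_upwards [hN.withDensity_ae_eq h𝒬 hB hNm hν0 measurable_one h3 hNm'] with ω hω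
  rw [hω, withDensity_one]

end Properties

end General

/-! ### A minimax theorem and closed null sets for finite energy -/

section Minimax

open CompactlySupported

variable {Y : Type*} [MetricSpace Y] [CompactSpace Y] [MeasurableSpace Y] [BorelSpace Y]

theorem integrable_continuousMap (μ : Measure Y) [IsFiniteMeasure μ] (f : C(Y, ℝ)) :
    Integrable f μ :=
  f.continuous.integrable_of_hasCompactSupport (HasCompactSupport.of_compactSpace f)

theorem integral_le_add_norm (μ : Measure Y) [IsProbabilityMeasure μ] (f g : C(Y, ℝ)) :
    ∫ x, g x ∂μ ≤ ∫ x, f x ∂μ + ‖g - f‖ := by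
  have h := integral_mono (μ := μ) (g := fun x => f x + ‖g - f‖) (integrable_continuousMap μ g)
    ((integrable_continuousMap μ f).add (integrable_const ‖g - f‖)) fun x => ?_
  · refine h.trans (le_of_eq ?_)
    rw [integral_add (integrable_continuousMap μ f) (integrable_const _)]
    simp
  · have := (g - f).norm_coe_le_norm x
    rw [ContinuousMap.sub_apply, Real.norm_eq_abs] at this
    change g x ≤ f x + ‖g - f‖
    linarith [le_abs_self (g x - f x)]

/-- A positive normalized functional is given by a probability measure. -/
theorem exists_measure_of_functional (Λ : C(Y, ℝ) →ₗ[ℝ] ℝ) (h0 : ∀ f, (∀ x, 0 ≤ f x) → 0 ≤ Λ f)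
    (h1 : Λ 1 = 1) :
    ∃ μ : Measure Y, IsProbabilityMeasure μ ∧ ∀ f : C(Y, ℝ), ∫ x, f x ∂μ = Λ f := by
  let Λ' : C_c(Y, ℝ) →ₗ[ℝ] ℝ :=
    { toFun := fun f => Λ f.toContinuousMap
      map_add' := fun f g => Λ.map_add _ _
      map_smul' := fun c f => Λ.map_smul c _ }
  let Ψ : C_c(Y, ℝ) →ₚ[ℝ] ℝ := PositiveLinearMap.mk₀ Λ' fun f hf => h0 _ hf
  have key : ∀ f : C(Y, ℝ), ∫ x, f x ∂(RealRMK.rieszMeasure Ψ) = Λ f := fun f =>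
    RealRMK.integral_rieszMeasure Ψ (CompactlySupportedContinuousMap.continuousMapEquiv f)
  refine ⟨RealRMK.rieszMeasure Ψ, ⟨?_⟩, key⟩
  have := key 1
  rw [h1] at this
  simp only [ContinuousMap.one_apply, integral_const, smul_eq_mul, mul_one] at this
  rw [← ENNReal.ofReal_toReal (measure_ne_top (RealRMK.rieszMeasure Ψ) univ)]
  rw [Measure.real] at this
  rw [this, ENNReal.ofReal_one]

/-- A minimax theorem: if no continuous function `f : Y → [0, 1]` makes both `∫ (1 - f) dν` and
the integrals `∫ f dσ` with `σ ∈ 𝒮` small, then this is due to a single measure in the closed convex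
hull of `𝒮`. -/
theorem exists_measure_of_minimax {𝒮 : Set (Measure Y)}
    (h𝒮 : ∀ σ ∈ 𝒮, IsProbabilityMeasure σ) (ν : Measure Y) [IsFiniteMeasure ν] {θ : ℝ}
    (h : ∀ f : C(Y, ℝ), (∀ x, 0 ≤ f x ∧ f x ≤ 1) → ∀ s, (∀ σ ∈ 𝒮, ∫ x, f x ∂σ ≤ s) →
      θ ≤ ∫ x, (1 - f x) ∂ν + s) :
    ∃ μ : Measure Y, IsProbabilityMeasure μ ∧
      (∀ (g : C(Y, ℝ)) (s : ℝ), (∀ σ ∈ 𝒮, ∫ x, g x ∂σ ≤ s) → ∫ x, g x ∂μ ≤ s) ∧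
      ∀ f : C(Y, ℝ), (∀ x, 0 ≤ f x ∧ f x ≤ 1) → θ ≤ ∫ x, (1 - f x) ∂ν + ∫ x, f x ∂μ := by
  -- `C₁` is the strict epigraph of `g ↦ sup_σ ∫ g dσ`, open and convex. `C₂` is the hypograph of `f
  -- ↦ θ - ∫ (1 - f) dν` over functions with values in `[0, 1]`. The hypothesis says that they are
  -- disjoint, so a hyperplane separates them.
  let C₁ : Set (C(Y, ℝ) × ℝ) := {p | ∃ s < p.2, ∀ σ ∈ 𝒮, ∫ x, p.1 x ∂σ ≤ s}
  let C₂ : Set (C(Y, ℝ) × ℝ) :=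
    {p | (∀ x, 0 ≤ p.1 x ∧ p.1 x ≤ 1) ∧ p.2 ≤ θ - ∫ x, (1 - p.1 x) ∂ν}
  have hint : ∀ f : C(Y, ℝ), ∫ x, (1 - f x) ∂ν = ν.real univ - ∫ x, f x ∂ν := fun f => by
    rw [integral_sub (integrable_const _) (integrable_continuousMap ν f)]
    simp
  have hcomb : ∀ (μ : Measure Y) [IsFiniteMeasure μ] (f g : C(Y, ℝ)) (a b : ℝ),
      ∫ x, (a • f + b • g) x ∂μ = a * ∫ x, f x ∂μ + b * ∫ x, g x ∂μ := by
    intro μ _ f g a b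
    simp only [ContinuousMap.add_apply, ContinuousMap.smul_apply, smul_eq_mul]
    rw [integral_add ((integrable_continuousMap μ f).const_mul a)
      ((integrable_continuousMap μ g).const_mul b), integral_const_mul, integral_const_mul]
  have hC₁ : Convex ℝ C₁ := by
    rintro ⟨f, t⟩ ⟨s, hs, hf⟩ ⟨g, t'⟩ ⟨s', hs', hg⟩ a b ha hb hab
    refine ⟨a * s + b * s', ?_, fun σ hσ => ?_⟩
    · simp only [Prod.snd_add, Prod.smul_snd, smul_eq_mul]
      rcases ha.eq_or_lt with rfl | ha'
      · have : b = 1 := by linarith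
        subst this
        simpa using hs'
      · have h1 : a * s < a * t := mul_lt_mul_of_pos_left hs ha'
        have h2 : b * s' ≤ b * t' := mul_le_mul_of_nonneg_left hs'.le hb
        linarith
    · have := h𝒮 σ hσ
      simp only [Prod.fst_add, Prod.smul_fst]
      rw [hcomb]
      exact add_le_add (mul_le_mul_of_nonneg_left (hf σ hσ) ha)
        (mul_le_mul_of_nonneg_left (hg σ hσ) hb)
  have hC₁o : IsOpen C₁ := by
    rw [Metric.isOpen_iff]
    rintro ⟨f, t⟩ ⟨s, hs, hf⟩
    refine ⟨(t - s) / 3, by simp only at hs; linarith, ?_⟩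
    rintro ⟨g, t'⟩ hg
    rw [Metric.mem_ball, Prod.dist_eq, max_lt_iff, dist_eq_norm, Real.dist_eq] at hg
    simp only at hg hs
    refine ⟨s + (t - s) / 3, ?_, fun σ hσ => ?_⟩
    · have := (abs_lt.1 hg.2).1
      simp only
      linarith
    · have := h𝒮 σ hσ
      have h1 := integral_le_add_norm σ f g
      have h2 := hf σ hσ
      simp only at h2 ⊢
      linarith [hg.1]
  have hC₂ : Convex ℝ C₂ := by
    rintro ⟨f, t⟩ ⟨hf, ht⟩ ⟨g, t'⟩ ⟨hg, ht'⟩ a b ha hb hab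
    simp only at hf ht hg ht'
    refine ⟨fun x => ?_, ?_⟩
    · simp only [Prod.fst_add, Prod.smul_fst, ContinuousMap.add_apply, ContinuousMap.smul_apply,
        smul_eq_mul]
      constructor
      · have := mul_nonneg ha (hf x).1
        have := mul_nonneg hb (hg x).1
        linarith
      · have := mul_le_mul_of_nonneg_left (hf x).2 ha
        have := mul_le_mul_of_nonneg_left (hg x).2 hb
        linarith
    · simp only [Prod.fst_add, Prod.smul_fst, Prod.snd_add, Prod.smul_snd, smul_eq_mul]
      rw [hint] at ht ht' ⊢
      rw [hcomb]
      have h1 := mul_le_mul_of_nonneg_left ht ha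
      have h2 := mul_le_mul_of_nonneg_left ht' hb
      have h3 : a = 1 - b := by linarith
      subst h3
      linarith
  have hdisj : Disjoint C₁ C₂ := by
    rw [Set.disjoint_left]
    rintro ⟨f, t⟩ ⟨s, hs, hf⟩ ⟨hf', ht⟩
    have := h f hf' s hf
    simp only at hs ht
    linarith
  obtain ⟨L, u, hL1, hL2⟩ := geometric_hahn_banach_open hC₁ hC₁o hC₂ hdisj
  have hLadd : ∀ (f : C(Y, ℝ)) (t : ℝ), L (f, t) = L (f, 0) + t * L (0, 1) := by
    intro f t
    rw [← smul_eq_mul, ← map_smul, ← map_add]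
    simp
  have h1mem : ∀ t : ℝ, 0 < t → ((0 : C(Y, ℝ)), t) ∈ C₁ := fun t ht =>
    ⟨0, ht, fun σ _ => by simp⟩
  have h2mem : ((0 : C(Y, ℝ)), θ - ν.real univ) ∈ C₂ := by
    refine ⟨fun x => by simp, ?_⟩
    simp
  -- The hyperplane is not vertical: `C₁` contains `(0, t)` for all `t > 0`, and `C₂` contains a
  -- point of the same vertical line.
  have hc : L (0, 1) < 0 := by
    have e : ∀ t : ℝ, L (0, t) = t * L (0, 1) := fun t => by
      rw [hLadd, show ((0 : C(Y, ℝ)), (0 : ℝ)) = 0 from rfl, map_zero, zero_add]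
    have h3 := hL1 _ (h1mem (|θ - ν.real univ| + 1) (by positivity))
    have h4 := hL2 _ h2mem
    rw [e] at h3 h4
    by_contra hcon
    push Not at hcon
    have h5 : (θ - ν.real univ) * L (0, 1) ≤ (|θ - ν.real univ| + 1) * L (0, 1) :=
      mul_le_mul_of_nonneg_right (by linarith [le_abs_self (θ - ν.real univ)]) hcon
    linarith
  set c := L (0, 1) with hcdef
  -- Normalised so that `L (f, t) = -c (Λ f - t)` with `-c > 0`: the separating hyperplane is a
  -- translate of the graph of `Λ`.
  let Λ : C(Y, ℝ) →ₗ[ℝ] ℝ :=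
    { toFun := fun f => L (f, 0) / (-c)
      map_add' := fun f g => by
        rw [← add_div, ← map_add]
        simp
      map_smul' := fun a f => by
        rw [RingHom.id_apply, smul_eq_mul, ← mul_div_assoc, ← smul_eq_mul, ← map_smul]
        simp }
  have hc0 : c ≠ 0 := hc.ne
  have hΛL : ∀ f t, L (f, t) = -c * (Λ f - t) := by
    intro f t
    rw [hLadd]
    change _ = -c * (L (f, 0) / (-c) - t)
    field_simp
    ring
  have hu : 0 ≤ u := by
    by_contra hcon
    push Not at hcon
    -- At this point `L` takes the value `u / 2`, which exceeds `u` if `u < 0`.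
    have := hL1 _ (h1mem (u / (2 * c)) (div_pos_of_neg_of_neg hcon (by linarith)))
    rw [hΛL, map_zero] at this
    have h5 : -c * (0 - u / (2 * c)) = u / 2 := by field_simp; ring
    rw [h5] at this
    linarith
  -- If `Λ g > s`, the points `(n g, n s + 1)` of `C₁` have unbounded `L`-values. Positivity and `Λ
  -- 1 = 1` below are instances of this bound, for `-f` and for `±1`.
  have hΛ1 : ∀ (g : C(Y, ℝ)) (s : ℝ), (∀ σ ∈ 𝒮, ∫ x, g x ∂σ ≤ s) → Λ g ≤ s := by
    intro g s hg
    by_contra hcon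
    push Not at hcon
    obtain ⟨n, hn⟩ := exists_nat_gt ((u / (-c) + 1) / (Λ g - s))
    have hmem : ((n : ℝ) • g, n * s + 1) ∈ C₁ := by
      refine ⟨n * s, by simp, fun σ hσ => ?_⟩
      simp only [ContinuousMap.smul_apply, smul_eq_mul]
      rw [integral_const_mul]
      exact mul_le_mul_of_nonneg_left (hg σ hσ) (Nat.cast_nonneg n)
    have := hL1 _ hmem
    rw [hΛL, map_smul, smul_eq_mul] at this
    rw [div_lt_iff₀ (by linarith)] at hn
    have h6 : u / (-c) * (-c) = u := div_mul_cancel₀ _ (by linarith)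
    have h7 : u / (-c) < n * Λ g - (n * s + 1) := by linarith
    have h8 := mul_lt_mul_of_pos_right h7 (show 0 < -c by linarith)
    rw [h6] at h8
    linarith
  have hΛ2 : ∀ f : C(Y, ℝ), (∀ x, 0 ≤ f x ∧ f x ≤ 1) → θ ≤ ∫ x, (1 - f x) ∂ν + Λ f := by
    intro f hf
    have := hL2 (f, θ - ∫ x, (1 - f x) ∂ν) ⟨hf, le_rfl⟩
    rw [hΛL] at this
    have h9 : 0 ≤ Λ f - (θ - ∫ x, (1 - f x) ∂ν) :=
      nonneg_of_mul_nonneg_right (hu.trans this) (by linarith)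
    linarith
  have hpos : ∀ f : C(Y, ℝ), (∀ x, 0 ≤ f x) → 0 ≤ Λ f := by
    intro f hf
    have := hΛ1 (-f) 0 fun σ hσ => by
      simp only [ContinuousMap.neg_apply, integral_neg]
      exact neg_nonpos.2 (integral_nonneg hf)
    rw [map_neg] at this
    linarith
  have hone : Λ 1 = 1 := by
    refine le_antisymm (hΛ1 1 1 fun σ hσ => ?_) ?_
    · have := h𝒮 σ hσ
      simp
    · have := hΛ1 (-1) (-1) fun σ hσ => by
        have := h𝒮 σ hσ
        simp
      rw [map_neg] at this
      linarith
  obtain ⟨μ, hμ, hμΛ⟩ := exists_measure_of_functional Λ hpos hone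
  exact ⟨μ, hμ, fun g s hg => by rw [hμΛ]; exact hΛ1 g s hg, fun f hf => by
    rw [hμΛ]; exact hΛ2 f hf⟩

/-- If `μ` is singular to `ν` then continuous functions separate them. -/
theorem exists_separating {μ ν : Measure Y} [IsFiniteMeasure μ] [IsFiniteMeasure ν]
    (h : μ ⟂ₘ ν) {θ : ℝ} (hθ : 0 < θ) :
    ∃ f : C(Y, ℝ), (∀ x, 0 ≤ f x ∧ f x ≤ 1) ∧ ∫ x, (1 - f x) ∂ν + ∫ x, f x ∂μ < θ := by
  obtain ⟨s, hs, hμs, hνs⟩ := h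
  -- A closed set `K` that is `μ`-null and carries all of `ν` up to `θ / 2`. The desired `f` is a
  -- continuous function above the indicator of `K`, close enough to it in `μ`-integral.
  obtain ⟨K, hKs, hK, hνK⟩ := hs.exists_isClosed_sdiff_lt (μ := ν) (measure_ne_top _ _)
    (ε := ENNReal.ofReal (θ / 2)) (by simpa using hθ)
  have hνK' : ν.real Kᶜ < θ / 2 := by
    have h1 : ν Kᶜ ≤ ν (s \ K) := by
      calc ν Kᶜ ≤ ν ((s \ K) ∪ sᶜ) := measure_mono fun x hx => by
            by_cases h : x ∈ s
            · exact Or.inl ⟨h, hx⟩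
            · exact Or.inr h
        _ ≤ ν (s \ K) + ν sᶜ := measure_union_le _ _
        _ = ν (s \ K) := by rw [hνs, add_zero]
    exact (ENNReal.lt_ofReal_iff_toReal_lt (measure_ne_top _ _)).1 (h1.trans_lt hνK)
  have hμK : μ K = 0 := measure_mono_null hKs hμs
  have hlim := HasOuterApproxClosed.tendsto_lintegral_apprSeq hK μ
  rw [hμK] at hlim
  obtain ⟨n, hn⟩ := (hlim.eventually (gt_mem_nhds
    (show (0 : ℝ≥0∞) < ENNReal.ofReal (θ / 2) by simpa using hθ))).exists
  set g := hK.apprSeq n with hg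
  let f : C(Y, ℝ) := ⟨fun x => (g x : ℝ), by fun_prop⟩
  have hf1 : ∀ x, f x ≤ 1 := fun x => by
    have := HasOuterApproxClosed.apprSeq_apply_le_one hK n x
    exact_mod_cast this
  refine ⟨f, fun x => ⟨(g x).2, hf1 x⟩, ?_⟩
  have h1 : ∫ x, (1 - f x) ∂ν ≤ ν.real Kᶜ := by
    rw [← integral_indicator_one hK.measurableSet.compl]
    refine integral_mono ((integrable_const _).sub (integrable_continuousMap ν f))
      ((integrable_const _).indicator hK.measurableSet.compl) fun x => ?_
    by_cases hx : x ∈ K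
    · have : f x = 1 := by
        have := HasOuterApproxClosed.apprSeq_apply_eq_one hK n hx
        simp [f, hg, this]
      simp [hx, this]
    · have : (0 : ℝ) ≤ f x := (g x).2
      simp [hx, this]
  have h2 : ∫ x, f x ∂μ < θ / 2 := by
    have e : ∫ x, f x ∂μ = (∫⁻ x, g x ∂μ).toReal := by
      change ∫ x, (g x : ℝ) ∂μ = _
      rw [integral_eq_lintegral_of_nonneg_ae (f := fun x => (g x : ℝ)) (ae_of_all _ fun x => (g x).2)
        f.continuous.aestronglyMeasurable]
      simp
    rw [e]
    exact (ENNReal.lt_ofReal_iff_toReal_lt hn.ne_top).1 hn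
  linarith

variable {φ : ℝ≥0 → ℝ≥0∞}

/-- The potential of `σ` with respect to the truncated kernel is continuous. -/
theorem exists_truncated_potential (hφ : IsRegularityKernel φ) (n : ℕ) (σ : Measure Y)
    [IsFiniteMeasure σ] :
    ∃ g : C(Y, ℝ), ∀ (μ : Measure Y) [IsFiniteMeasure μ] (s : ℝ), 0 ≤ s →
      (∫ x, g x ∂μ ≤ s ↔
        ∫⁻ x, ∫⁻ y, min (φ (nndist x y)) n ∂σ ∂μ ≤ ENNReal.ofReal s) := by
  have hn : ∀ x y : Y, min (φ (nndist x y)) (n : ℝ≥0∞) ≠ ∞ := fun x y =>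
    ((min_le_right _ _).trans_lt (ENNReal.natCast_lt_top n)).ne
  have hle : ∀ x y : Y, (min (φ (nndist x y)) (n : ℝ≥0∞)).toReal ≤ n := fun x y =>
    ENNReal.toReal_le_of_le_ofReal (Nat.cast_nonneg n) (by simp)
  have hcont : Continuous fun p : Y × Y => (min (φ (nndist p.1 p.2)) (n : ℝ≥0∞)).toReal := by
    refine continuous_iff_continuousAt.2 fun p => ?_
    refine (ENNReal.tendsto_toReal (hn p.1 p.2)).comp ?_
    exact ((hφ.continuous.comp (continuous_fst.nndist continuous_snd)).min
      continuous_const).tendsto p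
  have hc1 : ∀ x : Y, Continuous fun y => (min (φ (nndist x y)) (n : ℝ≥0∞)).toReal := fun x =>
    hcont.comp (by fun_prop : Continuous fun y : Y => (x, y))
  have hc2 : ∀ y : Y, Continuous fun x => (min (φ (nndist x y)) (n : ℝ≥0∞)).toReal := fun y =>
    hcont.comp (by fun_prop : Continuous fun x : Y => (x, y))
  have hbound : ∀ x y : Y, ‖(min (φ (nndist x y)) (n : ℝ≥0∞)).toReal‖ ≤ n := fun x y => by
    rw [Real.norm_of_nonneg ENNReal.toReal_nonneg]
    exact hle x y
  let g : C(Y, ℝ) := ⟨fun x => ∫ y, (min (φ (nndist x y)) (n : ℝ≥0∞)).toReal ∂σ,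
    continuous_of_dominated (fun x => (hc1 x).aestronglyMeasurable)
      (fun x => ae_of_all _ (hbound x)) (integrable_const _) (ae_of_all _ hc2)⟩
  have hg0 : ∀ x, 0 ≤ g x := fun x => integral_nonneg fun y => ENNReal.toReal_nonneg
  have hg : ∀ x, ENNReal.ofReal (g x) = ∫⁻ y, min (φ (nndist x y)) n ∂σ := by
    intro x
    change ENNReal.ofReal (∫ y, (min (φ (nndist x y)) (n : ℝ≥0∞)).toReal ∂σ) = _
    rw [ofReal_integral_eq_lintegral_ofReal
      ((integrable_const (n : ℝ)).mono' (hc1 x).aestronglyMeasurable (ae_of_all _ (hbound x)))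
      (ae_of_all _ fun y => ENNReal.toReal_nonneg)]
    exact lintegral_congr fun y => ENNReal.ofReal_toReal (hn x y)
  refine ⟨g, fun μ _ s hs => ?_⟩
  rw [← ENNReal.ofReal_le_ofReal_iff hs, ofReal_integral_eq_lintegral_ofReal
    (integrable_continuousMap μ g) (ae_of_all _ hg0)]
  simp_rw [hg]

theorem lintegral_min_kernel_swap (hφ : IsRegularityKernel φ) (n : ℕ) (σ μ : Measure Y)
    [IsFiniteMeasure σ] [IsFiniteMeasure μ] :
    ∫⁻ x, ∫⁻ y, min (φ (nndist x y)) n ∂σ ∂μ = ∫⁻ x, ∫⁻ y, min (φ (nndist x y)) n ∂μ ∂σ := by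
  have hm : Measurable fun p : Y × Y => min (φ (nndist p.1 p.2)) (n : ℝ≥0∞) :=
    (measurable_kernel hφ).min measurable_const
  rw [lintegral_lintegral_swap hm.aemeasurable]
  simp_rw [nndist_comm]

/-- Otherwise `exists_measure_of_minimax` yields a probability measure `μ` in the closed convex hull
of the measures considered. Their mutual energies are at most `s` by `two_mul_mutual_energy_le`, so
`I_φ(μ) ≤ s`. Then `μ` is singular to `ν`, and a function that separates them contradicts the choice
of `μ`. -/
theorem exists_small_on_energy_le (hφ : IsRegularityKernel φ) {ν : Measure Y} [IsFiniteMeasure ν]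
    (hν : ∀ μ : Measure Y, IsFiniteMeasure μ → energy φ μ < ∞ → μ ⟂ₘ ν) (s : ℕ) {θ : ℝ}
    (hθ : 0 < θ) :
    ∃ f : C(Y, ℝ), (∀ x, 0 ≤ f x ∧ f x ≤ 1) ∧ ∫ x, (1 - f x) ∂ν ≤ θ ∧
      ∀ σ : Measure Y, IsProbabilityMeasure σ →
        ∫⁻ p, φ (nndist p.1 p.2 / 2) ∂(σ.prod σ) ≤ s → ∫ x, f x ∂σ ≤ θ := by
  let 𝒮 : Set (Measure Y) :=
    {σ | IsProbabilityMeasure σ ∧ ∫⁻ p, φ (nndist p.1 p.2 / 2) ∂(σ.prod σ) ≤ s}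
  -- A member `σ₀` is needed later to see that upper bounds of all `∫ f dσ` are nonnegative. Without
  -- members, `f = 1` works.
  rcases 𝒮.eq_empty_or_nonempty with hemp | ⟨σ₀, hσ₀⟩
  · refine ⟨1, fun x => by simp, by simpa using hθ.le, fun σ hσ hσs => ?_⟩
    have : σ ∈ 𝒮 := ⟨hσ, hσs⟩
    rw [hemp] at this
    exact absurd this (notMem_empty σ)
  by_contra hcon
  obtain ⟨μ, hμ, hμ1, hμ2⟩ := exists_measure_of_minimax (𝒮 := 𝒮) (fun σ hσ => hσ.1) ν (θ := θ)
    fun f hf t ht => by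
      by_contra hlt
      push Not at hlt
      have h0 : 0 ≤ ∫ x, (1 - f x) ∂ν := integral_nonneg fun x => sub_nonneg.2 (hf x).2
      have h1 : 0 ≤ t := (integral_nonneg fun x => (hf x).1).trans (ht σ₀ hσ₀)
      exact hcon ⟨f, hf, by linarith, fun σ hσ hσs => (ht σ ⟨hσ, hσs⟩).trans (by linarith)⟩
  have hs0 : (0 : ℝ) ≤ s := Nat.cast_nonneg s
  have hs1 : ENNReal.ofReal (s : ℝ) = s := ENNReal.ofReal_natCast s
  -- Unlike energy, mutual energy is linear in each measure, so its bound passes to `μ` one variable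
  -- at a time. The truncation at `n` makes the potentials continuous, as the hull property of `μ`
  -- requires.
  have hmut : ∀ σ ∈ 𝒮, ∀ σ' ∈ 𝒮, ∀ n : ℕ,
      ∫⁻ x, ∫⁻ y, min (φ (nndist x y)) n ∂σ ∂σ' ≤ s := by
    rintro σ ⟨hσ, hσs⟩ σ' ⟨hσ', hσs'⟩ n
    have h1 := two_mul_mutual_energy_le hφ σ' σ
    rw [lintegral_prod _ (measurable_kernel hφ).aemeasurable] at h1
    have h2 : 2 * ∫⁻ x, ∫⁻ y, min (φ (nndist x y)) n ∂σ ∂σ' ≤ 2 * s := by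
      calc _ ≤ 2 * ∫⁻ x, ∫⁻ y, φ (nndist x y) ∂σ ∂σ' := by
            gcongr
            exact min_le_left _ _
        _ ≤ s + s := h1.trans (add_le_add hσs' hσs)
        _ = 2 * s := (two_mul _).symm
    exact (ENNReal.mul_le_mul_iff_right two_ne_zero ENNReal.ofNat_ne_top).1 h2
  have hμσ : ∀ σ ∈ 𝒮, ∀ n : ℕ, ∫⁻ x, ∫⁻ y, min (φ (nndist x y)) n ∂σ ∂μ ≤ s := by
    intro σ hσ n
    have := hσ.1
    obtain ⟨g, hg⟩ := exists_truncated_potential hφ n σ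
    rw [← hs1, ← hg μ s hs0]
    refine hμ1 g s fun σ' hσ' => ?_
    have := hσ'.1
    rw [hg σ' s hs0, hs1]
    exact hmut σ hσ σ' hσ' n
  have hμμ : ∀ n : ℕ, ∫⁻ x, ∫⁻ y, min (φ (nndist x y)) n ∂μ ∂μ ≤ s := by
    intro n
    obtain ⟨g, hg⟩ := exists_truncated_potential hφ n μ
    rw [← hs1, ← hg μ s hs0]
    refine hμ1 g s fun σ hσ => ?_
    have := hσ.1
    rw [hg σ s hs0, hs1, lintegral_min_kernel_swap hφ]
    exact hμσ σ hσ n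
  have henergy : energy φ μ ≤ s := by
    rw [energy_eq_lintegral_prod hφ]
    have hsup : ∀ p : Y × Y, φ (nndist p.1 p.2) = ⨆ n : ℕ, min (φ (nndist p.1 p.2)) n := by
      intro p
      rw [← inf_iSup_eq, ENNReal.iSup_natCast, inf_top_eq]
    rw [lintegral_congr hsup]
    rw [lintegral_iSup (fun n => (measurable_kernel hφ).min measurable_const)
      fun m n hmn p => min_le_min_left _ (by exact_mod_cast hmn)]
    refine iSup_le fun n => ?_
    rw [lintegral_prod _ ((measurable_kernel hφ).min measurable_const).aemeasurable]
    exact hμμ n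
  obtain ⟨f, hf, hfθ⟩ := exists_separating (hν μ inferInstance
    (henergy.trans_lt (ENNReal.natCast_lt_top s))) hθ
  exact absurd (hμ2 f hf) (not_le.2 hfθ)

/-- A measure that is singular to all measures of finite energy is concentrated, up to an arbitrarily
small mass, on a closed set that is a null set for all measures of finite energy. -/
theorem exists_closed_null (hφ : IsRegularityKernel φ) {ν : Measure Y} [IsFiniteMeasure ν]
    (hν : ∀ μ : Measure Y, IsFiniteMeasure μ → energy φ μ < ∞ → μ ⟂ₘ ν) {ε : ℝ≥0∞} (hε : ε ≠ 0) :
    ∃ D : Set Y, IsClosed D ∧ ν Dᶜ ≤ ε ∧ ∀ σ : Measure Y, IsProbabilityMeasure σ →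
      ∫⁻ p, φ (nndist p.1 p.2 / 2) ∂(σ.prod σ) < ∞ → σ D = 0 := by
  -- `f n` treats energies up to `n` with error `ε' n / 2`, and `D` is the intersection of the sets
  -- `{f n ≥ 1/2}`. By Markov's inequality `ν {f n < 1/2} ≤ ε' n`, which is summable. If `σ` has
  -- energy at most `m`, then `σ D ≤ ε' n → 0` for `n ≥ m`.
  obtain ⟨ε', hε'0, hε'⟩ := ENNReal.exists_pos_sum_of_countable hε ℕ
  choose f hf hfν hfσ using fun n : ℕ =>
    exists_small_on_energy_le hφ hν n (θ := ε' n / 2) (by have := hε'0 n; positivity)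
  have hmark : ∀ (μ : Measure Y) [IsFiniteMeasure μ] (g : C(Y, ℝ)) (t : ℝ≥0), (∀ x, 0 ≤ g x) →
      ∫ x, g x ∂μ ≤ t / 2 → μ {x | 1 / 2 ≤ g x} ≤ t := by
    intro μ _ g t hg ht
    have := mul_meas_ge_le_integral_of_nonneg (ae_of_all _ hg) (integrable_continuousMap μ g)
      (1 / 2)
    rw [← ENNReal.ofReal_toReal (measure_ne_top μ _), ← ENNReal.ofReal_coe_nnreal]
    refine ENNReal.ofReal_le_ofReal ?_
    rw [Measure.real] at this
    linarith
  refine ⟨⋂ n, {x | 1 / 2 ≤ f n x}, isClosed_iInter fun n =>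
    isClosed_le continuous_const (f n).continuous, ?_, fun σ hσ hfin => ?_⟩
  · rw [compl_iInter]
    refine (measure_iUnion_le _).trans (le_trans (ENNReal.tsum_le_tsum fun n => ?_) hε'.le)
    refine le_trans (measure_mono fun x hx => ?_) (hmark ν (1 - f n) (ε' n)
      (fun x => sub_nonneg.2 (hf n x).2) (hfν n))
    have : f n x < 1 / 2 := not_le.1 hx
    change 1 / 2 ≤ 1 - f n x
    linarith
  · obtain ⟨m, hm⟩ := ENNReal.exists_nat_gt hfin.ne
    have hlim : Tendsto (fun n => (ε' n : ℝ≥0∞)) atTop (𝓝 0) :=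
      ENNReal.tendsto_atTop_zero_of_tsum_ne_top hε'.ne_top
    refine le_antisymm (ge_of_tendsto hlim ?_) bot_le
    filter_upwards [eventually_ge_atTop m] with n hn
    refine (measure_mono (iInter_subset _ n)).trans (hmark σ (f n) (ε' n) (fun x => (hf n x).1)
      (hfσ n σ hσ (hm.le.trans (by exact_mod_cast hn))))

end Minimax

/-! ### Singular measures and sets of zero capacity -/

section Singular

variable {X : Type*} [MetricSpace X] [MeasurableSpace X] [SecondCountableTopology X] [BorelSpace X]
  {Ω : Type*} [MeasurableSpace Ω] {P : Measure Ω} {φ : ℝ≥0 → ℝ≥0∞} {𝒬 : ℕ → Set (Set X)}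
  {B : Ω → Set X} {δ : ℝ≥0} {F : X → X → ℝ≥0∞}

theorem energy_map_subtype {K : Set X} (hK : MeasurableSet K) (η : Measure K) :
    energy φ (η.map Subtype.val) = energy φ η := by
  unfold energy
  have he := MeasurableEmbedding.subtype_coe hK
  simp_rw [he.lintegral_map]
  rfl

theorem lintegral_half_kernel_lt_top {δ : ℝ≥0} (hδ : 0 < δ) (h : KernelRestriction φ δ)
    (hφ : IsRegularityKernel φ) (hφ0 : φ 0 = ∞) {σ : Measure X} [IsFiniteMeasure σ]
    (hσ : energy φ σ < ∞) : ∫⁻ p, φ (nndist p.1 p.2 / 2) ∂(σ.prod σ) < ∞ := by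
  obtain ⟨C, -, hC⟩ := h.half hδ hφ hφ0
  rw [energy_eq_lintegral_prod hφ] at hσ
  calc ∫⁻ p, φ (nndist p.1 p.2 / 2) ∂(σ.prod σ)
      ≤ ∫⁻ p, (C * φ (nndist p.1 p.2) + C) ∂(σ.prod σ) := lintegral_mono fun p => hC _
    _ = C * ∫⁻ p, φ (nndist p.1 p.2) ∂(σ.prod σ) + C * (σ.prod σ) univ := by
        rw [lintegral_add_right _ measurable_const, lintegral_const_mul' _ _ ENNReal.coe_ne_top,
          lintegral_const]
    _ < ∞ := ENNReal.add_lt_top.2 ⟨ENNReal.mul_lt_top ENNReal.coe_lt_top hσ,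
        ENNReal.mul_lt_top ENNReal.coe_lt_top (measure_lt_top _ _)⟩

/-- A measure on a compact set that is singular to all measures of finite energy is concentrated, up
to an arbitrarily small mass, on a compact set of zero capacity. -/
theorem exists_compact_capacity_zero {δ : ℝ≥0} (hδ : 0 < δ) (h : KernelRestriction φ δ)
    (hφ : IsRegularityKernel φ) (hφ0 : φ 0 = ∞) {ν : Measure X} [IsFiniteMeasure ν]
    (hν : ∀ μ : Measure X, IsLocallyFiniteMeasure μ → energy φ μ < ∞ → ν ⟂ₘ μ)
    {K : Set X} (hK : IsCompact K) {ε : ℝ≥0∞} (hε : ε ≠ 0) :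
    ∃ D ⊆ K, IsCompact D ∧ capacity φ D = 0 ∧ ν (K \ D) ≤ ε := by
  have hKm := hK.measurableSet
  have he := MeasurableEmbedding.subtype_coe hKm
  have : CompactSpace K := isCompact_iff_compactSpace.1 hK
  let ν' : Measure K := ν.comap Subtype.val
  have hmap : ν'.map Subtype.val = ν.restrict K := map_comap_subtype_coe hKm ν
  have happ : ∀ (μ : Measure X) (S : Set K), μ.comap Subtype.val S = μ (Subtype.val '' S) :=
    fun μ S => he.comap_apply μ S
  have hfin : IsFiniteMeasure ν' := ⟨by rw [happ]; exact measure_lt_top _ _⟩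
  -- The argument runs on `K` as a compact space. Measures on `K` are pushed forward to `X` with the
  -- same energy, and there singularity to `ν` is known.
  obtain ⟨D, hD, hνD, hσD⟩ := exists_closed_null hφ (ν := ν') (fun η hη hηe => by
    rw [← energy_map_subtype hKm] at hηe
    obtain ⟨s, hs, h1, h2⟩ := hν (η.map Subtype.val) inferInstance hηe
    refine ⟨Subtype.val ⁻¹' sᶜ, measurable_subtype_coe hs.compl, ?_, ?_⟩
    · rwa [Measure.map_apply measurable_subtype_coe hs.compl] at h2
    · rw [happ, ← preimage_compl, compl_compl]
      exact measure_mono_null (image_preimage_subset _ _) h1) hε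
  refine ⟨Subtype.val '' D, by simp, hD.isCompact.image continuous_subtype_val, ?_, ?_⟩
  -- Positive capacity would give a probability measure on `D` of finite energy. By the growth
  -- condition its energy for `φ(r/2)` is finite too, so `D` would be null for it.
  · rw [capacity]
    simp only [ENNReal.iSup_eq_zero]
    intro σ hσ hσ0
    by_contra hne
    have hσe : energy φ σ < ∞ := by
      rw [lt_top_iff_ne_top]
      exact fun h => hne (by rw [h, ENNReal.inv_top])
    have hσK : σ Kᶜ = 0 := measure_mono_null (compl_subset_compl.2 (by simp)) hσ0
    have hmapσ : (σ.comap Subtype.val : Measure K).map Subtype.val = σ := by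
      rw [map_comap_subtype_coe hKm, Measure.restrict_eq_self_of_ae_mem]
      exact hσK
    have hprob : IsProbabilityMeasure (σ.comap Subtype.val : Measure K) := ⟨by
      rw [happ, image_univ, Subtype.range_coe]
      exact (prob_compl_eq_zero_iff hKm).1 hσK⟩
    have he' : energy φ (σ.comap Subtype.val : Measure K) < ∞ := by
      rwa [← energy_map_subtype hKm, hmapσ]
    have h0 := hσD _ hprob (lintegral_half_kernel_lt_top hδ h hφ hφ0 he')
    rw [happ] at h0
    have := (prob_compl_eq_zero_iff
      (hD.isCompact.image continuous_subtype_val).measurableSet).1 hσ0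
    rw [h0] at this
    exact zero_ne_one this
  · refine le_trans (le_of_eq ?_) hνD
    rw [happ]
    congr 1
    ext x
    constructor
    · rintro ⟨hx, h⟩
      exact ⟨⟨x, hx⟩, fun hx' => h ⟨_, hx', rfl⟩, rfl⟩
    · rintro ⟨y, hy, rfl⟩
      exact ⟨y.2, fun ⟨z, hz, hzy⟩ => hy (Subtype.val_injective hzy ▸ hz)⟩

end Singular

/-! ### The singular part vanishes; convergence in probability -/

section SingularLimit

variable {X : Type*} [MetricSpace X] [MeasurableSpace X] [SecondCountableTopology X] [BorelSpace X]
  {Ω : Type*} [MeasurableSpace Ω] {P : Measure Ω} {φ : ℝ≥0 → ℝ≥0∞} {𝒬 : ℕ → Set (Set X)}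
  {B : Ω → Set X} {δ : ℝ≥0} {F : X → X → ℝ≥0∞}

/-- Away from `B` the measures `𝒞ₖ(η)` eventually vanish. -/
theorem eventually_approxCond_eq_zero (h𝒬 : IsPartitionSequence 𝒬) {ω : Ω} {E : Set X}
    (hE : MeasurableSet E) {r : ℝ≥0∞} (hr : 0 < r)
    (hEB : ∀ x ∈ E, ∀ y ∈ B ω, r ≤ edist x y) :
    ∀ᶠ k in atTop, ∀ η : Measure X, approxCond P 𝒬 B k η ω E = 0 := by
  filter_upwards [h𝒬.tendsto_diam.eventually (gt_mem_nhds hr)] with k hk η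
  rw [approxCond_eq_withDensity h𝒬, withDensity_apply _ hE]
  refine setLIntegral_eq_zero hE fun x hx => ?_
  by_cases hxk : x ∈ ⋃₀ 𝒬 k
  · obtain ⟨Q, hQ, hxQ⟩ := hxk
    rw [dens_of_mem h𝒬 hQ hxQ, indicator_of_notMem, mul_zero, Pi.zero_apply]
    -- A cell that contains `x ∈ E` and meets `B` has diameter at least `r`.
    rintro ⟨y, hyQ, hyB⟩
    exact absurd ((hEB x hx y hyB).trans ((Metric.edist_le_ediam_of_mem hxQ hyQ).trans
      (ediam_le_mesh hQ))) (not_le.2 hk)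
  · exact dens_of_notMem hxk ω

/-- The mean of `min 1 (·)` expresses convergence in probability; subadditivity allows adding terms
that are small in `L¹`. -/
theorem min_one_add_le (a b : ℝ≥0∞) : min 1 (a + b) ≤ min 1 a + min 1 b := by
  rcases le_total 1 a with h | h
  · rw [min_eq_left h]
    exact (min_le_left _ _).trans le_self_add
  rcases le_total 1 b with h' | h'
  · rw [min_eq_left h']
    exact (min_le_left _ _).trans le_add_self
  · rw [min_eq_right h, min_eq_right h']
    exact min_le_right _ _

theorem lintegral_min_one_le (u v : Ω → ℝ≥0∞) (hu : AEMeasurable u P) :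
    ∫⁻ ω, min 1 (u ω + v ω) ∂P ≤ ∫⁻ ω, min 1 (u ω) ∂P + ∫⁻ ω, v ω ∂P := by
  rw [← lintegral_add_left' (aemeasurable_const.min hu)]
  exact lintegral_mono fun ω => (min_one_add_le _ _).trans (add_le_add le_rfl (min_le_right _ _))

/-- The approximations of the conditional measure of a finite singular measure tend to zero. -/
theorem Admissible.tendsto_singular [CompleteSpace X] [IsProbabilityMeasure P]
    (h : Admissible P φ 𝒬 B δ F) {ν : Measure X} [IsFiniteMeasure ν]
    (hν0 : ν (coreSet 𝒬)ᶜ = 0)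
    (hν : ∀ μ : Measure X, IsLocallyFiniteMeasure μ → energy φ μ < ∞ → ν ⟂ₘ μ) :
    Tendsto (fun k => ∫⁻ ω, min 1 (approxCond P 𝒬 B k ν ω univ) ∂P) atTop (𝓝 0) := by
  have h𝒬 := h.partition
  have hB := h.randomSet
  rw [ENNReal.tendsto_nhds_zero]
  intro ε hε
  -- Two thirds bound the mass of `X₀ \ K` and of `K \ D`, which enter through the mean. The last
  -- third is for `D`, where only convergence in probability is available.
  have hε3 : ε / 3 ≠ 0 := (ENNReal.div_pos hε.ne' ENNReal.ofNat_ne_top).ne'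
  obtain ⟨K, hKX, hK, hνK⟩ := (measurableSet_coreSet h𝒬).exists_isCompact_lt_add
    (measure_ne_top ν _) hε3
  obtain ⟨D, hDK, hD, hcap, hνD⟩ := exists_compact_capacity_zero h.delta_pos h.restriction h.kernel
    h.kernel_zero hν hK hε3
  have hνD' : ν Dᶜ ≤ ε / 3 + ε / 3 := by
    have hν1 : ν (coreSet 𝒬 \ K) ≤ ε / 3 :=
      (measure_sdiff_lt_of_lt_add hK.measurableSet.nullMeasurableSet hKX (measure_ne_top _ _)
        hνK).le
    calc ν Dᶜ ≤ ν ((coreSet 𝒬)ᶜ ∪ (coreSet 𝒬 \ K ∪ K \ D)) := measure_mono fun x hx => by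
          by_cases h1 : x ∈ coreSet 𝒬
          · by_cases h2 : x ∈ K
            · exact Or.inr (Or.inr ⟨h2, hx⟩)
            · exact Or.inr (Or.inl ⟨h1, h2⟩)
          · exact Or.inl h1
      _ ≤ ν (coreSet 𝒬)ᶜ + (ν (coreSet 𝒬 \ K) + ν (K \ D)) :=
          (measure_union_le _ _).trans (add_le_add le_rfl (measure_union_le _ _))
      _ ≤ ε / 3 + ε / 3 := by
          rw [hν0, zero_add]
          exact add_le_add hν1 hνD
  -- Almost surely the compact set `D` and the closed set `B` are disjoint, hence at positive
  -- distance, so cells of small diameter that meet `D` miss `B`.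
  have hzero : Tendsto (fun k => ∫⁻ ω, min 1 (approxCond P 𝒬 B k ν ω D) ∂P) atTop (𝓝 0) := by
    have := tendsto_lintegral_of_dominated_convergence (μ := P)
      (F := fun k ω => min 1 (approxCond P 𝒬 B k ν ω D)) (f := fun _ => 0) (fun _ => 1)
      (fun k => measurable_const.min (measurable_approxCond_apply h𝒬 hB k ν hD.measurableSet))
      (fun k => ae_of_all _ fun ω => min_le_left _ _) (by simp) ?_
    · simpa using this
    · filter_upwards [h.polar D hD (hDK.trans hKX) hcap] with ω hω
      obtain ⟨r, hr, hrD⟩ := Metric.exists_pos_forall_lt_edist hD (hB.isClosed ω)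
        (Set.disjoint_iff_inter_eq_empty.2 (by rw [inter_comm]; exact hω))
      refine tendsto_const_nhds.congr' ?_
      filter_upwards [eventually_approxCond_eq_zero (P := P) h𝒬 hD.measurableSet
        (by exact_mod_cast hr) fun x hx y hy => (hrD x hx y hy).le] with k hk
      rw [hk ν]
      simp
  filter_upwards [ENNReal.tendsto_nhds_zero.1 hzero (ε / 3) (pos_iff_ne_zero.2 hε3)] with k hk
  have e : ∀ ω, approxCond P 𝒬 B k ν ω univ =
      approxCond P 𝒬 B k ν ω D + approxCond P 𝒬 B k ν ω Dᶜ := fun ω =>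
    (measure_add_measure_compl hD.measurableSet).symm
  simp_rw [e]
  calc _ ≤ ∫⁻ ω, min 1 (approxCond P 𝒬 B k ν ω D) ∂P + ∫⁻ ω, approxCond P 𝒬 B k ν ω Dᶜ ∂P :=
        lintegral_min_one_le _ _
          (measurable_approxCond_apply h𝒬 hB k ν hD.measurableSet).aemeasurable
    _ ≤ ε / 3 + (ε / 3 + ε / 3) := by
        rw [lintegral_approxCond_apply h𝒬 hB k hν0 hD.measurableSet.compl]
        exact add_le_add hk hνD'
    _ = ε := by rw [← add_assoc, ENNReal.add_thirds]

theorem approxCond_add (h𝒬 : IsPartitionSequence 𝒬) (k : ℕ) (μ ν : Measure X) (ω : Ω) :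
    approxCond P 𝒬 B k (μ + ν) ω = approxCond P 𝒬 B k μ ω + approxCond P 𝒬 B k ν ω := by
  simp_rw [approxCond_eq_withDensity h𝒬]
  exact withDensity_add_measure _ _ _

variable {ν : Measure X} [IsLocallyFiniteMeasure ν] {N : Ω → Measure X}

/-- `∫ g d𝒞ₖ(ν) → ∫ g d𝒞(ν)` in probability. -/
theorem IsLimit.tendsto_min_lintegral [CompleteSpace X] [IsProbabilityMeasure P]
    (hN : IsLimit P φ 𝒬 B ν N) (h : Admissible P φ 𝒬 B δ F) (hNm : Measurable N)
    (hν0 : ν (coreSet 𝒬)ᶜ = 0) {g : X → ℝ≥0∞} (hg : Measurable g) (hfin : ∫⁻ x, g x ∂ν ≠ ∞) :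
    Tendsto (fun k => ∫⁻ ω, min 1 (ennDist (∫⁻ x, g x ∂approxCond P 𝒬 B k ν ω)
      (∫⁻ x, g x ∂N ω)) ∂P) atTop (𝓝 0) := by
  have h𝒬 := h.partition
  have hB := h.randomSet
  have hdec := isRegularDecomposition_parts φ ν
  have hg' : ∫⁻ x, g x ∂singularPart φ ν ≠ ∞ :=
    ((lintegral_mono' (singularPart_le φ ν) le_rfl).trans_lt hfin.lt_top).ne
  have hgR : ∫⁻ x, g x ∂regularPart φ ν ≠ ∞ :=
    ((lintegral_mono' (regularPart_le φ ν) le_rfl).trans_lt hfin.lt_top).ne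
  -- The measure `g dν_⊥` is finite and again singular to all measures of finite energy, and the
  -- total mass of its approximation is `∫ g d𝒞ₖ(ν_⊥)`.
  have hηac := withDensity_absolutelyContinuous (singularPart φ ν) g
  have hη : IsFiniteMeasure ((singularPart φ ν).withDensity g) := isFiniteMeasure_withDensity hg'
  have h1 := h.tendsto_singular (ν := (singularPart φ ν).withDensity g)
    (hηac ((singularPart_le φ ν).absolutelyContinuous hν0))
    fun μ hμ hμe => (hdec.singular μ hμ hμe).mono_ac hηac Measure.AbsolutelyContinuous.rfl
  have h2 := hN.tendsto_lintegral h𝒬 hB hNm hν0 hg hgR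
  have h3 := h1.add h2
  rw [add_zero] at h3
  refine tendsto_of_tendsto_of_tendsto_of_le_of_le tendsto_const_nhds h3 (fun _ => bot_le)
    fun k => ?_
  have e : ∀ ω, approxCond P 𝒬 B k ((singularPart φ ν).withDensity g) ω univ =
      ∫⁻ x, g x ∂approxCond P 𝒬 B k (singularPart φ ν) ω := by
    intro ω
    have hd := measurable_dens_right h𝒬 hB k ω
    rw [lintegral_approxCond h𝒬 hB _ _ _ hg, approxCond_eq_withDensity h𝒬,
      withDensity_apply _ MeasurableSet.univ, Measure.restrict_univ,
      lintegral_withDensity_eq_lintegral_mul _ hg hd]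
    exact lintegral_congr fun x => mul_comm _ _
  refine le_trans (lintegral_mono fun ω => ?_) (lintegral_min_one_le
    (fun ω => approxCond P 𝒬 B k ((singularPart φ ν).withDensity g) ω univ) _
    (measurable_approxCond_apply h𝒬 hB k _ MeasurableSet.univ).aemeasurable)
  refine min_le_min_left _ ?_
  rw [e ω]
  have e2 : ∫⁻ x, g x ∂approxCond P 𝒬 B k ν ω =
      ∫⁻ x, g x ∂approxCond P 𝒬 B k (singularPart φ ν) ω +
        ∫⁻ x, g x ∂approxCond P 𝒬 B k (regularPart φ ν) ω := by
    nth_rw 1 [hdec.eq_add]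
    rw [approxCond_add h𝒬, lintegral_add_measure, add_comm]
  rw [e2]
  have := ennDist_add_le (∫⁻ x, g x ∂approxCond P 𝒬 B k (singularPart φ ν) ω)
    (∫⁻ x, g x ∂approxCond P 𝒬 B k (regularPart φ ν) ω) 0 (∫⁻ x, g x ∂N ω)
  rwa [zero_add, ennDist_zero_right] at this

/-- Markov's inequality for `min 1 d` at the level `min 1 ε`. -/
theorem tendstoInMeasure_of_min {f : ℕ → Ω → ℝ} {g : Ω → ℝ} {d : ℕ → Ω → ℝ≥0∞}
    (hd : ∀ k, AEMeasurable (d k) P) (hfd : ∀ k, ∀ᵐ ω ∂P, edist (f k ω) (g ω) ≤ d k ω)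
    (h : Tendsto (fun k => ∫⁻ ω, min 1 (d k ω) ∂P) atTop (𝓝 0)) :
    TendstoInMeasure P f atTop g := by
  intro ε hε
  have hc0 : min 1 ε ≠ 0 := (lt_min one_pos hε).ne'
  have hct : min 1 ε ≠ ∞ := ((min_le_left _ _).trans_lt ENNReal.one_lt_top).ne
  have h1 := ENNReal.Tendsto.div_const h (Or.inr hc0)
  rw [ENNReal.zero_div] at h1
  refine tendsto_of_tendsto_of_tendsto_of_le_of_le tendsto_const_nhds h1 (fun _ => bot_le)
    fun k => ?_
  refine le_trans (measure_mono_ae ?_)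
    (meas_ge_le_lintegral_div (aemeasurable_const.min (hd k)) hc0 hct)
  filter_upwards [hfd k] with ω hω hle
  exact min_le_min_left _ (le_trans hle hω)

theorem edist_integral_le {μ η : Measure X} {f : X → ℝ} (hμ : Integrable f μ)
    (hη : Integrable f η) :
    edist (∫ x, f x ∂μ) (∫ x, f x ∂η) ≤
      ennDist (∫⁻ x, ENNReal.ofReal (f x) ∂μ) (∫⁻ x, ENNReal.ofReal (f x) ∂η) +
        ennDist (∫⁻ x, ENNReal.ofReal (-f x) ∂μ) (∫⁻ x, ENNReal.ofReal (-f x) ∂η) := by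
  have hfin : ∀ {μ : Measure X}, Integrable f μ → ∫⁻ x, ENNReal.ofReal (f x) ∂μ ≠ ∞ ∧
      ∫⁻ x, ENNReal.ofReal (-f x) ∂μ ≠ ∞ := fun h =>
    ⟨h.lintegral_lt_top.ne, h.neg.lintegral_lt_top.ne⟩
  rw [← enorm_toReal_sub (hfin hμ).1 (hfin hη).1, ← enorm_toReal_sub (hfin hμ).2 (hfin hη).2,
    integral_eq_lintegral_pos_part_sub_lintegral_neg_part hμ,
    integral_eq_lintegral_pos_part_sub_lintegral_neg_part hη, edist_eq_enorm_sub]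
  refine le_trans (le_of_eq ?_) (enorm_sub_le)
  congr 1
  ring

theorem lintegral_enorm_lt_top {μ : Measure X} {f : X → ℝ} (hf : Measurable f) :
    Integrable f μ ↔ ∫⁻ x, ‖f x‖ₑ ∂μ < ∞ :=
  ⟨fun h => h.2, fun h => ⟨hf.aestronglyMeasurable, h⟩⟩

/-- `∫ f d𝒞ₖ(ν) → ∫ f d𝒞(ν)` in probability. -/
theorem IsLimit.tendstoInMeasure [CompleteSpace X] [IsProbabilityMeasure P]
    (hN : IsLimit P φ 𝒬 B ν N) (h : Admissible P φ 𝒬 B δ F) (hNm : Measurable N)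
    (hν0 : ν (coreSet 𝒬)ᶜ = 0) {f : X → ℝ} (hf : Measurable f) (hfi : Integrable f ν) :
    TendstoInMeasure P (fun k ω => ∫ x, f x ∂approxCond P 𝒬 B k ν ω) atTop
      (fun ω => ∫ x, f x ∂N ω) := by
  have h𝒬 := h.partition
  have hB := h.randomSet
  have hp : Measurable fun x => ENNReal.ofReal (f x) := hf.ennreal_ofReal
  have hn : Measurable fun x => ENNReal.ofReal (-f x) := hf.neg.ennreal_ofReal
  have he : Measurable fun x => ‖f x‖ₑ := hf.enorm
  have hNi : ∀ᵐ ω ∂P, Integrable f (N ω) := by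
    simp_rw [lintegral_enorm_lt_top hf]
    refine ae_lt_top (measurable_lintegral_random hNm he) ?_
    rw [lintegral_lintegral_of_bind_eq hNm (hN.bind_eq h𝒬 hB hNm hν0) he]
    exact ((lintegral_mono' (regularPart_le φ ν) le_rfl).trans_lt hfi.2).ne
  have hCi : ∀ k, ∀ᵐ ω ∂P, Integrable f (approxCond P 𝒬 B k ν ω) := by
    intro k
    simp_rw [lintegral_enorm_lt_top hf]
    refine ae_lt_top (measurable_lintegral_approxCond h𝒬 hB k ν he) ?_
    rw [lintegral_lintegral_approxCond h𝒬 hB k hν0 he]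
    exact hfi.2.ne
  have hm : ∀ {g : X → ℝ≥0∞}, Measurable g → ∀ k, Measurable fun ω =>
      ennDist (∫⁻ x, g x ∂approxCond P 𝒬 B k ν ω) (∫⁻ x, g x ∂N ω) := fun hg k =>
    measurable_ennDist (measurable_lintegral_approxCond h𝒬 hB k ν hg)
      (measurable_lintegral_random hNm hg)
  refine tendstoInMeasure_of_min (fun k => ((hm hp k).add (hm hn k)).aemeasurable) (fun k => ?_) ?_
  · filter_upwards [hNi, hCi k] with ω h1 h2
    exact edist_integral_le h2 h1
  · have h1 := hN.tendsto_min_lintegral h hNm hν0 hp hfi.lintegral_lt_top.ne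
    have h2 := hN.tendsto_min_lintegral h hNm hν0 hn hfi.neg.lintegral_lt_top.ne
    have h3 := h1.add h2
    rw [add_zero] at h3
    refine tendsto_of_tendsto_of_tendsto_of_le_of_le tendsto_const_nhds h3 (fun _ => bot_le)
      fun k => ?_
    have hmk : Measurable fun ω => min 1 (ennDist
        (∫⁻ x, ENNReal.ofReal (f x) ∂approxCond P 𝒬 B k ν ω)
        (∫⁻ x, ENNReal.ofReal (f x) ∂N ω)) := measurable_const.min (hm hp k)
    rw [← lintegral_add_left hmk]
    exact lintegral_mono fun ω => min_one_add_le _ _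

end SingularLimit

/-! ### Weak convergence from countably many sets -/

section WeakConvergence

variable {X : Type*} [MetricSpace X] [MeasurableSpace X] [SecondCountableTopology X] [BorelSpace X]

/-- The lower half of the portmanteau theorem for finite measures: adding `‖g‖` makes `g`
nonnegative, and convergence of the total masses removes the shift again. -/
theorem eventually_lt_integral {μs : ℕ → Measure X} {μ : Measure X}
    [∀ i, IsFiniteMeasure (μs i)] [IsFiniteMeasure μ]
    (hopen : ∀ G, IsOpen G → μ G ≤ liminf (fun i => μs i G) atTop)
    (huniv : Tendsto (fun i => μs i univ) atTop (𝓝 (μ univ))) (g : X →ᵇ ℝ) {a : ℝ}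
    (ha : a < ∫ x, g x ∂μ) : ∀ᶠ i in atTop, a < ∫ x, g x ∂μs i := by
  have hg0 : ∀ x, 0 ≤ g x + ‖g‖ := fun x => by
    have := g.norm_coe_le_norm x
    rw [Real.norm_eq_abs] at this
    linarith [neg_abs_le (g x)]
  have hint : ∀ (η : Measure X) [IsFiniteMeasure η],
      (∫⁻ x, ENNReal.ofReal (g x + ‖g‖) ∂η).toReal = ∫ x, g x ∂η + ‖g‖ * η.real univ := by
    intro η _
    rw [← integral_eq_lintegral_of_nonneg_ae (ae_of_all _ hg0)
      (g.continuous.add continuous_const).aestronglyMeasurable,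
      integral_add (g.integrable η) (integrable_const _)]
    simp [mul_comm]
  have hfin : ∀ (η : Measure X) [IsFiniteMeasure η],
      ∫⁻ x, ENNReal.ofReal (g x + ‖g‖) ∂η ≠ ∞ := fun η _ =>
    ((g.integrable η).add (integrable_const ‖g‖)).lintegral_lt_top.ne
  have h1 := lintegral_le_liminf_lintegral_of_forall_isOpen_measure_le_liminf_measure
    (g.continuous.add continuous_const) hg0 hopen
  -- The midpoint leaves a gap `b - a` to absorb the error in the total masses.
  set b := (a + ∫ x, g x ∂μ) / 2 with hb
  have h2 : 0 ≤ b + ‖g‖ * μ.real univ ∧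
      ENNReal.ofReal (b + ‖g‖ * μ.real univ) < ∫⁻ x, ENNReal.ofReal (g x + ‖g‖) ∂μ ∨
      b + ‖g‖ * μ.real univ < 0 := by
    rcases lt_or_ge (b + ‖g‖ * μ.real univ) 0 with h | h
    · exact Or.inr h
    · refine Or.inl ⟨h, ?_⟩
      rw [ENNReal.ofReal_lt_iff_lt_toReal h (hfin μ), hint]
      linarith
  have h3 : ∀ᶠ i in atTop, b + ‖g‖ * μ.real univ < ∫ x, g x ∂μs i + ‖g‖ * (μs i).real univ := by
    rcases h2 with ⟨h0, h2⟩ | h2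
    · filter_upwards [eventually_lt_of_lt_liminf (h2.trans_le h1)] with i hi
      rw [← hint]
      exact (ENNReal.ofReal_lt_iff_lt_toReal h0 (hfin _)).1 hi
    · refine Eventually.of_forall fun i => h2.trans_le ?_
      rw [← hint]
      exact ENNReal.toReal_nonneg
  have h4 : Tendsto (fun i => ‖g‖ * (μs i).real univ) atTop (𝓝 (‖g‖ * μ.real univ)) :=
    ((ENNReal.tendsto_toReal (measure_ne_top μ univ)).comp huniv).const_mul _
  have h5 : ∀ᶠ i in atTop, ‖g‖ * (μs i).real univ < ‖g‖ * μ.real univ + (b - a) :=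
    h4.eventually (gt_mem_nhds (by linarith))
  filter_upwards [h3, h5] with i h6 h7
  linarith

/-- Convergence on the algebra generated by a countable base implies weak convergence. -/
theorem weaklyConverges_of_forall_mem_algebra {μs : ℕ → Measure X} {μ : Measure X}
    (hμs : ∀ i, IsFiniteMeasure (μs i)) (hμ : IsFiniteMeasure μ)
    (h : ∀ S ∈ generateSetAlgebra (TopologicalSpace.countableBasis X),
      Tendsto (fun i => μs i S) atTop (𝓝 (μ S))) : WeaklyConverges μs μ := by
  have halg : IsSetAlgebra (generateSetAlgebra (TopologicalSpace.countableBasis X)) :=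
    isSetAlgebra_generateSetAlgebra
  -- An open set is an increasing union of finite unions of basic sets, which belong to the algebra.
  have hopen : ∀ G, IsOpen G → μ G ≤ liminf (fun i => μs i G) atTop := by
    intro G hG
    obtain ⟨T, hT, rfl⟩ := (TopologicalSpace.isBasis_countableBasis X).open_eq_sUnion hG
    rcases T.eq_empty_or_nonempty with rfl | hne
    · simp
    obtain ⟨S, rfl⟩ := ((TopologicalSpace.countable_countableBasis X).mono hT).exists_eq_range hne
    have hmem : ∀ n, accumulate S n ∈ generateSetAlgebra (TopologicalSpace.countableBasis X) := by
      intro n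
      induction n with
      | zero =>
        rw [accumulate_zero_nat]
        exact self_subset_generateSetAlgebra (hT (mem_range_self 0))
      | succ n ih =>
        rw [accumulate_succ]
        exact halg.union_mem ih (self_subset_generateSetAlgebra (hT (mem_range_self _)))
    rw [sUnion_range, measure_iUnion_eq_iSup_accumulate]
    refine iSup_le fun n => ?_
    rw [← (h _ (hmem n)).liminf_eq]
    refine liminf_le_liminf (Eventually.of_forall fun i => measure_mono ?_)
    exact iUnion₂_subset fun y _ => subset_iUnion S y
  have huniv := h univ halg.univ_mem
  refine ⟨hμs, hμ, fun g => tendsto_order.2 ⟨fun a ha =>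
    eventually_lt_integral hopen huniv g ha, fun a ha => ?_⟩⟩
  have := eventually_lt_integral hopen huniv (-g) (a := -a) (by
    simp only [BoundedContinuousFunction.coe_neg, Pi.neg_apply, integral_neg]
    linarith)
  filter_upwards [this] with i hi
  simp only [BoundedContinuousFunction.coe_neg, Pi.neg_apply, integral_neg] at hi
  linarith

end WeakConvergence

/-! ### Integrals with respect to a random measure of given mean -/

section Mean

variable {Z : Type*} [MeasurableSpace Z] {Ω : Type*} [MeasurableSpace Ω] {P : Measure Ω}

/-- Integrals with respect to a random measure of mean `ρ`. -/
theorem integral_of_mean {N : Ω → Measure Z} {ρ : Measure Z}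
    (hm : ∀ g : Z → ℝ≥0∞, Measurable g → AEMeasurable (fun ω => ∫⁻ x, g x ∂N ω) P)
    (hE : ∀ g : Z → ℝ≥0∞, Measurable g → ∫⁻ ω, ∫⁻ x, g x ∂N ω ∂P = ∫⁻ x, g x ∂ρ)
    {f : Z → ℝ} (hf : Measurable f) (hfi : Integrable f ρ) :
    (∀ᵐ ω ∂P, Integrable f (N ω)) ∧ Integrable (fun ω => ∫ x, f x ∂N ω) P ∧
      ∫ ω, ∫ x, f x ∂N ω ∂P = ∫ x, f x ∂ρ := by
  have hp : Measurable fun x => ENNReal.ofReal (f x) := hf.ennreal_ofReal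
  have hn : Measurable fun x => ENNReal.ofReal (-f x) := hf.neg.ennreal_ofReal
  have h1 : ∀ᵐ ω ∂P, Integrable f (N ω) := by
    filter_upwards [ae_lt_top' (hm _ hf.enorm) (by rw [hE _ hf.enorm]; exact hfi.2.ne)] with ω hω
    exact ⟨hf.aestronglyMeasurable, hω⟩
  have hp1 : ∫⁻ ω, ∫⁻ x, ENNReal.ofReal (f x) ∂N ω ∂P ≠ ∞ := by
    rw [hE _ hp]
    exact hfi.lintegral_lt_top.ne
  have hn1 : ∫⁻ ω, ∫⁻ x, ENNReal.ofReal (-f x) ∂N ω ∂P ≠ ∞ := by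
    rw [hE _ hn]
    exact hfi.neg.lintegral_lt_top.ne
  have h2 : (fun ω => ∫ x, f x ∂N ω) =ᵐ[P] fun ω => (∫⁻ x, ENNReal.ofReal (f x) ∂N ω).toReal -
      (∫⁻ x, ENNReal.ofReal (-f x) ∂N ω).toReal := by
    filter_upwards [h1] with ω hω
    exact integral_eq_lintegral_pos_part_sub_lintegral_neg_part hω
  have hip := integrable_toReal_of_lintegral_ne_top (hm _ hp) hp1
  have hin := integrable_toReal_of_lintegral_ne_top (hm _ hn) hn1
  refine ⟨h1, (hip.sub hin).congr h2.symm, ?_⟩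
  rw [integral_congr_ae h2, integral_sub hip hin,
    integral_toReal (hm _ hp) (ae_lt_top' (hm _ hp) hp1),
    integral_toReal (hm _ hn) (ae_lt_top' (hm _ hn) hn1), hE _ hp, hE _ hn,
    integral_eq_lintegral_pos_part_sub_lintegral_neg_part hfi]

end Mean

/-! ### The conditional measures and their defining properties -/

section System

variable {X : Type*} [MetricSpace X] [MeasurableSpace X] [SecondCountableTopology X] [BorelSpace X]
  {Ω : Type*} [MeasurableSpace Ω] {P : Measure Ω} {φ : ℝ≥0 → ℝ≥0∞} {𝒬 : ℕ → Set (Set X)}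
  {B : Ω → Set X} {δ : ℝ≥0} {F : X → X → ℝ≥0∞}

/-- A class of locally finite measures, like the finite ones, that is determined by the finiteness
on countably many sets. -/
structure IsFinitenessClass (G : Measure X → Prop) : Prop where
  locallyFinite : ∀ {η}, G η → IsLocallyFiniteMeasure η
  mono : ∀ {η η'}, η' ≤ η → G η → G η'
  exists_cover : ∀ {η}, G η → ∃ U : ℕ → Set X, (∀ i, MeasurableSet (U i)) ∧
    (∀ i, η (U i) < ∞) ∧ ∀ η' : Measure X, (∀ i, η' (U i) < ∞) → G η'

theorem isFinitenessClass_finite : IsFinitenessClass (X := X) fun η => IsFiniteMeasure η where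
  locallyFinite _ := inferInstance
  mono hle _ := isFiniteMeasure_of_le _ hle
  exists_cover _ := ⟨fun _ => univ, fun _ => MeasurableSet.univ, fun _ => measure_lt_top _ _,
    fun _ h => ⟨h 0⟩⟩

theorem isFinitenessClass_locallyFinite :
    IsFinitenessClass (X := X) fun η => IsLocallyFiniteMeasure η where
  locallyFinite h := h
  mono {η _} hle _ := ⟨fun x =>
    let ⟨U, hU, h⟩ := η.finiteAt_nhds x
    ⟨U, hU, (hle U).trans_lt h⟩⟩
  exists_cover {η} _ := by
    let S := η.finiteSpanningSetsInOpen'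
    refine ⟨S.set, fun i => (S.set_mem i).measurableSet, S.finite, fun η' h => ⟨fun x => ?_⟩⟩
    obtain ⟨i, hi⟩ := mem_iUnion.1 (S.spanning ▸ mem_univ x)
    exact ⟨S.set i, (S.set_mem i).mem_nhds hi, h i⟩

/-- `N` is the conditional measure of `ν`, where `ν` and `N` belong to the class `G`. -/
structure IsCond (P : Measure Ω) (φ : ℝ≥0 → ℝ≥0∞) (𝒬 : ℕ → Set (Set X)) (B : Ω → Set X)
    (G : Measure X → Prop) (ν : Measure X) (N : Ω → Measure X) : Prop where
  good : G ν
  null : ν (coreSet 𝒬)ᶜ = 0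
  measurable : Measurable N
  good_random : ∀ ω, G (N ω)
  isLimit : IsLimit P φ 𝒬 B ν N

variable {G : Measure X → Prop} {ν : Measure X} {N : Ω → Measure X}

theorem Admissible.exists_isCond [CompleteSpace X] [IsProbabilityMeasure P]
    (h : Admissible P φ 𝒬 B δ F) (hG : IsFinitenessClass G) (hν : G ν)
    (hν0 : ν (coreSet 𝒬)ᶜ = 0) : ∃ N : Ω → Measure X, IsCond P φ 𝒬 B G ν N := by
  have := hG.locallyFinite hν
  obtain ⟨U, hUm, hU, hUG⟩ := hG.exists_cover hν
  obtain ⟨N, hNm, hN, hlim⟩ := h.exists_isLimit hν0 hUm hU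
  exact ⟨N, hν, hν0, hNm, fun ω => hUG _ (hN ω), hlim⟩

theorem isLimit_zero (P : Measure Ω) (φ : ℝ≥0 → ℝ≥0∞) (B : Ω → Set X)
    (hν : regularPart φ ν = 0) : IsLimit P φ 𝒬 B ν fun _ => 0 := by
  intro A hA _
  rw [hν]
  simp [approxCond, ennDist]

theorem IsCond.bind_eq [IsProbabilityMeasure P] (hN : IsCond P φ 𝒬 B G ν N)
    (h : Admissible P φ 𝒬 B δ F) (hG : IsFinitenessClass G) : P.bind N = regularPart φ ν := by
  have := hG.locallyFinite hN.good
  exact hN.isLimit.bind_eq h.partition h.randomSet hN.measurable hN.null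

theorem IsCond.ae_lt_top [IsProbabilityMeasure P] (hN : IsCond P φ 𝒬 B G ν N)
    (h : Admissible P φ 𝒬 B δ F) (hG : IsFinitenessClass G) {A : Set X} (hA : MeasurableSet A)
    (hνA : ν A < ∞) : ∀ᵐ ω ∂P, N ω A < ∞ := by
  have := hG.locallyFinite hN.good
  exact hN.isLimit.ae_measure_lt_top h.partition h.randomSet hN.measurable hN.null hA
    ((regularPart_le φ ν A).trans_lt hνA)

theorem IsCond.withDensity_ae_eq [CompleteSpace X] [IsProbabilityMeasure P]
    (hN : IsCond P φ 𝒬 B G ν N) (h : Admissible P φ 𝒬 B δ F) (hG : IsFinitenessClass G)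
    {f : X → ℝ≥0∞} (hf : Measurable f) {N' : Ω → Measure X}
    (hN' : IsCond P φ 𝒬 B G (ν.withDensity f) N') : ∀ᵐ ω ∂P, N' ω = (N ω).withDensity f := by
  have := hG.locallyFinite hN.good
  have := hG.locallyFinite hN'.good
  exact hN.isLimit.withDensity_ae_eq h.partition h.randomSet hN.measurable hN.null hf hN'.isLimit
    hN'.measurable

theorem IsCond.exists_withDensity [CompleteSpace X] [IsProbabilityMeasure P]
    (hN : IsCond P φ 𝒬 B G ν N) (h : Admissible P φ 𝒬 B δ F) (hG : IsFinitenessClass G)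
    {f : X → ℝ≥0∞} (hf : Measurable f) (hfG : G (ν.withDensity f)) :
    ∃ N' : Ω → Measure X, IsCond P φ 𝒬 B G (ν.withDensity f) N' ∧
      ∀ᵐ ω ∂P, N' ω = (N ω).withDensity f := by
  obtain ⟨N', hN'⟩ := h.exists_isCond hG hfG (withDensity_absolutelyContinuous ν f hN.null)
  exact ⟨N', hN', hN.withDensity_ae_eq h hG hf hN'⟩

/-- The summands have densities `rᵢ` with `∑ rᵢ = 1` `ν`-almost everywhere, so `𝒞(νⁱ) = rᵢ d𝒞(ν)`.
Since `E 𝒞(ν) = ν_R`, the identity `∑ rᵢ = 1` also holds almost everywhere for `𝒞(ν)`. -/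
theorem IsCond.exists_sum [CompleteSpace X] [IsProbabilityMeasure P]
    (hN : IsCond P φ 𝒬 B G ν N) (h : Admissible P φ 𝒬 B δ F) (hG : IsFinitenessClass G)
    {νs : ℕ → Measure X} (hνs : ∀ i, IsLocallyFiniteMeasure (νs i)) (hsum : ν = Measure.sum νs) :
    ∃ Ns : ℕ → Ω → Measure X, (∀ i, IsCond P φ 𝒬 B G (νs i) (Ns i)) ∧
      ∀ᵐ ω ∂P, N ω = Measure.sum fun i => Ns i ω := by
  have := hG.locallyFinite hN.good
  have hle : ∀ i, νs i ≤ ν := fun i => hsum ▸ Measure.le_sum νs i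
  let r : ℕ → X → ℝ≥0∞ := fun i => (νs i).rnDeriv ν
  have hr : ∀ i, ν.withDensity (r i) = νs i := fun i =>
    Measure.withDensity_rnDeriv_eq _ _ (Measure.absolutelyContinuous_of_le (hle i))
  have hrm : ∀ i, Measurable (r i) := fun i => Measure.measurable_rnDeriv _ _
  have hone : (fun x => ∑' i, r i x) =ᵐ[ν] 1 := by
    rw [← withDensity_eq_iff_of_sigmaFinite (Measurable.tsum hrm).aemeasurable
      measurable_one.aemeasurable, withDensity_one]
    have : (fun x => ∑' i, r i x) = ∑' i, r i := by
      ext x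
      rw [ENNReal.tsum_apply]
    rw [this, withDensity_tsum hrm]
    simp_rw [hr]
    exact hsum.symm
  choose Ns hNs hNsr using fun i => hN.exists_withDensity h hG (hrm i)
    (by rw [hr]; exact hG.mono (hle i) hN.good)
  refine ⟨Ns, fun i => by rw [← hr i]; exact hNs i, ?_⟩
  have hone' : ∀ᵐ x ∂regularPart φ ν, ∑' i, r i x = 1 :=
    (Measure.absolutelyContinuous_of_le (regularPart_le φ ν)).ae_le hone
  filter_upwards [ae_all_iff.2 hNsr, ae_ae_of_bind_eq hN.measurable (hN.bind_eq h hG) hone']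
    with ω h1 h2
  simp_rw [h1]
  have : ∑' i, r i = fun x => ∑' i, r i x := by
    ext x
    rw [ENNReal.tsum_apply]
  rw [← withDensity_tsum hrm, this, withDensity_congr_ae (g := 1) h2, withDensity_one]

/-- Concentration on `supp ν` is inherited from the mean `ν_R`. A point off `B` has a basic
neighbourhood `V` of finite measure at positive distance from `B`. There `𝒞ₖ(V)` eventually
vanishes, and Fatou's lemma for `|𝒞ₖ(V) - N(V)|` gives `N(V) = 0`. A countable base keeps the
exceptional set null. -/
theorem IsCond.support_subset [CompleteSpace X] [IsProbabilityMeasure P]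
    (hN : IsCond P φ 𝒬 B G ν N) (h : Admissible P φ 𝒬 B δ F) (hG : IsFinitenessClass G) :
    ∀ᵐ ω ∂P, (N ω).support ⊆ ν.support ∩ B ω := by
  have := hG.locallyFinite hN.good
  have h𝒬 := h.partition
  have hB := h.randomSet
  have h1 : ∀ᵐ ω ∂P, ∀ᵐ x ∂N ω, x ∈ ν.support := by
    refine ae_ae_of_bind_eq hN.measurable (hN.bind_eq h hG) ?_
    exact (Measure.absolutelyContinuous_of_le (regularPart_le φ ν)).ae_le Measure.support_mem_ae
  have h2 : ∀ᵐ ω ∂P, ∀ V ∈ TopologicalSpace.countableBasis X, ν V < ∞ →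
      (∀ᶠ k in atTop, ∀ η : Measure X, approxCond P 𝒬 B k η ω V = 0) → N ω V = 0 := by
    refine (ae_ball_iff (TopologicalSpace.countable_countableBasis X)).2 fun V hV => ?_
    by_cases hνV : ν V < ∞
    swap
    · exact ae_of_all _ fun ω hω => absurd hω hνV
    have hVm : MeasurableSet V := (TopologicalSpace.isOpen_of_mem_countableBasis hV).measurableSet
    have hlim := hN.isLimit V hVm ((regularPart_le φ ν V).trans_lt hνV)
    have hm : ∀ k, Measurable fun ω => ennDist (approxCond P 𝒬 B k (regularPart φ ν) ω V)
        (N ω V) := fun k => measurable_ennDist (measurable_approxCond_apply h𝒬 hB k _ hVm)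
      ((Measure.measurable_coe hVm).comp hN.measurable)
    have h0 := lintegral_liminf_le (μ := P) (u := atTop) hm
    have hml : Measurable fun ω => liminf (fun k =>
        ennDist (approxCond P 𝒬 B k (regularPart φ ν) ω V) (N ω V)) atTop := Measurable.liminf hm
    rw [hlim.liminf_eq, nonpos_iff_eq_zero, lintegral_eq_zero_iff hml] at h0
    filter_upwards [h0] with ω hω _ hev
    rw [Pi.zero_apply] at hω
    rw [← hω]
    have : (fun k => ennDist (approxCond P 𝒬 B k (regularPart φ ν) ω V) (N ω V)) =ᶠ[atTop]
        fun _ => N ω V := by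
      filter_upwards [hev] with k hk
      rw [hk, ennDist_comm, ennDist_zero_right]
    rw [liminf_congr this, liminf_const]
  filter_upwards [h1, h2] with ω hω1 hω2
  refine subset_inter (Measure.support_subset_of_isClosed Measure.isClosed_support hω1) ?_
  intro x hx
  by_contra hxB
  obtain ⟨r, hr, hrB⟩ := Metric.exists_pos_forall_lt_edist (isCompact_singleton (x := x))
    (hB.isClosed ω) (Set.disjoint_singleton_left.2 hxB)
  have hr2 : (0 : ℝ≥0∞) < r / 2 := ENNReal.half_pos (by exact_mod_cast hr.ne')
  obtain ⟨W, hW, hνW⟩ := ν.finiteAt_nhds x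
  obtain ⟨V, hV, hxV, hVsub⟩ := (TopologicalSpace.isBasis_countableBasis X).mem_nhds_iff.1
    (inter_mem hW (Metric.eball_mem_nhds x hr2))
  have hVo := TopologicalSpace.isOpen_of_mem_countableBasis hV
  have h0 := hω2 V hV ((measure_mono (hVsub.trans inter_subset_left)).trans_lt hνW)
    (eventually_approxCond_eq_zero h𝒬 hVo.measurableSet hr2 fun y hy z hz => by
      have h3 := (hrB x rfl z hz).le
      have h4 : edist y x < r / 2 := (hVsub hy).2
      by_contra hcon
      push Not at hcon
      have h5 : edist x z < r / 2 + r / 2 := (edist_triangle x y z).trans_lt (by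
        rw [edist_comm x y]
        exact ENNReal.add_lt_add h4 hcon)
      rw [ENNReal.add_halves] at h5
      exact absurd h5 (not_lt.2 h3))
  exact absurd h0 ((Measure.mem_support_iff_forall x).1 hx V (hVo.mem_nhds hxV)).ne'

theorem IsCond.ae_good_approxCond [IsProbabilityMeasure P] (hN : IsCond P φ 𝒬 B G ν N)
    (h : Admissible P φ 𝒬 B δ F) (hG : IsFinitenessClass G) :
    ∀ᵐ ω ∂P, ∀ k, G (approxCond P 𝒬 B k ν ω) := by
  have := hG.locallyFinite hN.good
  obtain ⟨U, hUm, hU, hUG⟩ := hG.exists_cover hN.good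
  filter_upwards [ae_all_iff.2 fun i => ae_approxCond_lt_top h.partition h.randomSet hN.null
    (hUm i) (hU i).ne] with ω hω k
  exact hUG _ fun i => hω i k

theorem IsCond.commonProperties [CompleteSpace X] [IsProbabilityMeasure P]
    (hN : IsCond P φ 𝒬 B G ν N) (h : Admissible P φ 𝒬 B δ F) (hG : IsFinitenessClass G) :
    CommonProperties P φ 𝒬 B (IsCond P φ 𝒬 B G) ν N := by
  have := hG.locallyFinite hN.good
  have h𝒬 := h.partition
  have hB := h.randomSet
  have hNm := hN.measurable
  have hbind := hN.bind_eq h hG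
  have hle := regularPart_le φ ν
  have hmean : ∀ {f : X → ℝ}, Measurable f → Integrable f ν → _ := fun {f} hf hfi =>
    integral_of_mean (N := N) (ρ := regularPart φ ν)
      (fun g hg => (measurable_lintegral_random hNm hg).aemeasurable)
      (fun g hg => lintegral_lintegral_of_bind_eq hNm hbind hg) hf (hfi.mono_measure hle)
  have hind : ∀ (η : Measure X) {A : Set X}, MeasurableSet A →
      ∫ x, A.indicator (fun _ => (1 : ℝ)) x ∂η = η.real A := fun η A hA =>
    integral_indicator_one hA
  have hfinA : ∀ {A : Set X}, MeasurableSet A → ν A < ∞ → ∀ᵐ ω ∂P, N ω A < ∞ := fun hA hνA =>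
    hN.ae_lt_top h hG hA hνA
  have hEA : ∀ {A : Set X}, MeasurableSet A → ∫⁻ ω, N ω A ∂P = regularPart φ ν A := fun hA => by
    rw [← Measure.bind_apply hA hNm.aemeasurable, hbind]
  have hmA : ∀ {A : Set X}, MeasurableSet A → Measurable fun ω => N ω A := fun hA =>
    (Measure.measurable_coe hA).comp hNm
  -- The limit `S(f)` is taken to be `∫ f dN` itself.
  refine ⟨⟨fun f ω => ∫ x, f x ∂N ω, ?_, ?_, ?_, ?_⟩, ?_, ?_, ?_, ?_, hN.support_subset h hG⟩
  · intro f hf hfi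
    obtain ⟨-, h2, h3⟩ := hmean hf hfi
    exact ⟨hN.isLimit.tendstoInMeasure h hNm hN.null hf hfi, h2, h2, hfi.mono_measure hle, rfl, h3⟩
  · intro f hf
    refine ae_all_iff.2 fun n => ?_
    filter_upwards [(hmean (hf n).1 (hf n).2).1] with ω hω
    exact ⟨hω, rfl⟩
  · intro A hA
    refine ae_all_iff.2 fun n => ?_
    filter_upwards [hfinA (hA n).1 (hA n).2] with ω hω
    exact ⟨hω, hind _ (hA n).1⟩
  · intro A hA hνA
    refine ⟨hEA hA, ?_, hle A⟩
    simp_rw [hind _ hA, Measure.real]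
    rw [integral_toReal (hmA hA).aemeasurable (hfinA hA hνA), hEA hA]
  · intro A hA hνA
    have hRA := (hle A).trans_lt hνA
    refine (hN.isLimit A hA hRA).congr fun k => ?_
    rw [eLpNorm_one_eq_lintegral_enorm]
    refine lintegral_congr_ae ?_
    filter_upwards [hfinA hA hνA, ae_approxCond_lt_top h𝒬 hB (ν := regularPart φ ν)
      (regularPart_coreSet hN.null) hA hRA.ne] with ω h1 h2
    exact (enorm_toReal_sub (h2 k).ne h1.ne).symm
  -- The regular part of `ν_⊥` is 0, so the zero measure is its conditional measure.
  · exact ⟨fun _ => 0, ⟨hG.mono (singularPart_le φ ν) hN.good,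
      (singularPart_le φ ν).absolutelyContinuous hN.null, measurable_const,
      fun _ => hG.mono (Measure.zero_le ν) hN.good,
      isLimit_zero P φ B (regularPart_singularPart φ ν)⟩, ae_of_all _ fun _ => rfl⟩
  · refine ⟨N, ⟨hG.mono hle hN.good, regularPart_coreSet hN.null, hNm, hN.good_random, ?_⟩,
      ae_of_all _ fun _ => rfl⟩
    have := hN.isLimit
    rw [IsLimit, regularPart_regularPart]
    exact this
  · intro νs hνs hsum
    exact hN.exists_sum h hG hνs hsum

/-- Subsequential weak convergence in probability. -/
theorem IsCond.weaklySubseqInProb [CompleteSpace X] [IsProbabilityMeasure P]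
    (hN : IsCond P φ 𝒬 B (fun η => IsFiniteMeasure η) ν N) (h : Admissible P φ 𝒬 B δ F) :
    WeaklySubseqInProb P (fun k ω => approxCond P 𝒬 B k ν ω) N := by
  intro α hα
  have hG := isFinitenessClass_finite (X := X)
  have := hN.good
  have h𝒬 := h.partition
  have hB := h.randomSet
  let 𝒢 := generateSetAlgebra (TopologicalSpace.countableBasis X)
  have h𝒢c : 𝒢.Countable :=
    countable_generateSetAlgebra (TopologicalSpace.countable_countableBasis X)
  have h𝒢m : ∀ S ∈ 𝒢, MeasurableSet S := fun S hS => by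
    have hg : ‹MeasurableSpace X› = MeasurableSpace.generateFrom 𝒢 := by
      rw [generateFrom_generateSetAlgebra_eq, BorelSpace.measurable_eq (α := X),
        (TopologicalSpace.isBasis_countableBasis X).borel_eq_generateFrom]
    rw [hg]
    exact MeasurableSpace.measurableSet_generateFrom hS
  obtain ⟨A, hA⟩ := h𝒢c.exists_eq_range ⟨univ, isSetAlgebra_generateSetAlgebra.univ_mem⟩
  have hAm : ∀ i, MeasurableSet (A i) := fun i => h𝒢m _ (hA ▸ mem_range_self i)
  obtain ⟨ε, hε0, hε⟩ := ENNReal.exists_pos_sum_of_countable one_ne_zero ℕ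
  let e : ℕ → ℕ → Ω → ℝ≥0∞ := fun k i ω => ennDist (approxCond P 𝒬 B k ν ω (A i)) (N ω (A i))
  have he : ∀ k i, Measurable (e k i) := fun k i =>
    measurable_ennDist (measurable_approxCond_apply h𝒬 hB k ν (hAm i))
      ((Measure.measurable_coe (hAm i)).comp hN.measurable)
  have hterm : ∀ k i, Measurable fun ω => ε i * min 1 (e k i ω) := fun k i =>
    (measurable_const.min (he k i)).const_mul _
  -- A weighted sum that measures convergence on all sets of the countable algebra at once. It tends
  -- to 0 in mean, so a subsequence tends to 0 almost surely, with one exceptional set for all these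
  -- sets.
  let d : ℕ → Ω → ℝ≥0∞ := fun k ω => ∑' i, ε i * min 1 (e k i ω)
  have hdm : ∀ k, Measurable (d k) := fun k => Measurable.tsum (hterm k)
  have hd1 : ∀ k ω, d k ω < ∞ := fun k ω =>
    lt_of_le_of_lt (ENNReal.tsum_le_tsum fun i => by
      calc (ε i : ℝ≥0∞) * min 1 (e k i ω) ≤ ε i * 1 := by gcongr; exact min_le_left _ _
        _ = ε i := mul_one _) (hε.trans ENNReal.one_lt_top)
  have hlim : Tendsto (fun k => ∫⁻ ω, d k ω ∂P) atTop (𝓝 0) := by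
    have e1 : ∀ k, ∫⁻ ω, d k ω ∂P = ∑' i, ε i * ∫⁻ ω, min 1 (e k i ω) ∂P := by
      intro k
      rw [lintegral_tsum fun i => (hterm k i).aemeasurable]
      exact tsum_congr fun i => lintegral_const_mul' _ _ ENNReal.coe_ne_top
    simp_rw [e1]
    refine tendsto_tsum_zero_of_dominated (b := fun i => ε i) (hε.trans ENNReal.one_lt_top).ne
      (fun k i => ?_) fun i => ?_
    · calc (ε i : ℝ≥0∞) * ∫⁻ ω, min 1 (e k i ω) ∂P ≤ ε i * ∫⁻ _, 1 ∂P := by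
            gcongr
            exact min_le_left _ _
        _ = ε i := by simp
    · have h1 := hN.isLimit.tendsto_min_lintegral h hN.measurable hN.null
        (measurable_one.indicator (hAm i)) (by
          rw [lintegral_indicator_one (hAm i)]
          exact measure_ne_top _ _)
      simp_rw [lintegral_indicator_one (hAm i)] at h1
      have := ENNReal.Tendsto.const_mul h1 (Or.inr (ENNReal.coe_ne_top (r := ε i)))
      rwa [mul_zero] at this
  have hmeas : TendstoInMeasure P (fun j ω => (d (α j) ω).toReal) atTop fun _ => 0 := by
    refine tendstoInMeasure_of_min (d := fun j => d (α j)) (fun j => (hdm _).aemeasurable)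
      (fun j => ae_of_all _ fun ω => ?_) ?_
    · rw [edist_eq_enorm_sub, sub_zero, Real.enorm_of_nonneg ENNReal.toReal_nonneg,
        ENNReal.ofReal_toReal (hd1 _ ω).ne]
    · exact tendsto_of_tendsto_of_tendsto_of_le_of_le tendsto_const_nhds
        (hlim.comp hα.tendsto_atTop) (fun _ => bot_le)
        fun j => lintegral_mono fun ω => min_le_right _ _
  obtain ⟨β, hβ, hae⟩ := hmeas.exists_seq_tendsto_ae
  refine ⟨β, hβ, ?_⟩
  filter_upwards [hae, hN.ae_good_approxCond h hG] with ω hω hfin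
  refine weaklyConverges_of_forall_mem_algebra (fun j => hfin _) (hN.good_random ω) fun S hS => ?_
  have hNω := hN.good_random ω
  obtain ⟨i, rfl⟩ : S ∈ range A := hA ▸ hS
  have h1 : Tendsto (fun j => d (α (β j)) ω) atTop (𝓝 0) := by
    rw [← ENNReal.tendsto_toReal_iff (fun j => (hd1 _ ω).ne) ENNReal.zero_ne_top]
    simpa using hω
  have hεi : (ε i : ℝ≥0∞) ≠ 0 := by exact_mod_cast (hε0 i).ne'
  have h2 : Tendsto (fun j => min 1 (e (α (β j)) i ω)) atTop (𝓝 0) := by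
    have h3 := ENNReal.Tendsto.const_mul (a := (ε i : ℝ≥0∞)⁻¹) h1
      (Or.inr (ENNReal.inv_ne_top.2 hεi))
    rw [mul_zero] at h3
    refine tendsto_of_tendsto_of_tendsto_of_le_of_le tendsto_const_nhds h3 (fun _ => bot_le)
      fun j => ?_
    calc min 1 (e (α (β j)) i ω) = (ε i : ℝ≥0∞)⁻¹ * (ε i * min 1 (e (α (β j)) i ω)) := by
          rw [← mul_assoc, ENNReal.inv_mul_cancel hεi ENNReal.coe_ne_top, one_mul]
      _ ≤ (ε i : ℝ≥0∞)⁻¹ * d (α (β j)) ω := by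
          gcongr
          exact ENNReal.le_tsum i
  refine tendsto_of_ennDist (measure_ne_top _ _) (h2.congr' ?_)
  filter_upwards [h2.eventually (gt_mem_nhds one_pos)] with j hj
  exact min_eq_right (le_of_not_ge fun hcon => absurd hj (not_lt.2 (le_min le_rfl hcon)))

theorem Admissible.isFiniteConditionalSystem [CompleteSpace X] [IsProbabilityMeasure P]
    (h : Admissible P φ 𝒬 B δ F) :
    IsFiniteConditionalSystem P φ 𝒬 B (IsCond P φ 𝒬 B fun η => IsFiniteMeasure η) := by
  intro ν N hN
  have hG := isFinitenessClass_finite (X := X)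
  refine ⟨hN.good, hN.measurable, hN.good_random, hN.weaklySubseqInProb h,
    hN.commonProperties h hG, fun f hf hfin => ?_⟩
  exact hN.exists_withDensity h hG hf.coe_nnreal_ennreal (isFiniteMeasure_withDensity hfin.ne)

theorem Admissible.isLocallyFiniteConditionalSystem [CompleteSpace X] [IsProbabilityMeasure P]
    (h : Admissible P φ 𝒬 B δ F) : IsLocallyFiniteConditionalSystem P φ 𝒬 B
      (IsCond P φ 𝒬 B fun η => IsLocallyFiniteMeasure η) := by
  intro ν N hN
  have hG := isFinitenessClass_locallyFinite (X := X)
  have := hN.good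
  refine ⟨hN.good, hN.measurable, hN.good_random, ⟨hN.ae_good_approxCond h hG, fun g hg hgc => ?_⟩,
    hN.commonProperties h hG, fun f hf hfin => ?_⟩
  · exact hN.isLimit.tendstoInMeasure h hN.measurable hN.null hg.measurable
      (hg.integrable_of_hasCompactSupport hgc)
  · refine hN.exists_withDensity h hG hf.coe_nnreal_ennreal ⟨fun x => ?_⟩
    obtain ⟨U, hU, hUf⟩ := hfin x
    exact ⟨U, hU, by rwa [withDensity_apply' _ U]⟩

end System

/-! ### The double integral formula -/

section DoubleIntegral

variable {X : Type*} [MetricSpace X] [MeasurableSpace X] [SecondCountableTopology X] [BorelSpace X]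
  {Ω : Type*} [MeasurableSpace Ω] {P : Measure Ω} {φ : ℝ≥0 → ℝ≥0∞} {𝒬 : ℕ → Set (Set X)}
  {B : Ω → Set X} {δ : ℝ≥0} {F : X → X → ℝ≥0∞} {G : Measure X → Prop}

/-- The `L²` limit of the masses and the `L¹` limit `N(A)` are limits in measure of the same
sequence, hence equal almost surely. -/
theorem IsEnergyLimit.memLp_two [IsProbabilityMeasure P] (h : Admissible P φ 𝒬 B δ F)
    {ν : Measure X} {N : Ω → Measure X} (hN : IsEnergyLimit P φ 𝒬 B ν N) {A : Set X}
    (hA : MeasurableSet A) :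
    MemLp (fun ω => (N ω A).toReal) 2 P ∧
      (∀ᶠ k in atTop, MemLp (fun ω => (approxCond P 𝒬 B k (ν.restrict A) ω univ).toReal) 2 P) ∧
      Tendsto (fun k => eLpNorm ((fun ω => (approxCond P 𝒬 B k (ν.restrict A) ω univ).toReal) -
        fun ω => (N ω A).toReal) 2 P) atTop (𝓝 0) := by
  have h𝒬 := h.partition
  have hB := h.randomSet
  have := hN.finite
  have := hN.finite_random
  obtain ⟨Z, hZ, hev, hlim⟩ := h.exists_limit_mass (energy_restrict_lt_top hN.energy_lt_top A)
    (restrict_compl_eq_zero hN.null A)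
  simp_rw [approxCond_apply_univ h𝒬 _ ν hA] at hlim hev ⊢
  have hm : ∀ k, Measurable fun ω => approxCond P 𝒬 B k ν ω A := fun k =>
    measurable_approxCond_apply h𝒬 hB k ν hA
  have hNA : Measurable fun ω => N ω A := (Measure.measurable_coe hA).comp hN.measurable
  have h1 : TendstoInMeasure P (fun k ω => (approxCond P 𝒬 B k ν ω A).toReal) atTop Z :=
    tendstoInMeasure_of_tendsto_eLpNorm two_ne_zero
      (fun k => (hm k).ennreal_toReal.aestronglyMeasurable) hZ.aestronglyMeasurable hlim
  have h2 : TendstoInMeasure P (fun k ω => (approxCond P 𝒬 B k ν ω A).toReal) atTop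
      fun ω => (N ω A).toReal := by
    refine tendstoInMeasure_of_min
      (d := fun k ω => ennDist (approxCond P 𝒬 B k ν ω A) (N ω A))
      (fun k => (measurable_ennDist (hm k) hNA).aemeasurable) (fun k => ?_) ?_
    · filter_upwards [ae_approxCond_lt_top h𝒬 hB hN.null hA (measure_ne_top ν A)] with ω hω
      rw [edist_eq_enorm_sub, enorm_toReal_sub (hω k).ne (measure_ne_top _ _)]
    · exact tendsto_of_tendsto_of_tendsto_of_le_of_le tendsto_const_nhds (hN.tendsto A hA)
        (fun _ => bot_le) fun k => lintegral_mono fun ω => min_le_right _ _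
  have h3 : Z =ᵐ[P] fun ω => (N ω A).toReal := tendstoInMeasure_ae_unique h1 h2
  exact ⟨(memLp_congr_ae h3).1 hZ, hev, hlim.congr fun k =>
    eLpNorm_congr_ae (EventuallyEq.rfl.sub h3)⟩

/-- The mutual energy is controlled by energies for `φ(r/2)`, and the growth condition makes these
finite. -/
theorem mutual_energy_lt_top (h : Admissible P φ 𝒬 B δ F) {ν τ : Measure X} [IsFiniteMeasure ν]
    [IsFiniteMeasure τ] (hν : energy φ ν < ∞) (hτ : energy φ τ < ∞) :
    ∫⁻ p, φ (nndist p.1 p.2) ∂(ν.prod τ) < ∞ := by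
  have h1 := two_mul_mutual_energy_le h.kernel ν τ
  have h2 := lintegral_half_kernel_lt_top h.delta_pos h.restriction h.kernel h.kernel_zero hν
  have h3 := lintegral_half_kernel_lt_top h.delta_pos h.restriction h.kernel h.kernel_zero hτ
  have h4 := h1.trans_lt (ENNReal.add_lt_top.2 ⟨h2, h3⟩)
  by_contra hcon
  rw [not_lt, top_le_iff] at hcon
  rw [hcon, ENNReal.mul_top two_ne_zero] at h4
  exact lt_irrefl _ h4

theorem measurable_prod_random {M N : Ω → Measure X} (hM : Measurable M) (hN : Measurable N)
    (hMf : ∀ ω, IsFiniteMeasure (M ω)) (hNf : ∀ ω, IsFiniteMeasure (N ω)) :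
    Measurable fun ω => (M ω).prod (N ω) := by
  refine Measurable.measure_of_isPiSystem generateFrom_prod.symm isPiSystem_prod ?_ ?_
  · rintro _ ⟨A, hA, A', hA', rfl⟩
    simp_rw [Measure.prod_prod]
    exact ((Measure.measurable_coe hA).comp hM).mul ((Measure.measurable_coe hA').comp hN)
  · simp_rw [← univ_prod_univ, Measure.prod_prod]
    exact ((Measure.measurable_coe MeasurableSet.univ).comp hM).mul
      ((Measure.measurable_coe MeasurableSet.univ).comp hN)

/-- The mean of the product of the conditional measures of two measures of finite energy. -/
theorem IsEnergyLimit.bind_prod [IsProbabilityMeasure P] (h : Admissible P φ 𝒬 B δ F)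
    {ν τ : Measure X} {M N : Ω → Measure X} (hM : IsEnergyLimit P φ 𝒬 B ν M)
    (hN : IsEnergyLimit P φ 𝒬 B τ N) :
    P.bind (fun ω => (M ω).prod (N ω)) = (ν.prod τ).withDensity fun p => F p.1 p.2 := by
  have := hM.finite
  have := hN.finite
  have := hM.finite_random
  have := hN.finite_random
  have hFm := h.measurable
  have hmut := mutual_energy_lt_top h hM.energy_lt_top hN.energy_lt_top
  have hFfin := h.lintegral_lt_top hmut
  have hmeas := measurable_prod_random hM.measurable hN.measurable hM.finite_random
    hN.finite_random
  -- On rectangles this is `Admissible.integral_mul_limit` for the restricted measures. Both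
  -- measures are finite, so rectangles determine them.
  have hrect : ∀ A A' : Set X, MeasurableSet A → MeasurableSet A' →
      P.bind (fun ω => (M ω).prod (N ω)) (A ×ˢ A') =
        (ν.prod τ).withDensity (fun p => F p.1 p.2) (A ×ˢ A') := by
    intro A A' hA hA'
    rw [Measure.bind_apply (hA.prod hA') hmeas.aemeasurable,
      withDensity_apply _ (hA.prod hA'), ← Measure.prod_restrict]
    simp_rw [Measure.prod_prod]
    obtain ⟨hZ, hZev, hZlim⟩ := hM.memLp_two h hA
    obtain ⟨hW, hWev, hWlim⟩ := hN.memLp_two h hA'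
    have hle : (ν.restrict A).prod (τ.restrict A') ≤ ν.prod τ := by
      rw [Measure.prod_restrict]
      exact Measure.restrict_le_self
    have key := h.integral_mul_limit (energy_restrict_lt_top hM.energy_lt_top A)
      (energy_restrict_lt_top hN.energy_lt_top A')
      ((lintegral_mono' hle le_rfl).trans_lt hmut) (restrict_compl_eq_zero hM.null A)
      (restrict_compl_eq_zero hN.null A') hZ hW hZev hWev hZlim hWlim
    have hint : Integrable (fun ω => (M ω A).toReal * (N ω A').toReal) P := hZ.integrable_mul hW
    have e := ofReal_integral_eq_lintegral_ofReal hint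
      (ae_of_all _ fun ω => mul_nonneg ENNReal.toReal_nonneg ENNReal.toReal_nonneg)
    rw [key, ENNReal.ofReal_toReal ((lintegral_mono' hle le_rfl).trans_lt hFfin).ne] at e
    rw [e]
    refine lintegral_congr fun ω => ?_
    rw [← ENNReal.toReal_mul, ENNReal.ofReal_toReal
      (ENNReal.mul_ne_top (measure_ne_top _ _) (measure_ne_top _ _))]
  have hfin : IsFiniteMeasure ((ν.prod τ).withDensity fun p => F p.1 p.2) :=
    isFiniteMeasure_withDensity hFfin.ne
  have hfin' : IsFiniteMeasure (P.bind fun ω => (M ω).prod (N ω)) := ⟨by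
    rw [← univ_prod_univ, hrect _ _ MeasurableSet.univ MeasurableSet.univ]
    exact measure_lt_top _ _⟩
  exact Measure.ext_prod fun {A A'} hA hA' => hrect A A' hA hA'

theorem Admissible.ae_lt_top [IsProbabilityMeasure P] (h : Admissible P φ 𝒬 B δ F)
    {ν τ : Measure X} [IsFiniteMeasure ν] [IsFiniteMeasure τ] (hν : energy φ ν < ∞)
    (hτ : energy φ τ < ∞) : ∀ᵐ p ∂ν.prod τ, F p.1 p.2 < ∞ :=
  MeasureTheory.ae_lt_top h.measurable (h.lintegral_lt_top (mutual_energy_lt_top h hν hτ)).ne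

/-- By property (vi), any version has as values on sets of finite measure the `L¹` limits of
`𝒞ₖ(ν_R)`, which also define `N`. -/
theorem CommonProperties.ae_eq [CompleteSpace X] [IsProbabilityMeasure P]
    {R : Measure X → (Ω → Measure X) → Prop} {ν : Measure X} {M N : Ω → Measure X}
    (hM : CommonProperties P φ 𝒬 B R ν M) (hMm : Measurable M)
    (hN : IsCond P φ 𝒬 B G ν N) (h : Admissible P φ 𝒬 B δ F) (hG : IsFinitenessClass G) :
    ∀ᵐ ω ∂P, M ω = N ω := by
  have := hG.locallyFinite hN.good
  have h𝒬 := h.partition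
  have hB := h.randomSet
  obtain ⟨S, -, -, hS, -⟩ := hM.exists_limit
  have hfin : ∀ {A : Set X}, MeasurableSet A → ν A < ∞ → ∀ᵐ ω ∂P, M ω A < ∞ := by
    intro A hA hνA
    filter_upwards [hS (fun _ => A) fun _ => ⟨hA, hνA⟩] with ω hω
    exact (hω 0).1
  refine ae_eq_of_forall_ae_eq (V := spanningSets ν) (iUnion_spanningSets ν)
    (ae_all_iff.2 fun i => hfin (measurableSet_spanningSets ν i) (measure_spanningSets_lt_top ν i))
    fun i A hA => ?_
  have hAm : MeasurableSet (A ∩ spanningSets ν i) := hA.inter (measurableSet_spanningSets ν i)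
  have hνA : ν (A ∩ spanningSets ν i) < ∞ :=
    (measure_mono inter_subset_right).trans_lt (measure_spanningSets_lt_top ν i)
  have hRA := (regularPart_le φ ν (A ∩ spanningSets ν i)).trans_lt hνA
  refine ae_eq_of_tendsto (fun k => measurable_approxCond_apply h𝒬 hB k (regularPart φ ν) hAm)
    ((Measure.measurable_coe hAm).comp hMm) ((Measure.measurable_coe hAm).comp hN.measurable) ?_
    (hN.isLimit _ hAm hRA)
  refine (hM.tendsto_L1 _ hAm hνA).congr fun k => ?_
  rw [eLpNorm_one_eq_lintegral_enorm]
  refine lintegral_congr_ae ?_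
  filter_upwards [hfin hAm hνA, ae_approxCond_lt_top h𝒬 hB (ν := regularPart φ ν)
    (regularPart_coreSet hN.null) hAm hRA.ne] with ω h1 h2
  exact enorm_toReal_sub (h2 k).ne h1.ne

theorem DoubleIntegralFormula.congr_ae {νR τR : Measure X} {M N M' N' : Ω → Measure X}
    (h : DoubleIntegralFormula P F νR τR M N) (hM : ∀ᵐ ω ∂P, M' ω = M ω)
    (hN : ∀ᵐ ω ∂P, N' ω = N ω) : DoubleIntegralFormula P F νR τR M' N' := by
  intro f hf hfin
  obtain ⟨h1, h2, h3, h4⟩ := h f hf hfin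
  have e : (fun ω => ∫ y, ∫ x, f (x, y) ∂M ω ∂N ω) =ᵐ[P]
      fun ω => ∫ y, ∫ x, f (x, y) ∂M' ω ∂N' ω := by
    filter_upwards [hM, hN] with ω hω hω'
    rw [hω, hω']
  refine ⟨h1, ?_, h3.congr e, by rw [← integral_congr_ae e]; exact h4⟩
  filter_upwards [h2, hM, hN] with ω hω hω1 hω2
  rw [hω1, hω2]
  exact hω

/-- Decomposing into pieces of finite energy shows that the random product measure has mean `F d(ν_R
⊗ τ_R)`. Then `integral_of_mean` and Fubini's theorem give the formula. -/
theorem IsCond.doubleIntegralFormula [CompleteSpace X] [IsProbabilityMeasure P]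
    (h : Admissible P φ 𝒬 B δ F) (hG : IsFinitenessClass G) {ν τ : Measure X}
    {M N : Ω → Measure X} (hM : IsCond P φ 𝒬 B G ν M) (hN : IsCond P φ 𝒬 B G τ N) :
    DoubleIntegralFormula P F (regularPart φ ν) (regularPart φ τ) M N := by
  have := hG.locallyFinite hM.good
  have := hG.locallyFinite hN.good
  have h𝒬 := h.partition
  have hB := h.randomSet
  have hFm := h.measurable
  obtain ⟨νs, Ms, hνR, hMs⟩ := h.exists_energyLimit_pieces hM.null
  obtain ⟨τs, Ns, hτR, hNs⟩ := h.exists_energyLimit_pieces hN.null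
  have hMsm := measurable_measure_sum fun i => (hMs i).measurable
  have hNsm := measurable_measure_sum fun i => (hNs i).measurable
  have hMeq : ∀ᵐ ω ∂P, M ω = Measure.sum fun i => Ms i ω :=
    (isLimit_sum h𝒬 hB hνR hMs).ae_eq h𝒬 hB hMsm hM.null hM.isLimit hM.measurable
  have hNeq : ∀ᵐ ω ∂P, N ω = Measure.sum fun i => Ns i ω :=
    (isLimit_sum h𝒬 hB hτR hNs).ae_eq h𝒬 hB hNsm hN.null hN.isLimit hN.measurable
  have hνf := fun i => (hMs i).finite
  have hτf := fun i => (hNs i).finite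
  have hMf := fun i => (hMs i).finite_random
  have hNf := fun i => (hNs i).finite_random
  refine DoubleIntegralFormula.congr_ae ?_ hMeq hNeq
  have hprodR : (regularPart φ ν).prod (regularPart φ τ) =
      Measure.sum fun p : ℕ × ℕ => (νs p.1).prod (τs p.2) := by
    rw [hνR, hτR, Measure.prod_sum]
  let K : Ω → Measure (X × X) := fun ω =>
    (Measure.sum fun i => Ms i ω).prod (Measure.sum fun i => Ns i ω)
  have hKsum : ∀ ω, K ω = Measure.sum fun p : ℕ × ℕ => (Ms p.1 ω).prod (Ns p.2 ω) := fun ω =>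
    Measure.prod_sum _ _
  have hpm : ∀ p : ℕ × ℕ, Measurable fun ω => (Ms p.1 ω).prod (Ns p.2 ω) := fun p =>
    measurable_prod_random (hMs _).measurable (hNs _).measurable (hMf _) (hNf _)
  have hpg : ∀ (g : X × X → ℝ≥0∞), Measurable g → ∀ p : ℕ × ℕ,
      Measurable fun ω => ∫⁻ z, g z ∂(Ms p.1 ω).prod (Ns p.2 ω) := fun g hg p =>
    (Measure.measurable_lintegral hg).comp (hpm p)
  have hm : ∀ g : X × X → ℝ≥0∞, Measurable g → AEMeasurable (fun ω => ∫⁻ z, g z ∂K ω) P := by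
    intro g hg
    simp_rw [hKsum, lintegral_sum_measure]
    exact (Measurable.tsum (hpg g hg)).aemeasurable
  have hE : ∀ g : X × X → ℝ≥0∞, Measurable g → ∫⁻ ω, ∫⁻ z, g z ∂K ω ∂P =
      ∫⁻ z, g z ∂((regularPart φ ν).prod (regularPart φ τ)).withDensity fun p => F p.1 p.2 := by
    intro g hg
    rw [hprodR, withDensity_sum]
    simp_rw [hKsum, lintegral_sum_measure]
    rw [lintegral_tsum fun p => (hpg g hg p).aemeasurable]
    refine tsum_congr fun p => ?_
    rw [← (hMs p.1).bind_prod h (hNs p.2),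
      Measure.lintegral_bind (hpm p).aemeasurable hg.aemeasurable]
  -- `F` may be `∞` on a null set; finiteness almost everywhere justifies the use of `toReal` for
  -- the density.
  have hFfin : ∀ᵐ p ∂(regularPart φ ν).prod (regularPart φ τ), F p.1 p.2 < ∞ := by
    rw [hprodR, Measure.ae_sum_iff]
    exact fun p => h.ae_lt_top (hMs _).energy_lt_top (hNs _).energy_lt_top
  intro f hf hfin
  have hfi' : ∫⁻ p, F p.1 p.2 * ‖f p‖ₑ ∂(regularPart φ ν).prod (regularPart φ τ) < ∞ := by
    have hFf : Measurable fun p : X × X => F p.1 p.2 * ‖f p‖ₑ := hFm.mul hf.enorm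
    rw [lintegral_prod_symm _ hFf.aemeasurable]
    exact hfin
  have hfi : Integrable f
      (((regularPart φ ν).prod (regularPart φ τ)).withDensity fun p => F p.1 p.2) := by
    refine ⟨hf.aestronglyMeasurable, ?_⟩
    rw [HasFiniteIntegral, lintegral_withDensity_eq_lintegral_mul _ hFm hf.enorm]
    exact hfi'
  obtain ⟨h1, h2, h3⟩ := integral_of_mean hm hE hf hfi
  have e : (fun ω => ∫ z, f z ∂K ω) =ᵐ[P] fun ω => ∫ y, ∫ x, f (x, y)
      ∂(Measure.sum fun i => Ms i ω) ∂(Measure.sum fun i => Ns i ω) := by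
    filter_upwards [h1] with ω hω
    exact integral_prod_symm _ hω
  have hint : Integrable (fun z : X × X => (F z.1 z.2).toReal * f z)
      ((regularPart φ ν).prod (regularPart φ τ)) :=
    (integrable_withDensity_iff_integrable_smul' hFm hFfin).1 hfi
  refine ⟨hint, h1, h2.congr e, ?_⟩
  rw [← integral_congr_ae e, h3, integral_withDensity_eq_integral_toReal_smul hFm hFfin]
  exact integral_prod_symm _ hint

/-- This follows from `F ≤ c φ` and `ν_R ≤ ν`, `τ_R ≤ τ`. -/
theorem Admissible.lintegral_lt_top_of_kernel [IsProbabilityMeasure P]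
    (h : Admissible P φ 𝒬 B δ F) {ν τ : Measure X} [IsLocallyFiniteMeasure ν]
    [IsLocallyFiniteMeasure τ] {f : X × X → ℝ}
    (hfin : ∫⁻ y, ∫⁻ x, φ (nndist x y) * ‖f (x, y)‖ₑ ∂ν ∂τ < ∞) :
    ∫⁻ y, ∫⁻ x, F x y * ‖f (x, y)‖ₑ ∂regularPart φ ν ∂regularPart φ τ < ∞ := by
  obtain ⟨c, -, hc⟩ := h.exists_le
  calc ∫⁻ y, ∫⁻ x, F x y * ‖f (x, y)‖ₑ ∂regularPart φ ν ∂regularPart φ τ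
      ≤ ∫⁻ y, ∫⁻ x, F x y * ‖f (x, y)‖ₑ ∂ν ∂τ :=
        lintegral_mono' (regularPart_le φ τ) fun y => lintegral_mono' (regularPart_le φ ν) le_rfl
    _ ≤ ∫⁻ y, ∫⁻ x, c * (φ (nndist x y) * ‖f (x, y)‖ₑ) ∂ν ∂τ := by
        refine lintegral_mono fun y => lintegral_mono fun x => ?_
        rw [← mul_assoc]
        exact mul_le_mul_left (hc x y) _
    _ = c * ∫⁻ y, ∫⁻ x, φ (nndist x y) * ‖f (x, y)‖ₑ ∂ν ∂τ := by
        simp_rw [lintegral_const_mul' _ _ ENNReal.coe_ne_top]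
    _ < ∞ := ENNReal.mul_lt_top ENNReal.coe_lt_top hfin

/-- The conditional measures of two measures exist, and every version satisfies the formula. -/
theorem Admissible.exists_and_doubleIntegralFormula [CompleteSpace X] [IsProbabilityMeasure P]
    (h : Admissible P φ 𝒬 B δ F) (hG : IsFinitenessClass G) {ν τ : Measure X} (hν : G ν)
    (hτ : G τ) (hν0 : ν (coreSet 𝒬)ᶜ = 0) (hτ0 : τ (coreSet 𝒬)ᶜ = 0)
    {C : Measure X → (Ω → Measure X) → Prop} (hC : ∀ η N, IsCond P φ 𝒬 B G η N → C η N)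
    (hC' : ∀ η N, C η N → Measurable N ∧
      ∃ R : Measure X → (Ω → Measure X) → Prop, CommonProperties P φ 𝒬 B R η N) :
    (∃ M, C ν M) ∧ (∃ N, C τ N) ∧ ∀ M N, C ν M → C τ N →
      DoubleIntegralFormula P F (regularPart φ ν) (regularPart φ τ) M N := by
  obtain ⟨M₀, hM₀⟩ := h.exists_isCond hG hν hν0
  obtain ⟨N₀, hN₀⟩ := h.exists_isCond hG hτ hτ0
  refine ⟨⟨M₀, hC _ _ hM₀⟩, ⟨N₀, hC _ _ hN₀⟩, fun M N hM hN => ?_⟩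
  obtain ⟨hMm, R, hMR⟩ := hC' _ _ hM
  obtain ⟨hNm, R', hNR⟩ := hC' _ _ hN
  exact (IsCond.doubleIntegralFormula h hG hM₀ hN₀).congr_ae (hMR.ae_eq hMm hM₀ h hG)
    (hNR.ae_eq hNm hN₀ h hG)

end DoubleIntegral

end CondMeas

theorem mainTheorem2
    {X : Type*} [MetricSpace X] [CompleteSpace X] [SecondCountableTopology X]
    [MeasurableSpace X] [BorelSpace X]
    {Ω : Type*} [MeasurableSpace Ω] (P : Measure Ω) [IsProbabilityMeasure P]
    (φ : ℝ≥0 → ℝ≥0∞) (hφ : CondMeas.IsRegularityKernel φ)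
    (𝒬 : ℕ → Set (Set X)) (h𝒬 : CondMeas.IsPartitionSequence 𝒬)
    (B : Ω → Set X) (hB : CondMeas.IsRandomClosedSet P 𝒬 B)
    (hφ0 : φ 0 = ∞)
    (hsize : CondMeas.SameSize 𝒬)
    (hlower : CondMeas.LowerHitting P φ 𝒬 B)
    (hδ : ∃ δ : ℝ≥0, 0 < δ ∧ δ < 1 ∧ CondMeas.KernelRestriction φ δ ∧
      CondMeas.CapacityIndependence P φ 𝒬 B δ ∧ CondMeas.BoundedSubdivision 𝒬 δ)
    (F : X → X → ℝ≥0∞)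
    (hF : ∀ x y, F x y = CondMeas.lowerF P 𝒬 B x y ∧ F x y = CondMeas.upperF P 𝒬 B x y)
    (hcap : ∀ D : Set X, IsCompact D → D ⊆ CondMeas.coreSet 𝒬 → CondMeas.capacity φ D = 0 →
      ∀ᵐ ω ∂P, B ω ∩ D = ∅)
    (ν τ : Measure X)
    (hν : ν (CondMeas.coreSet 𝒬)ᶜ = 0) (hτ : τ (CondMeas.coreSet 𝒬)ᶜ = 0) :
    (IsFiniteMeasure ν → IsFiniteMeasure τ →
      (∃ M, CondMeas.IsConditionalMeasure P φ 𝒬 B ν M) ∧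
      (∃ N, CondMeas.IsConditionalMeasure P φ 𝒬 B τ N) ∧
      ∀ M N, CondMeas.IsConditionalMeasure P φ 𝒬 B ν M →
        CondMeas.IsConditionalMeasure P φ 𝒬 B τ N →
        CondMeas.DoubleIntegralFormula P F (CondMeas.regularPart φ ν) (CondMeas.regularPart φ τ)
          M N) ∧
    (LocallyCompactSpace X → IsLocallyFiniteMeasure ν → IsLocallyFiniteMeasure τ →
      (∃ M, CondMeas.IsConditionalMeasureLoc P φ 𝒬 B ν M) ∧
      (∃ N, CondMeas.IsConditionalMeasureLoc P φ 𝒬 B τ N) ∧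
      ∀ M N, CondMeas.IsConditionalMeasureLoc P φ 𝒬 B ν M →
        CondMeas.IsConditionalMeasureLoc P φ 𝒬 B τ N →
        CondMeas.DoubleIntegralFormula P F (CondMeas.regularPart φ ν) (CondMeas.regularPart φ τ)
          M N) ∧
    ((IsFiniteMeasure ν ∧ IsFiniteMeasure τ) ∨
        (LocallyCompactSpace X ∧ IsLocallyFiniteMeasure ν ∧ IsLocallyFiniteMeasure τ) →
      ∀ f : X × X → ℝ, Measurable f →
        ∫⁻ y, ∫⁻ x, φ (nndist x y) * ‖f (x, y)‖ₑ ∂ν ∂τ < ∞ →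
        ∫⁻ y, ∫⁻ x, F x y * ‖f (x, y)‖ₑ
          ∂(CondMeas.regularPart φ ν) ∂(CondMeas.regularPart φ τ) < ∞) := by
  obtain ⟨δ, hδ0, -, hδr, hδi, hδs⟩ := hδ
  have h : CondMeas.Admissible P φ 𝒬 B δ F :=
    ⟨hφ, hφ0, h𝒬, hB, hlower, hδ0, hδr, hδi, hδs, fun x y => (hF x y).1, fun x y => (hF x y).2, hcap⟩
  -- The two settings differ only in the finiteness class. Of the definition of a version, only its
  -- measurability and the common properties are used.
  refine ⟨fun hνf hτf => ?_, fun _ hνf hτf => ?_, fun hfin f _ hf => ?_⟩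
  · exact h.exists_and_doubleIntegralFormula CondMeas.isFinitenessClass_finite hνf hτf hν hτ
      (fun η N hN => ⟨_, h.isFiniteConditionalSystem, hN⟩) fun η N ⟨R, hR, hN⟩ =>
        ⟨(hR η N hN).2.1, R, (hR η N hN).2.2.2.2.1⟩
  · exact h.exists_and_doubleIntegralFormula CondMeas.isFinitenessClass_locallyFinite hνf hτf hν hτ
      (fun η N hN => ⟨_, h.isLocallyFiniteConditionalSystem, hN⟩) fun η N ⟨R, hR, hN⟩ =>
        ⟨(hR η N hN).2.1, R, (hR η N hN).2.2.2.2.1⟩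
  · rcases hfin with ⟨_, _⟩ | ⟨_, _, _⟩ <;> exact h.lintegral_lt_top_of_kernel hf
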